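/- Let $M$ be a closed oriented triangulated PL 4-manifold. (Triangulation is meant in the broad sense: every simplex has distinct vertices, but several simplices may have the same vertices; the link of every simplex is a PL sphere.) Write $s,t,u$ for 2-, 3- and 4-simplices. Let the following be fixed. * A simplicial 2-cocycle $\omega\in Z^2(M,\mathbb C)$ with $\omega_s\neq 0$ for all triangles $s$. * For every tetrahedron $t=ijkl$ a square root $K_t=K_{ijkl}$, $K_{ijkl}^2=\omega_{ijk}\,\omega_{ijl}\,\omega_{ikl}\,\omega_{jkl}$, which changes its sign together with the orientation of $t$, and such that in every 4-simplex the product of the five $K_t$ equals the product of the ten $\omega_s$ (all taken in one order of the vertices). * A basis $(c_a)$ of the space $Z^2(M,\mathbb C)$. **Edge operators.** Edge operators are $d_{ij}^{(u)}=\sum_{t}(\beta_{ij,t}\,\partial_t+\gamma^{(u)}_{ij,t}\,\vartheta_t)$ for the oriented edges $ij$ of the 4-simplices $u$. The sum is over the tetrahedra $t\subset u$ containing $ij$, the $\vartheta_t$ are Grassmann variables, $\partial_t=\partial/\partial\vartheta_t$, and $\beta_{ij,t}$ does not depend on $u$. They are required to satisfy: * $d_{ji}=-d_{ij}$, and $\sum_j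 d_{ij}=0$ in every $u$; * $\sum_{b\subset u}\nu_b\, d_b=0$ whenever $\omega|_u=\delta\nu$; * for every ordering $ijklm$ of the vertices of $u$, with $t=ijkl$ and $\epsilon=1$ or $-1$ according to whether $ijklm$ gives the orientation of $u$ or not, $$\beta_{ij,t}\gamma_{ik,t}+\beta_{ik,t}\gamma_{ij,t}=\frac{\epsilon}{\omega_{ijk}},\qquad \beta_{ij,t}\gamma_{ik,t}-\beta_{ik,t}\gamma_{ij,t}=-\frac{\epsilon\,K_{ijkl}}{\omega_{ijk}\,\omega_{ijl}\,\omega_{ikl}}.$$ Let $F^{(u)}$ be the skew-symmetric matrix, with rows and columns indexed by the tetrahedra of $u$, such that all edge operators of $u$ annihilate $\mathcal W_u=\exp\bigl(-\frac12\sum_{t,t'}\vartheta_tF^{(u)}_{tt'}\vartheta_{t'}\bigr)$, that is, $\gamma^{(u)}=\beta F^{(u)}$. The existence of such matrices is assumed. **Torsion.** Consider the sequence $$0\to\mathbb C\xrightarrow{f_1}Z^2(M,\mathbb C)\xrightarrow{f_2}\mathbb C^{\{t\}}\xrightarrow{f_3}\mathbb C^{\{t\}}\xrightarrow{f_2^{\mathrm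 T}}Z^2(M,\mathbb C)^*\xrightarrow{f_1^{\mathrm T}}\mathbb C\to0,$$ where $f_1(1)=\omega$; $f_2(c)_t=\sum_{b\subset t}\nu_b\beta_{b,t}$ with $\delta\nu=c|_t$; and $f_3=-\frac12\sum_uF^{(u)}$. It is assumed to be an acyclic complex. Put $$\sqrt\tau=\frac{\operatorname{minor}f_1\cdot\operatorname{Pf}(\text{submatrix of }f_3)}{\operatorname{minor}f_2}.$$ Here one row $a$ of $f_1$ is chosen, $\operatorname{minor} f_2$ uses all columns except $a$ and an equal number of rows, and the submatrix of $f_3$ uses the rows and columns with the remaining numbers. All three square submatrices are required to be nondegenerate. **The quantity $I$.** Number the vertices by distinct natural numbers. Let $q_s$ be square roots of the values $\omega_{ijk}$, $s=ijk$, $i<j<k$, such that $K_{ijkl}=q_{ijk}q_{ijl}q_{ikl}q_{jkl}$ for all tetrahedra $ijkl$ with $i<j<k<l$. For a 4-simplex $u=ijklm$ whose orientation is given by the order $ijklm$, with $i<j$, put $\eta_u=\sqrt{\mathrm H_u}$, where $$\mathrm H_u=\frac{\beta_{ij,ijkl}\;q_{\{ijk\}}\,q_{\{ijl\}}\,q_{\{ijm\}}\,q_{\{klm\}}}{F_{iklm,ijkm}F_{jklm,ijlm}-F_{iklm,ijlm}F_{jklm,ijkm}},$$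 $F=F^{(u)}$, and $\{ijk\}$ means that the three vertices are put in increasing order; any such order of the vertices of $u$ with a nonzero denominator may be used. Finally, let $$I=\prod_sq_s^{-1}\;\prod_u\eta_u\cdot\sqrt\tau.$$ **Theorem.** With $\omega$, the $K_t$, the orientation of $M$ and the basis of $Z^2(M,\mathbb C)$ fixed, $I$ taken up to a sign does not depend on the numbering of the vertices. More precisely, if $x$ is a value of $I$ calculated for one numbering, then for any numbering the possible values of $I$ are exactly $x$ and $-x$, whatever admissible edge operators, signs of the roots $q_s$ and $\eta_u$, vertex orders in the formulas for $\mathrm H_u$, and minors (with any order of their rows and columns) are used. -/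

import Mathlib

open Finset

namespace ExoticTorsion

/-! ### Finite simplicial complexes and combinatorial spheres

Here a finite simplicial complex is a finite family of finite sets that contains the empty set and
all subsets of its members; the dimension of a simplex is its cardinality minus one, and the complex
consisting of the empty simplex only is the sphere of dimension `-1`. -/

section Complexes

/-- The family is closed under taking subsets and contains the empty simplex. -/
def IsComplex {α : Type*} (K : Finset (Finset α)) : Prop :=
  ∅ ∈ K ∧ ∀ σ ∈ K, ∀ τ, τ ⊆ σ → τ ∈ K

/-- The link of a simplex in a complex. -/
def link (K : Finset (Finset ℕ)) (σ : Finset ℕ) : Finset (Finset ℕ) :=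
  K.filter fun τ => Disjoint σ τ ∧ σ ∪ τ ∈ K

/-- Starring the complex `K` at its simplex `σ` with the new vertex `a`: the simplices containing
`σ` are replaced by the simplices of the join `a * ∂σ * link σ`. -/
def starring (K : Finset (Finset ℕ)) (σ : Finset ℕ) (a : ℕ) : Finset (Finset ℕ) :=
  (K.filter fun τ => ¬ σ ⊆ τ) ∪
    (σ.ssubsets ×ˢ link K σ).image fun x => insert a (x.1 ∪ x.2)

/-- `L` is an elementary stellar subdivision of the complex `K`. -/
def IsStellarSubdivision (K L : Finset (Finset ℕ)) : Prop :=
  IsComplex K ∧ ∃ σ ∈ K, σ.Nonempty ∧ ∃ a : ℕ, {a} ∉ K ∧ L = starring K σ a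

/-- Stellar equivalence (which, for finite complexes, is the same as PL homeomorphism). -/
def StellarEquivalent : Finset (Finset ℕ) → Finset (Finset ℕ) → Prop :=
  Relation.EqvGen IsStellarSubdivision

/-- `K` is a combinatorial (PL) sphere of dimension `m - 1`: after naming its vertices by natural
numbers it is stellar equivalent to the boundary of an `m`-dimensional simplex. -/
def IsCombinatorialSphere {α : Type*} (m : ℕ) (K : Finset (Finset α)) : Prop :=
  ∃ f : α ↪ ℕ, StellarEquivalent (K.image fun s => s.map f) (range (m + 1)).ssubsets

end Complexes

/-! ### Triangulations of closed PL four-manifolds -/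

/-- A triangulation in the broad sense: a poset `C` of (nonempty) simplices, ordered by "is a face
of". Every simplex has pairwise distinct vertices and every nonempty subset of its vertices spans
exactly one face of it, but several simplices of positive dimension may have the same vertices. -/
structure Triangulation (V C : Type*) [PartialOrder C] where
  /-- the set of vertices of a simplex -/
  vert : C → Finset V
  vert_nonempty : ∀ σ, (vert σ).Nonempty
  existsUnique_vertex : ∀ v, ∃! σ, vert σ = {v}
  vert_mono : ∀ σ τ, σ ≤ τ → vert σ ⊆ vert τ
  existsUnique_face : ∀ τ, ∀ A, A ⊆ vert τ → A.Nonempty → ∃! σ, σ ≤ τ ∧ vert σ = A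

namespace Triangulation

variable {V C : Type*} [DecidableEq V] [PartialOrder C] (T : Triangulation V C)

/-- The simplex `σ` has the pairwise distinct vertices `p 0, …, p (n - 1)`. -/
def Spells {n : ℕ} (σ : C) (p : Fin n → V) : Prop :=
  Function.Injective p ∧ univ.image p = T.vert σ

open Classical in
/-- The face of `τ` with vertices `p 0, …, p (n - 1)` (and `τ` itself if there is no such face). -/
noncomputable def face {n : ℕ} (τ : C) (p : Fin n → V) : C :=
  if h : ∃ σ, σ ≤ τ ∧ T.vert σ = univ.image p then h.choose else τ

/-- The set of simplices with `n` vertices. -/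
def cells [Fintype C] (n : ℕ) : Finset C := univ.filter fun σ => (T.vert σ).card = n

open Classical in
/-- The barycentric subdivision of the link of `σ`: the complex of all chains of simplices that
properly contain `σ`. -/
noncomputable def linkSubdivision [Fintype C] (_T : Triangulation V C) (σ : C) : Finset (Finset C) :=
  univ.filter fun c => (∀ τ ∈ c, σ < τ) ∧ IsChain (· ≤ ·) (c : Set C)

/-- `T` triangulates a closed PL manifold of dimension four: the link of every simplex `σ` is a PL
sphere of dimension `4 - (number of vertices of σ)`. -/
def IsClosedFourManifold [Fintype C] : Prop :=
  ∀ σ, ∃ m, m + (T.vert σ).card = 5 ∧ IsCombinatorialSphere m (T.linkSubdivision σ)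

/-- An orientation of every 4-simplex, such that neighbouring 4-simplices are oriented
consistently. The value is `1` on those orderings of the vertices of a 4-simplex that give its
orientation and `-1` on the others; an ordering `p` of its vertices orients its face without the
vertex `p 4` by the order of the remaining vertices. -/
structure IsOrientation (o : C → (Fin 5 → V) → ℤ) : Prop where
  value : ∀ u p, T.Spells u p → o u p = 1 ∨ o u p = -1
  perm : ∀ u p, T.Spells u p → ∀ π : Equiv.Perm (Fin 5),
    o u (p ∘ π) = (Equiv.Perm.sign π : ℤ) * o u p
  consistent : ∀ u u' p p', u ≠ u' → T.Spells u p → T.Spells u' p' →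
    p ∘ Fin.castSucc = p' ∘ Fin.castSucc →
    T.face u (p ∘ Fin.castSucc) = T.face u' (p' ∘ Fin.castSucc) → o u' p' = - o u p

/-- The space of simplicial 2-cocycles with complex coefficients: `c s ![i, j, k]` is the value on
the triangle `s` with vertices `i, j, k`, oriented by their order. -/
def cocycles : Submodule ℂ (C → (Fin 3 → V) → ℂ) where
  carrier := {c |
    (∀ s p, ¬ T.Spells s p → c s p = 0) ∧
    (∀ s p, T.Spells s p → ∀ π : Equiv.Perm (Fin 3),
      c s (p ∘ π) = ((Equiv.Perm.sign π : ℤ) : ℂ) * c s p) ∧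
    (∀ t (p : Fin 4 → V), T.Spells t p →
      ∑ a : Fin 4, (-1 : ℂ) ^ (a : ℕ) * c (T.face t (p ∘ a.succAbove)) (p ∘ a.succAbove) = 0)}
  zero_mem' := by simp
  add_mem' := by
    rintro c d ⟨hc1, hc2, hc3⟩ ⟨hd1, hd2, hd3⟩
    refine ⟨fun s p h => by simp [hc1 s p h, hd1 s p h], fun s p h π => ?_, fun t p h => ?_⟩
    · simp only [Pi.add_apply]
      rw [hc2 s p h π, hd2 s p h π, mul_add]
    · simp only [Pi.add_apply, mul_add, sum_add_distrib]
      rw [hc3 t p h, hd3 t p h, add_zero]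
  smul_mem' := by
    rintro z c ⟨hc1, hc2, hc3⟩
    refine ⟨fun s p h => by simp [hc1 s p h], fun s p h π => ?_, fun t p h => ?_⟩
    · simp only [Pi.smul_apply, smul_eq_mul]
      rw [hc2 s p h π]
      ring
    · simp only [Pi.smul_apply, smul_eq_mul, mul_left_comm _ z, ← mul_sum]
      rw [hc3 t p h, mul_zero]

/-! ### The square roots `K_t`, edge operators and pentachoron weights -/

/-- Admissible square roots `K_t`: for a tetrahedron `t` the square of `K_t` is the product of the
values of `ω` on the four faces, `K_t` changes its sign together with the orientation of `t`, and
in every 4-simplex the product of the five `K_t` is the product of the ten values of `ω`. -/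
structure IsSquareRoots (ω : C → (Fin 3 → V) → ℂ) (K : C → (Fin 4 → V) → ℂ) : Prop where
  sq : ∀ t p, T.Spells t p →
    K t p ^ 2 = ∏ a : Fin 4, ω (T.face t (p ∘ a.succAbove)) (p ∘ a.succAbove)
  perm : ∀ t p, T.Spells t p → ∀ π : Equiv.Perm (Fin 4),
    K t (p ∘ π) = ((Equiv.Perm.sign π : ℤ) : ℂ) * K t p
  prod : ∀ u (p : Fin 5 → V), T.Spells u p →
    ∏ a : Fin 5, K (T.face u (p ∘ a.succAbove)) (p ∘ a.succAbove) =
      ∏ x ∈ univ.filter (fun x : Fin 5 × Fin 5 × Fin 5 => x.1 < x.2.1 ∧ x.2.1 < x.2.2),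
        ω (T.face u ![p x.1, p x.2.1, p x.2.2]) ![p x.1, p x.2.1, p x.2.2]

/-- Let `b i j` be attached to the oriented edges `ij` of a tetrahedron `t`, with `b j i = - b i j`
and `∑ j, b i j = 0` for all `i`, and let `c` be a 2-cocycle. If `ν` is a 1-cochain on `t` with
coboundary `c`, then the sum of `ν i j * b i j` over the edges of `t` depends on `c` only; this is
its value, written without a choice of `ν` (see `cochainPairing_eq`). -/
noncomputable def cochainPairing (b : V → V → ℂ) (c : C → (Fin 3 → V) → ℂ) (t : C) : ℂ :=
  (1 / 8) * ∑ k ∈ T.vert t, ∑ i ∈ T.vert t, ∑ j ∈ T.vert t,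
    c (T.face t ![k, i, j]) ![k, i, j] * b i j

/-- The reason for the definition of `cochainPairing`. The factor `1 / 2` is there because every
edge occurs in the sum with both of its orientations. -/
theorem cochainPairing_eq (b : V → V → ℂ) (c : C → (Fin 3 → V) → ℂ) (t : C) (ν : V → V → ℂ)
    (ht : (T.vert t).card = 4) (hb : ∀ i j, b j i = - b i j)
    (hcyc : ∀ i ∈ T.vert t, ∑ j ∈ T.vert t, b i j = 0)
    (hν : ∀ k ∈ T.vert t, ∀ i ∈ T.vert t, ∀ j ∈ T.vert t,
      c (T.face t ![k, i, j]) ![k, i, j] = ν k i + ν i j + ν j k) :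
    T.cochainPairing b c t = (1 / 2) * ∑ i ∈ T.vert t, ∑ j ∈ T.vert t, ν i j * b i j := by
  have hcyc' : ∀ j ∈ T.vert t, ∑ i ∈ T.vert t, b i j = 0 := by
    intro j hj
    have h : ∀ i, b i j = - b j i := fun i => hb j i
    rw [sum_congr rfl fun i _ => h i, sum_neg_distrib, hcyc j hj, neg_zero]
  have key : ∀ k ∈ T.vert t, (∑ i ∈ T.vert t, ∑ j ∈ T.vert t,
      c (T.face t ![k, i, j]) ![k, i, j] * b i j) =
      ∑ i ∈ T.vert t, ∑ j ∈ T.vert t, ν i j * b i j := by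
    intro k hk
    have h1 : ∑ i ∈ T.vert t, ∑ j ∈ T.vert t, ν k i * b i j = 0 :=
      sum_eq_zero fun i hi => by rw [← mul_sum, hcyc i hi, mul_zero]
    have h2 : ∑ i ∈ T.vert t, ∑ j ∈ T.vert t, ν j k * b i j = 0 := by
      rw [sum_comm]
      exact sum_eq_zero fun j hj => by rw [← mul_sum, hcyc' j hj, mul_zero]
    calc _ = ∑ i ∈ T.vert t, ∑ j ∈ T.vert t, (ν k i * b i j + ν i j * b i j + ν j k * b i j) :=
          sum_congr rfl fun i hi => sum_congr rfl fun j hj => by rw [hν k hk i hi j hj]; ring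
      _ = _ := by simp only [sum_add_distrib]; rw [h1, h2]; ring
  rw [cochainPairing, sum_congr rfl key, sum_const, ht]
  simp only [nsmul_eq_mul]
  push_cast
  ring

variable [Fintype C]

/-- The edge operators: for an oriented edge `ij` of a 4-simplex `u`,
`d_ij = ∑ t, (β t i j * ∂_t + γ u t i j * ϑ_t)`, where `t` runs over the tetrahedra of `u` that
contain `ij`, and the differential part is common to all 4-simplices that contain `t`. -/
structure IsEdgeOperators (o : C → (Fin 5 → V) → ℤ) (ω : C → (Fin 3 → V) → ℂ)
    (K : C → (Fin 4 → V) → ℂ) (β : C → V → V → ℂ) (γ : C → C → V → V → ℂ) : Prop where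
  support : ∀ u ∈ T.cells 5, ∀ t ∈ T.cells 4, t ≤ u → ∀ i j, ¬ (i ∈ T.vert t ∧ j ∈ T.vert t) →
    β t i j = 0 ∧ γ u t i j = 0
  antisymm : ∀ u ∈ T.cells 5, ∀ t ∈ T.cells 4, t ≤ u → ∀ i j,
    β t j i = - β t i j ∧ γ u t j i = - γ u t i j
  /-- the operators form a 1-cycle: `∑ j, d_ij = 0` in every 4-simplex, for every vertex `i` -/
  cycle : ∀ u ∈ T.cells 5, ∀ t ∈ T.cells 4, t ≤ u → ∀ i ∈ T.vert u,
    ∑ j ∈ T.vert u, β t i j = 0 ∧ ∑ j ∈ T.vert u, γ u t i j = 0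
  /-- the linear relation between the edge operators of a 4-simplex that is given by `ω`: if `ω` is
  the coboundary of `ν` on the 4-simplex, then the sum of `ν_b d_b` over its edges `b` is zero -/
  relation : ∀ u ∈ T.cells 5, ∀ t ∈ T.cells 4, t ≤ u →
    T.cochainPairing (β t) ω t = 0 ∧ T.cochainPairing (γ u t) ω t = 0
  /-- normalization: the part of the anticommutator `d_ij d_ik + d_ik d_ij` that comes from the
  tetrahedron `t = ijkl` is `1 / ω_ijk` if the orientation of `u` is given by `ijklm` -/
  normalization : ∀ u i j k l m, T.Spells u ![i, j, k, l, m] →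
    β (T.face u ![i, j, k, l]) i j * γ u (T.face u ![i, j, k, l]) i k +
        β (T.face u ![i, j, k, l]) i k * γ u (T.face u ![i, j, k, l]) i j =
      (o u ![i, j, k, l, m] : ℂ) / ω (T.face u ![i, j, k]) ![i, j, k]
  /-- by the previous conditions the square of the left-hand side is determined by `ω`; the sign of
  `K_t` specifies the left-hand side, and thus which part of the operators is the differential
  one -/
  branch : ∀ u i j k l m, T.Spells u ![i, j, k, l, m] →
    β (T.face u ![i, j, k, l]) i j * γ u (T.face u ![i, j, k, l]) i k -
        β (T.face u ![i, j, k, l]) i k * γ u (T.face u ![i, j, k, l]) i j =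
      - (o u ![i, j, k, l, m] : ℂ) * K (T.face u ![i, j, k, l]) ![i, j, k, l] /
        (ω (T.face u ![i, j, k]) ![i, j, k] * ω (T.face u ![i, j, l]) ![i, j, l] *
          ω (T.face u ![i, k, l]) ![i, k, l])

open Classical in
/-- The skew-symmetric matrices `F` of the 4-simplices `u`: all edge operators of `u` annihilate
the Grassmann–Gaussian weight `exp (-(1/2) * ∑ t t', ϑ_t * F u t t' * ϑ_t')`, where `t` and `t'`
run over the tetrahedra of `u`. As `∂_t` multiplies the weight by `- ∑ t', F u t t' * ϑ_t'`, this
means that `γ` is the product of `β` and `F`. -/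
structure IsWeightMatrix (β : C → V → V → ℂ) (γ : C → C → V → V → ℂ) (F : C → C → C → ℂ) :
    Prop where
  skew : ∀ u ∈ T.cells 5, ∀ t ∈ T.cells 4, ∀ t' ∈ T.cells 4, t ≤ u → t' ≤ u →
    F u t' t = - F u t t'
  annihilate : ∀ u ∈ T.cells 5, ∀ t' ∈ T.cells 4, t' ≤ u → ∀ i ∈ T.vert u, ∀ j ∈ T.vert u,
    γ u t' i j = ∑ t ∈ (T.cells 4).filter (· ≤ u), β t i j * F u t t'

/-! ### The exotic chain complex and the square root of its torsion -/

/-- The tetrahedra. -/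
abbrev Tet : Type _ := {t : C // t ∈ T.cells 4}

section ChainComplex

variable {ι : Type*}

/-- The matrix of `f₁ : ℂ → Z²(M, ℂ)`, `1 ↦ ω`, in a basis of the space of cocycles. -/
noncomputable def f₁ (bas : Module.Basis ι ℂ T.cocycles) (ω : T.cocycles) : Matrix ι Unit ℂ :=
  Matrix.of fun a _ => bas.repr ω a

/-- The matrix of `f₂`, which sends a cocycle `c` to the coefficients of the `∂_t` in the global
operator `D_c`; if `c` is the coboundary of an edge, this is the edge operator. -/
noncomputable def f₂ (bas : Module.Basis ι ℂ T.cocycles) (β : C → V → V → ℂ) :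
    Matrix T.Tet ι ℂ :=
  Matrix.of fun t a => T.cochainPairing (β t) (bas a : C → (Fin 3 → V) → ℂ) t

open Classical in
/-- The matrix `f₃`: the product of the weights of all 4-simplices is
`exp (∑ t t', ϑ_t * f₃ t t' * ϑ_t')`. -/
noncomputable def f₃ (F : C → C → C → ℂ) : Matrix T.Tet T.Tet ℂ :=
  Matrix.of fun t t' =>
    -(1 / 2) * ∑ u ∈ (T.cells 5).filter (fun u => t.1 ≤ u ∧ t'.1 ≤ u), F u t t'

end ChainComplex

end Triangulation

section Torsion

variable {ι τ : Type*} [Fintype ι] [Fintype τ]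

/-- The sequence `0 → ℂ → ℂ^ι → ℂ^τ → ℂ^τ → ℂ^ι → ℂ → 0` with the maps `f₁`, `f₂`, `f₃`, `f₂ᵀ`,
`f₁ᵀ` is an acyclic complex. -/
structure IsAcyclic (f₁ : Matrix ι Unit ℂ) (f₂ : Matrix τ ι ℂ) (f₃ : Matrix τ τ ℂ) : Prop where
  injective : Function.Injective f₁.mulVec
  exact₁₂ : Function.Exact f₁.mulVec f₂.mulVec
  exact₂₃ : Function.Exact f₂.mulVec f₃.mulVec
  exact₃₄ : Function.Exact f₃.mulVec f₂.transpose.mulVec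
  exact₄₅ : Function.Exact f₂.transpose.mulVec f₁.transpose.mulVec
  surjective : Function.Surjective f₁.transpose.mulVec

/-- The Pfaffian of a skew-symmetric matrix whose `2 * m` rows and columns are numbered in the order
`(0, 0), (0, 1), (1, 0), (1, 1), …`. -/
noncomputable def pfaffian {m : ℕ} (A : Matrix (Fin m × Fin 2) (Fin m × Fin 2) ℂ) : ℂ :=
  (1 / ((2 : ℂ) ^ m * (m.factorial : ℂ))) *
    ∑ π : Equiv.Perm (Fin m × Fin 2),
      ((Equiv.Perm.sign π : ℤ) : ℂ) * ∏ a : Fin m, A (π (a, 0)) (π (a, 1))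

/-- `r = minor f₁ * Pf (submatrix of f₃) / minor f₂` for some symmetric choice of nondegenerate
minors: one row of `f₁`; the columns of `f₂` with the other numbers and an equal number of its rows;
the rows and columns of `f₃` with the remaining numbers. The rows and columns may be taken in any
order. -/
def IsSqrtTorsion (f₁ : Matrix ι Unit ℂ) (f₂ : Matrix τ ι ℂ) (f₃ : Matrix τ τ ℂ) (r : ℂ) : Prop :=
  ∃ (n m : ℕ) (e : Unit ⊕ Fin n ≃ ι) (g : Fin n ⊕ (Fin m × Fin 2) ≃ τ),
    f₁ (e (Sum.inl ())) () ≠ 0 ∧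
    (f₂.submatrix (g ∘ Sum.inl) (e ∘ Sum.inr)).det ≠ 0 ∧
    (f₃.submatrix (g ∘ Sum.inr) (g ∘ Sum.inr)).det ≠ 0 ∧
    r = f₁ (e (Sum.inl ())) () * pfaffian (f₃.submatrix (g ∘ Sum.inr) (g ∘ Sum.inr)) /
      (f₂.submatrix (g ∘ Sum.inl) (e ∘ Sum.inr)).det

end Torsion

namespace Triangulation

variable {V C : Type*} [DecidableEq V] [PartialOrder C] (T : Triangulation V C) [Fintype C]

/-! ### The quantity `I` -/

/-- Square roots `q_s` of the values of `ω` on the triangles, taken with their vertices in the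
increasing order of the numbers `num`, which agree with the `K_t` in the sense that
`K_ijkl = q_ijk q_ijl q_ikl q_jkl` for the tetrahedra `ijkl` with increasing vertices. -/
structure IsTriangleRoots (ω : C → (Fin 3 → V) → ℂ) (K : C → (Fin 4 → V) → ℂ) (num : V → ℕ)
    (q : C → ℂ) : Prop where
  sq : ∀ s p, T.Spells s p → StrictMono (num ∘ p) → q s ^ 2 = ω s p
  agree : ∀ t (p : Fin 4 → V), T.Spells t p → StrictMono (num ∘ p) →
    K t p = ∏ a : Fin 4, q (T.face t (p ∘ a.succAbove))

/-- The denominator in the formula for `H_u`, for `u = ijklm`. -/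
noncomputable def denominatorH (F : C → C → C → ℂ) (u : C) (i j k l m : V) : ℂ :=
  F u (T.face u ![i, k, l, m]) (T.face u ![i, j, k, m]) *
      F u (T.face u ![j, k, l, m]) (T.face u ![i, j, l, m]) -
    F u (T.face u ![i, k, l, m]) (T.face u ![i, j, l, m]) *
      F u (T.face u ![j, k, l, m]) (T.face u ![i, j, k, m])

/-- The quantity `H_u` calculated from the edge `b = ij` and the tetrahedron `t = ijkl` of
`u = ijklm`. -/
noncomputable def valueH (β : C → V → V → ℂ) (F : C → C → C → ℂ) (q : C → ℂ) (u : C)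
    (i j k l m : V) : ℂ :=
  β (T.face u ![i, j, k, l]) i j *
      (q (T.face u ![i, j, k]) * q (T.face u ![i, j, l]) * q (T.face u ![i, j, m]) *
        q (T.face u ![k, l, m])) /
    T.denominatorH F u i j k l m

/-- `η_u` is a square root of `H_u`, for every 4-simplex `u`. Here `H_u` may be calculated from any
edge `ij` and tetrahedron `ijkl` of `u` such that the formula makes sense, where the edge is
directed from the smaller to the larger number and `ijklm` gives the orientation of `u`. -/
def IsEta (o : C → (Fin 5 → V) → ℤ) (num : V → ℕ) (β : C → V → V → ℂ) (F : C → C → C → ℂ)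
    (q η : C → ℂ) : Prop :=
  ∀ u ∈ T.cells 5, ∃ i j k l m, T.Spells u ![i, j, k, l, m] ∧ o u ![i, j, k, l, m] = 1 ∧
    num i < num j ∧ T.denominatorH F u i j k l m ≠ 0 ∧
    η u ^ 2 = T.valueH β F q u i j k l m

/-- `x` is a value of the quantity `I = ∏ q_s⁻¹ * ∏ η_u * √τ`, calculated for the numbering `num` of
the vertices, with any choice of what is still free: the edge operators, the signs of the roots and
the minors in `√τ`. -/
def IsValueI {ι : Type*} [Fintype ι] (o : C → (Fin 5 → V) → ℤ) (ω : T.cocycles)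
    (K : C → (Fin 4 → V) → ℂ) (bas : Module.Basis ι ℂ T.cocycles) (num : V → ℕ) (x : ℂ) : Prop :=
  ∃ (β : C → V → V → ℂ) (γ : C → C → V → V → ℂ) (F : C → C → C → ℂ) (q η : C → ℂ) (r : ℂ),
    T.IsEdgeOperators o ω K β γ ∧ T.IsWeightMatrix β γ F ∧
    IsAcyclic (T.f₁ bas ω) (T.f₂ bas β) (T.f₃ F) ∧
    T.IsTriangleRoots ω K num q ∧ T.IsEta o num β F q η ∧
    IsSqrtTorsion (T.f₁ bas ω) (T.f₂ bas β) (T.f₃ F) r ∧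
    x = (∏ s ∈ T.cells 3, (q s)⁻¹) * (∏ u ∈ T.cells 5, η u) * r

end Triangulation

end ExoticTorsion

set_option linter.unusedSectionVars false

namespace ExoticTorsion

/-! Signs are irrelevant for $I$, so squares are compared. The key is the local formula
$H_u=\theta_u\,\varepsilon_u\prod_{s\subset u}q_s$ (`valueH_eq`). Here $\varepsilon_u$ compares the
orientation of $u$ with the order of the numbers (`simplexSign`), and $\theta_u$ depends only on
$\omega$ and $\beta$ (`simplexMinor`). It follows that $I^2$ splits into a factor that contains the
numbering and the roots $q_s$ (`rootFactor`) and the factor $\prod_u\theta_u\cdot\tau$, which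
contains the edge operators and the minors (`sq_value_eq`).

The local formula: of the ten edge operators of $u$, four are eliminated by the vertex relations and
one by the relation with $\omega$. The remaining five, at the five tetrahedra of $u$, give a square
matrix, and $\theta_u$ is its determinant divided by the value of $\omega$ used in the last
elimination; this quotient does not depend on the order of the vertices (`edgeMinor_relabel`).
Multiplying the matrix by unit vectors and columns of $F$ makes it block triangular, because two
tetrahedra see only few of the chosen edges. This expresses $2\times2$ minors of $F$ through
$\theta_u$ and known products of coefficients (`det_edgeMatrix_mul`, `IsEdgePair.mul_minor`).

The first factor: if two numberings disagree on an edge, give the edge the factor $\sqrt{-1}$,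
otherwise $1$; multiplying every $q_s$ by the factors of its edges yields admissible roots for the
other numbering. In `rootFactor` an edge factor then enters with the exponent $5n_5-2n_3$, where
$n_5$ and $n_3$ count the 4-simplices and triangles at the edge. The link of an edge is a 2-sphere,
so $n_5+4=2n_3$ and the exponent is divisible by four (`rootFactor_flip`). For a fixed numbering, a
change of signs of the $q_s$ is harmless since a triangle lies in as many tetrahedra as 4-simplices,
and the $K_t$ fix the product of the $q_s$ over a tetrahedron (`IsTriangleRoots.rootFactor_eq`).

The second factor: the normalization and the choice of $K_t$ determine all products
$\beta_{b,t}\gamma_{b',t}$, so edge operators are unique up to a rescaling of each $\vartheta_t$ by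
a number $c_t$ (`IsEdgeOperators.exists_scale`). Then $\theta_u$ acquires $\prod_{t\subset u}c_t$.
As a tetrahedron lies in two 4-simplices, $\prod_u\theta_u$ acquires $\prod_tc_t^2$, which cancels
against $\tau$ (`IsSqrtTorsion.scale`). Another choice of minors changes $\sqrt\tau$ at most by a
sign (`IsSqrtTorsion.eq_or_eq_neg`).

Both signs of $I$ occur because one $\eta_u$ may be replaced by $-\eta_u$ (`IsValueI.neg`), and some
value exists for every numbering (`IsValueI.exists_renumber`). -/

/-! ### Euler characteristics of combinatorial spheres. -/

/-- The alternating sum of the numbers of simplices; it is the negative of the reduced Euler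
characteristic. -/
def eulerSum {α : Type*} (K : Finset (Finset α)) : ℤ := ∑ σ ∈ K, (-1) ^ σ.card

theorem eulerSum_ssubsets {α : Type*} [DecidableEq α] {σ : Finset α} (hσ : σ.Nonempty) :
    eulerSum σ.ssubsets = -(-1) ^ σ.card := by
  have h := Finset.sum_powerset_neg_one_pow_card_of_nonempty hσ
  rw [← Finset.insert_erase (Finset.mem_powerset_self σ), Finset.sum_insert (by simp)] at h
  rw [eulerSum, Finset.ssubsets]
  linarith

/-- Only the open star of $\sigma$ changes. Its contribution is $(-1)^{|\sigma|}$ times the sum over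
the link. The new simplices contribute minus the product of the sums over $\partial\sigma$ and the
link, and the sum over $\partial\sigma$ is $-(-1)^{|\sigma|}$. -/
theorem eulerSum_starring {K : Finset (Finset ℕ)} (hK : IsComplex K) {σ : Finset ℕ} (hσ : σ ∈ K)
    (hne : σ.Nonempty) {a : ℕ} (ha : {a} ∉ K) : eulerSum (starring K σ a) = eulerSum K := by
  have haK : ∀ τ ∈ K, a ∉ τ := fun τ hτ h => ha (hK.2 τ hτ _ (by simpa using h))
  have hdisj : Disjoint (K.filter fun τ => ¬ σ ⊆ τ)
      ((σ.ssubsets ×ˢ link K σ).image fun x => insert a (x.1 ∪ x.2)) := by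
    rw [Finset.disjoint_left]
    intro τ h1 h2
    obtain ⟨x, -, rfl⟩ := mem_image.1 h2
    exact haK _ (mem_filter.1 h1).1 (mem_insert_self _ _)
  have hlink : ∀ y ∈ link K σ, y ∈ K ∧ Disjoint σ y ∧ σ ∪ y ∈ K := fun y hy => by
    simpa [link] using hy
  have hinj : Set.InjOn (fun x : Finset ℕ × Finset ℕ => insert a (x.1 ∪ x.2))
      (σ.ssubsets ×ˢ link K σ : Finset _) := by
    -- The pair can be recovered from the new simplex, because $a$ lies in no simplex of $K$ and the
    -- link is disjoint from $\sigma$.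
    have hx : ∀ x ∈ σ.ssubsets ×ˢ link K σ,
        insert a (x.1 ∪ x.2) ∩ σ = x.1 ∧ (insert a (x.1 ∪ x.2) \ σ).erase a = x.2 := by
      rintro ⟨x, y⟩ h
      obtain ⟨h1, h2⟩ := mem_product.1 h
      obtain ⟨h3, h4, -⟩ := hlink y h2
      have h5 : x ⊆ σ := (mem_ssubsets.1 h1).subset
      have h6 := haK σ hσ
      have h7 := haK y h3
      rw [Finset.disjoint_left] at h4
      refine ⟨?_, ?_⟩
      · ext z
        have := @h5 z
        have := @h4 z
        simp only [mem_inter, mem_insert, mem_union]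
        by_cases hz : z = a
        · subst hz; tauto
        · tauto
      · ext z
        have := @h5 z
        have := @h4 z
        simp only [mem_erase, mem_sdiff, mem_insert, mem_union]
        by_cases hz : z = a
        · subst hz; tauto
        · tauto
    intro x h x' h' heq
    obtain ⟨h1, h2⟩ := hx x h
    obtain ⟨h3, h4⟩ := hx x' h'
    simp only at heq
    rw [heq] at h1 h2
    exact Prod.ext (h1.symm.trans h3) (h2.symm.trans h4)
  have hstar : ∑ τ ∈ K.filter (fun τ => σ ⊆ τ), (-1 : ℤ) ^ τ.card =
      ∑ y ∈ link K σ, (-1) ^ (σ.card + y.card) := by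
    symm
    refine sum_bij' (fun y _ => σ ∪ y) (fun τ _ => τ \ σ) ?_ ?_ ?_ ?_ ?_
    · intro y hy
      exact mem_filter.2 ⟨(hlink y hy).2.2, subset_union_left⟩
    · intro τ hτ
      obtain ⟨h1, h2⟩ := mem_filter.1 hτ
      refine mem_filter.2 ⟨hK.2 τ h1 _ sdiff_subset, disjoint_sdiff, ?_⟩
      rwa [union_sdiff_of_subset h2]
    · intro y hy
      exact (Finset.union_sdiff_cancel_left (hlink y hy).2.1)
    · intro τ hτ
      exact union_sdiff_of_subset (mem_filter.1 hτ).2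
    · intro y hy
      rw [card_union_of_disjoint (hlink y hy).2.1]
  have hcard : ∀ x ∈ σ.ssubsets ×ˢ link K σ,
      (-1 : ℤ) ^ (insert a (x.1 ∪ x.2)).card = -((-1) ^ x.1.card * (-1) ^ x.2.card) := by
    rintro ⟨x, y⟩ h
    obtain ⟨h1, h2⟩ := mem_product.1 h
    obtain ⟨h3, h4, -⟩ := hlink y h2
    have h5 : x ⊆ σ := (mem_ssubsets.1 h1).subset
    have h6 : a ∉ x ∪ y := by
      rw [mem_union]
      exact fun h => h.elim (fun h => haK σ hσ (h5 h)) (haK y h3)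
    rw [card_insert_of_notMem h6, card_union_of_disjoint (disjoint_of_subset_left h5 h4)]
    ring
  have hss := eulerSum_ssubsets hne
  rw [eulerSum] at hss
  rw [eulerSum, starring, sum_union hdisj, sum_image hinj, sum_congr rfl hcard, eulerSum,
    ← Finset.sum_filter_add_sum_filter_not K (fun τ => σ ⊆ τ), hstar, sum_neg_distrib,
    sum_product]
  simp only [← mul_sum, ← sum_mul, pow_add]
  rw [hss]
  ring

theorem StellarEquivalent.eulerSum_eq {K L : Finset (Finset ℕ)} (h : StellarEquivalent K L) :
    eulerSum K = eulerSum L := by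
  induction h with
  | rel K L h =>
    obtain ⟨hK, σ, hσ, hne, a, ha, rfl⟩ := h
    exact (eulerSum_starring hK hσ hne ha).symm
  | refl => rfl
  | symm _ _ _ ih => exact ih.symm
  | trans _ _ _ _ _ ih₁ ih₂ => exact ih₁.trans ih₂

/-- The Euler characteristic gives only the parity of the dimension. This separates the empty sphere
from all others, which is needed to see that maximal simplices have five vertices. -/
theorem StellarEquivalent.eq_singleton_iff {K L : Finset (Finset ℕ)} (h : StellarEquivalent K L) :
    K = {∅} ↔ L = {∅} := by
  induction h with
  | rel K L h =>
    obtain ⟨hK, σ, hσ, hne, a, ha, rfl⟩ := h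
    refine iff_of_false ?_ ?_
    · rintro rfl
      exact hne.ne_empty (mem_singleton.1 hσ)
    · intro h
      have h1 : ({a} : Finset ℕ) ∈ starring K σ a := by
        refine mem_union_right _ (mem_image.2 ⟨(∅, ∅), mem_product.2 ⟨?_, ?_⟩, by simp⟩)
        · exact mem_ssubsets.2 (Finset.empty_ssubset.2 hne)
        · exact mem_filter.2 ⟨hK.1, by simp, by simpa using hσ⟩
      rw [h] at h1
      simp at h1
  | refl => rfl
  | symm _ _ _ ih => exact ih.symm
  | trans _ _ _ _ _ ih₁ ih₂ => exact ih₁.trans ih₂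

theorem IsCombinatorialSphere.eulerSum_eq {α : Type*} {m : ℕ} {K : Finset (Finset α)}
    (h : IsCombinatorialSphere m K) : eulerSum K = (-1) ^ m := by
  obtain ⟨f, hf⟩ := h
  have h1 := hf.eulerSum_eq
  rw [eulerSum_ssubsets (by simp), card_range] at h1
  rw [eulerSum, sum_image (fun x _ y _ h => Finset.map_injective f h)] at h1
  simp only [card_map] at h1
  rw [eulerSum, h1]
  ring

theorem IsCombinatorialSphere.eq_zero_of_singleton {α : Type*} {m : ℕ}
    (h : IsCombinatorialSphere m ({∅} : Finset (Finset α))) : m = 0 := by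
  obtain ⟨f, hf⟩ := h
  have h1 := hf.eq_singleton_iff.1 (by simp)
  by_contra hm
  have h2 : ({0} : Finset ℕ) ∈ (range (m + 1)).ssubsets := by
    rw [mem_ssubsets, Finset.ssubset_iff_of_subset (by simp)]
    exact ⟨m, by simp, by simpa using hm⟩
  rw [h1] at h2
  simp at h2

/-! ### Chains in partially ordered sets. -/

open Classical in
/-- The complex of all chains in a finite set of elements of a partially ordered set. -/
noncomputable def chainComplex {C : Type*} [PartialOrder C] (S : Finset C) : Finset (Finset C) :=
  S.powerset.filter fun c => IsChain (· ≤ ·) (c : Set C)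

open Classical in
/-- Sorting the nonempty chains according to their greatest elements. -/
theorem eulerSum_chainComplex {C : Type*} [PartialOrder C] (S : Finset C) :
    eulerSum (chainComplex S) = 1 - ∑ x ∈ S, eulerSum (chainComplex (S.filter (· < x))) := by
  have hmem : ∀ (S : Finset C) c, c ∈ chainComplex S ↔ c ⊆ S ∧ IsChain (· ≤ ·) (c : Set C) :=
    fun S c => by simp [chainComplex]
  have hlt : ∀ x, ∀ c ∈ chainComplex (S.filter (· < x)), ∀ y ∈ c, y ∈ S ∧ y < x := fun x c hc y hy =>
    mem_filter.1 (((hmem _ _).1 hc).1 hy)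
  have hx : ∀ x, ∀ c ∈ chainComplex (S.filter (· < x)), x ∉ c := fun x c hc h =>
    lt_irrefl x (hlt x c hc x h).2
  have hempty : ∅ ∈ chainComplex S := (hmem _ _).2 ⟨empty_subset _, by simp⟩
  rw [eulerSum, ← Finset.insert_erase hempty, sum_insert (by simp), card_empty, pow_zero,
    sub_eq_add_neg, ← sum_neg_distrib]
  congr 1
  simp only [eulerSum, ← sum_neg_distrib]
  rw [Finset.sum_sigma' S (fun x => chainComplex (S.filter (· < x)))]
  symm
  refine sum_bij (fun z _ => insert z.1 z.2) ?_ ?_ ?_ ?_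
  · rintro ⟨x, c⟩ h
    obtain ⟨h1, h2⟩ := mem_sigma.1 h
    simp only at h1 h2
    refine mem_erase.2 ⟨insert_ne_empty _ _, (hmem _ _).2 ⟨?_, ?_⟩⟩
    · exact insert_subset h1 fun y hy => (hlt x c h2 y hy).1
    · rw [coe_insert]
      exact ((hmem _ _).1 h2).2.insert fun y hy _ => Or.inr (hlt x c h2 y hy).2.le
  · rintro ⟨x, c⟩ h ⟨x', c'⟩ h' heq
    obtain ⟨-, h2⟩ := mem_sigma.1 h
    obtain ⟨-, h2'⟩ := mem_sigma.1 h'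
    simp only at h2 h2' heq
    have hxx : x = x' := by
      by_contra hne
      have h3 : x ∈ c' := mem_of_mem_insert_of_ne (heq ▸ mem_insert_self x c) hne
      have h4 : x' ∈ c := mem_of_mem_insert_of_ne (heq ▸ mem_insert_self x' c') (Ne.symm hne)
      exact lt_asymm (hlt x' c' h2' x h3).2 (hlt x c h2 x' h4).2
    subst hxx
    have : c = c' := by
      rw [← erase_insert (hx x c h2), heq, erase_insert (hx x c' h2')]
    rw [this]
  · intro c hc
    obtain ⟨h1, h2⟩ := mem_erase.1 hc
    obtain ⟨h3, h4⟩ := (hmem _ _).1 h2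
    obtain ⟨x, hxc, hmax⟩ := c.exists_maximal (nonempty_of_ne_empty h1)
    refine ⟨⟨x, c.erase x⟩, mem_sigma.2 ⟨h3 hxc, (hmem _ _).2 ⟨?_, ?_⟩⟩, insert_erase hxc⟩
    · intro y hy
      obtain ⟨h5, h6⟩ := mem_erase.1 hy
      refine mem_filter.2 ⟨h3 h6, lt_of_le_of_ne ?_ h5⟩
      exact (h4 h6 hxc h5).elim id fun h => hmax h6 h
    · exact h4.mono (by simp)
  · rintro ⟨x, c⟩ h
    obtain ⟨-, h2⟩ := mem_sigma.1 h
    rw [card_insert_of_notMem (hx x c h2), pow_succ]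
    ring

/-! ### Faces of a simplex, and the numbers of simplices around a simplex of a closed 4-manifold. -/

namespace Triangulation

variable {V C : Type*} [DecidableEq V] [PartialOrder C] (T : Triangulation V C)

open Classical in
/-- The face of `τ` with the vertex set `A` (and `τ` itself if there is no such face). -/
noncomputable def faceOn (τ : C) (A : Finset V) : C :=
  if h : ∃ σ, σ ≤ τ ∧ T.vert σ = A then h.choose else τ

theorem face_eq_faceOn {n : ℕ} (τ : C) (p : Fin n → V) :
    T.face τ p = T.faceOn τ (univ.image p) := rfl

variable {T}

/-- In general a simplex is not determined by its vertices; inside a common simplex $\tau$ it is,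
and this is the form in which uniqueness of faces is used. -/
theorem le_of_vert_subset {ρ σ τ : C} (hρ : ρ ≤ τ) (hσ : σ ≤ τ) (h : T.vert σ ⊆ T.vert ρ) :
    σ ≤ ρ := by
  obtain ⟨σ', ⟨h1, h2⟩, -⟩ := T.existsUnique_face ρ _ h (T.vert_nonempty σ)
  have h3 := T.existsUnique_face τ _ (T.vert_mono _ _ hσ) (T.vert_nonempty σ)
  rwa [h3.unique ⟨hσ, rfl⟩ ⟨h1.trans hρ, h2⟩]

theorem eq_of_vert_eq {ρ σ τ : C} (hρ : ρ ≤ τ) (hσ : σ ≤ τ) (h : T.vert σ = T.vert ρ) : σ = ρ :=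
  le_antisymm (le_of_vert_subset (T := T) hρ hσ h.subset)
    (le_of_vert_subset (T := T) hσ hρ h.symm.subset)

theorem faceOn_spec {τ : C} {A : Finset V} (hA : A ⊆ T.vert τ) (hne : A.Nonempty) :
    T.faceOn τ A ≤ τ ∧ T.vert (T.faceOn τ A) = A := by
  have h := (T.existsUnique_face τ A hA hne).exists
  rw [faceOn, dif_pos h]
  exact h.choose_spec

theorem faceOn_vert {σ τ : C} (h : σ ≤ τ) : T.faceOn τ (T.vert σ) = σ := by
  obtain ⟨h1, h2⟩ := faceOn_spec (T.vert_mono _ _ h) (T.vert_nonempty σ)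
  exact eq_of_vert_eq (T := T) h h1 h2

theorem faceOn_faceOn {τ : C} {A B : Finset V} (hA : A ⊆ T.vert τ) (hB : B ⊆ A)
    (hne : B.Nonempty) : T.faceOn (T.faceOn τ A) B = T.faceOn τ B := by
  obtain ⟨h1, h2⟩ := faceOn_spec hA (hne.mono hB)
  obtain ⟨h3, h4⟩ := faceOn_spec (T := T) (τ := T.faceOn τ A) (A := B) (by rwa [h2]) hne
  rw [← faceOn_vert (T := T) (h3.trans h1), h4]

open Classical in
/-- The faces of a simplex correspond to the nonempty sets of its vertices. -/
theorem prod_faces [Fintype C] {R : Type*} [CommMonoid R] (τ : C) (P : Finset V → Prop)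
    [DecidablePred P] (f : C → R) :
    ∏ σ ∈ univ.filter (fun σ => σ ≤ τ ∧ P (T.vert σ)), f σ =
      ∏ A ∈ (T.vert τ).powerset.filter (fun A => A.Nonempty ∧ P A), f (T.faceOn τ A) := by
  refine prod_bij' (fun σ _ => T.vert σ) (fun A _ => T.faceOn τ A) ?_ ?_ ?_ ?_ ?_
  · intro σ hσ
    obtain ⟨-, h1, h2⟩ := mem_filter.1 hσ
    exact mem_filter.2 ⟨mem_powerset.2 (T.vert_mono _ _ h1), T.vert_nonempty σ, h2⟩
  · intro A hA
    obtain ⟨h1, h2, h3⟩ := mem_filter.1 hA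
    obtain ⟨h4, h5⟩ := faceOn_spec (mem_powerset.1 h1) h2
    exact mem_filter.2 ⟨mem_univ _, h4, by rwa [h5]⟩
  · intro σ hσ
    exact faceOn_vert (mem_filter.1 hσ).2.1
  · intro A hA
    obtain ⟨h1, h2, h3⟩ := mem_filter.1 hA
    exact (faceOn_spec (mem_powerset.1 h1) h2).2
  · intro σ hσ
    rw [faceOn_vert (mem_filter.1 hσ).2.1]

open Classical in
theorem sum_faces [Fintype C] {R : Type*} [AddCommMonoid R] (τ : C) (P : Finset V → Prop)
    [DecidablePred P] (f : C → R) :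
    ∑ σ ∈ univ.filter (fun σ => σ ≤ τ ∧ P (T.vert σ)), f σ =
      ∑ A ∈ (T.vert τ).powerset.filter (fun A => A.Nonempty ∧ P A), f (T.faceOn τ A) :=
  prod_faces (R := Multiplicative R) τ P f

theorem Spells.card_vert {n : ℕ} {σ : C} {p : Fin n → V} (h : T.Spells σ p) :
    (T.vert σ).card = n := by
  rw [← h.2, card_image_of_injective _ h.1, card_fin]

theorem exists_spells {n : ℕ} {σ : C} (h : (T.vert σ).card = n) : ∃ p : Fin n → V, T.Spells σ p := by
  let e := ((T.vert σ).equivFinOfCardEq h).symm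
  refine ⟨fun a => e a, Subtype.val_injective.comp e.injective, ?_⟩
  ext v
  simp only [mem_image, mem_univ, true_and]
  exact ⟨fun ⟨a, ha⟩ => ha ▸ (e a).2, fun hv => ⟨e.symm ⟨v, hv⟩, by simp⟩⟩

open Classical in
/-- The faces of dimension `n` of a simplex with `N + 1` vertices, listed by an ordering of the
vertices. -/
theorem prod_cells_le [Fintype C] {R : Type*} [CommMonoid R] {N n : ℕ} (hn : n ≠ 0) {τ : C}
    {p : Fin N → V} (hp : T.Spells τ p) (f : C → R) :
    ∏ σ ∈ (T.cells n).filter (· ≤ τ), f σ =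
      ∏ B ∈ powersetCard n (univ : Finset (Fin N)), f (T.faceOn τ (B.image p)) := by
  have h1 : (T.cells n).filter (· ≤ τ) =
      univ.filter (fun σ => σ ≤ τ ∧ (T.vert σ).card = n) := by
    ext σ; simp [cells, and_comm]
  rw [h1, prod_faces (T := T) τ (fun A => A.card = n) f]
  symm
  refine prod_bij (fun B _ => B.image p) ?_ ?_ ?_ ?_
  · intro B hB
    have h2 := (mem_powersetCard.1 hB).2
    have h3 : (B.image p).card = n := by rw [card_image_of_injective _ hp.1, h2]
    refine mem_filter.2 ⟨mem_powerset.2 ?_, card_ne_zero.1 (h3 ▸ hn), h3⟩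
    rw [← hp.2]
    exact image_subset_image (subset_univ _)
  · intro B _ B' _ h
    exact image_injective hp.1 h
  · intro A hA
    obtain ⟨h2, h3, h4⟩ := mem_filter.1 hA
    rw [mem_powerset, ← hp.2] at h2
    obtain ⟨B, -, hB⟩ := subset_image_iff.1 h2
    refine ⟨B, mem_powersetCard.2 ⟨subset_univ _, ?_⟩, hB⟩
    rw [← h4, ← hB, card_image_of_injective _ hp.1]
  · intro B _
    rfl

/-- Removing $A$ turns the interval into the full power set of the nonempty set $B\setminus A$. -/
theorem sum_Icc_neg_one_pow {A B : Finset V} (h : A ⊂ B) :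
    ∑ D ∈ B.powerset.filter (fun D => A ⊆ D), (-1 : ℤ) ^ D.card = 0 := by
  have h1 : ∑ D ∈ B.powerset.filter (fun D => A ⊆ D), (-1 : ℤ) ^ D.card =
      ∑ D ∈ (B \ A).powerset, (-1) ^ A.card * (-1) ^ D.card := by
    refine sum_bij' (fun D _ => D \ A) (fun D _ => A ∪ D) ?_ ?_ ?_ ?_ ?_
    · intro D hD
      obtain ⟨h1, h2⟩ := mem_filter.1 hD
      exact mem_powerset.2 (sdiff_subset_sdiff (mem_powerset.1 h1) le_rfl)
    · intro D hD
      refine mem_filter.2 ⟨mem_powerset.2 (union_subset h.subset ?_), subset_union_left⟩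
      exact (mem_powerset.1 hD).trans sdiff_subset
    · intro D hD
      exact union_sdiff_of_subset (mem_filter.1 hD).2
    · intro D hD
      refine union_sdiff_cancel_left (disjoint_of_subset_right (mem_powerset.1 hD) ?_)
      exact disjoint_sdiff
    · intro D hD
      rw [← pow_add, add_comm, card_sdiff_add_card_eq_card (mem_filter.1 hD).2]
  rw [h1, ← mul_sum, sum_powerset_neg_one_pow_card_of_nonempty, mul_zero]
  exact sdiff_nonempty.2 h.not_subset

open Classical in
theorem sum_interval_neg_one_pow [Fintype C] {σ τ : C} (h : σ < τ) :
    ∑ ρ ∈ univ.filter (fun ρ => σ ≤ ρ ∧ ρ ≤ τ), (-1 : ℤ) ^ (T.vert ρ).card = 0 := by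
  have h1 : univ.filter (fun ρ => σ ≤ ρ ∧ ρ ≤ τ) =
      univ.filter (fun ρ => ρ ≤ τ ∧ T.vert σ ⊆ T.vert ρ) := by
    ext ρ
    simp only [mem_filter, mem_univ, true_and]
    exact ⟨fun ⟨h1, h2⟩ => ⟨h2, T.vert_mono _ _ h1⟩,
      fun ⟨h1, h2⟩ => ⟨le_of_vert_subset h1 h.le h2, h1⟩⟩
  have h2 : T.vert σ ⊂ T.vert τ :=
    (T.vert_mono _ _ h.le).ssubset_of_ne fun h2 => h.ne (eq_of_vert_eq le_rfl h.le h2)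
  rw [h1, sum_faces (T := T) τ (fun A => T.vert σ ⊆ A), ← sum_Icc_neg_one_pow h2]
  refine sum_congr ?_ ?_
  · ext A
    simp only [mem_filter, and_congr_right_iff]
    exact fun _ => ⟨fun h => h.2, fun h => ⟨(T.vert_nonempty σ).mono h, h⟩⟩
  · intro A hA
    obtain ⟨h3, h4⟩ := mem_filter.1 hA
    rw [(faceOn_spec (mem_powerset.1 h3) ((T.vert_nonempty σ).mono h4)).2]

-- The interval is Boolean, and up to sign this is its Möbius function (P. Hall's theorem). The
-- induction compares the recursion by greatest elements of chains with the vanishing alternating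
-- sum over the closed interval.
open Classical in
theorem eulerSum_openInterval [Fintype C] {σ : C} (τ : C) (h : σ < τ) :
    eulerSum (chainComplex (univ.filter fun ρ => σ < ρ ∧ ρ < τ)) =
      -(-1) ^ ((T.vert σ).card + (T.vert τ).card) := by
  induction τ using (Finite.wellFounded_of_trans_of_irrefl (α := C) (· < ·)).induction with
  | _ τ ih =>
    rw [eulerSum_chainComplex]
    have h1 : ∀ x ∈ univ.filter (fun ρ => σ < ρ ∧ ρ < τ),
        eulerSum (chainComplex ((univ.filter fun ρ => σ < ρ ∧ ρ < τ).filter (· < x))) =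
          -(-1) ^ (T.vert σ).card * (-1) ^ (T.vert x).card := by
      intro x hx
      obtain ⟨-, h2, h3⟩ := mem_filter.1 hx
      rw [neg_mul, ← pow_add, ← ih x h3 h2]
      congr 2
      ext ρ
      simp only [mem_filter, mem_univ, true_and]
      exact ⟨fun h => ⟨h.1.1, h.2⟩, fun h => ⟨⟨h.1, h.2.trans h3⟩, h.2⟩⟩
    rw [sum_congr rfl h1, ← mul_sum]
    have h2 := sum_interval_neg_one_pow (T := T) h
    have h3 : univ.filter (fun ρ => σ ≤ ρ ∧ ρ ≤ τ) =
        insert σ (insert τ (univ.filter fun ρ => σ < ρ ∧ ρ < τ)) := by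
      ext ρ
      simp only [mem_filter, mem_univ, true_and, mem_insert]
      constructor
      · rintro ⟨h4, h5⟩
        rcases h4.eq_or_lt with h4 | h4
        · exact Or.inl h4.symm
        · rcases h5.eq_or_lt with h5 | h5
          · exact Or.inr (Or.inl h5)
          · exact Or.inr (Or.inr ⟨h4, h5⟩)
      · rintro (rfl | rfl | h4)
        · exact ⟨le_rfl, h.le⟩
        · exact ⟨h.le, le_rfl⟩
        · exact ⟨h4.1.le, h4.2.le⟩
    rw [h3, sum_insert (by simp [h.ne]), sum_insert (by simp)] at h2
    have h4 : ((-1 : ℤ) ^ (T.vert σ).card) * (-1) ^ (T.vert σ).card = 1 := by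
      rw [← pow_add]; exact Even.neg_one_pow ⟨_, rfl⟩
    rw [pow_add]
    linear_combination (-1 : ℤ) ^ (T.vert σ).card * h2 - h4

open Classical in
/-- The Euler characteristic of the link of a simplex, in terms of the simplices containing it. -/
theorem IsClosedFourManifold.sum_neg_one_pow [Fintype C] (hT : T.IsClosedFourManifold) (σ : C) :
    ∑ τ ∈ univ.filter (fun τ => σ ≤ τ), (-1 : ℤ) ^ (T.vert τ).card = -1 := by
  obtain ⟨m, hm, hS⟩ := hT σ
  have h1 := hS.eulerSum_eq
  have h2 : T.linkSubdivision σ = chainComplex (univ.filter fun τ => σ < τ) := by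
    ext c
    simp [linkSubdivision, chainComplex, subset_iff]
  rw [h2, eulerSum_chainComplex] at h1
  have h3 : ∀ x ∈ univ.filter (fun τ => σ < τ),
      eulerSum (chainComplex ((univ.filter fun τ => σ < τ).filter (· < x))) =
        -(-1) ^ (T.vert σ).card * (-1) ^ (T.vert x).card := by
    intro x hx
    rw [neg_mul, ← pow_add, ← eulerSum_openInterval x (mem_filter.1 hx).2, filter_filter]
  rw [sum_congr rfl h3, ← mul_sum] at h1
  have h4 : univ.filter (fun τ => σ ≤ τ) = insert σ (univ.filter fun τ => σ < τ) := by
    ext τ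
    simp only [mem_filter, mem_univ, true_and, mem_insert]
    exact le_iff_eq_or_lt.trans (or_congr_left eq_comm)
  rw [h4, sum_insert (by simp)]
  have h5 : ((-1 : ℤ) ^ (T.vert σ).card) * (-1) ^ (T.vert σ).card = 1 := by
    rw [← pow_add]; exact Even.neg_one_pow ⟨_, rfl⟩
  have h6 : (-1 : ℤ) ^ m * (-1) ^ (T.vert σ).card = -1 := by
    rw [← pow_add, hm]; norm_num
  linear_combination (-1 : ℤ) ^ (T.vert σ).card * h1 + h6 -
    (∑ τ ∈ univ.filter (fun τ => σ < τ), (-1 : ℤ) ^ (T.vert τ).card) * h5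

/-- A maximal simplex of a closed four-manifold has five vertices. -/
theorem IsClosedFourManifold.exists_cell_five [Fintype C] [Nonempty C]
    (hT : T.IsClosedFourManifold) : ∃ u, u ∈ T.cells 5 := by
  obtain ⟨u, -, hu⟩ := (univ : Finset C).exists_maximal univ_nonempty
  obtain ⟨m, hm, hS⟩ := hT u
  have h1 : T.linkSubdivision u = {∅} := by
    ext c
    simp only [linkSubdivision, mem_filter, mem_univ, true_and, mem_singleton]
    constructor
    · rintro ⟨h, -⟩
      refine eq_empty_of_forall_notMem fun x hx => ?_
      exact (h x hx).not_ge (hu (mem_univ x) (h x hx).le)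
    · rintro rfl
      simp
  rw [h1] at hS
  rw [hS.eq_zero_of_singleton, zero_add] at hm
  exact ⟨u, by simp [cells, hm]⟩

theorem IsClosedFourManifold.card_vert_le [Fintype C] (hT : T.IsClosedFourManifold) (σ : C) :
    (T.vert σ).card ≤ 5 := by
  obtain ⟨m, hm, -⟩ := hT σ
  omega

open Classical in
/-- The number of simplices with `n` vertices that contain `σ`. -/
noncomputable def cofaceCount [Fintype C] (T : Triangulation V C) (n : ℕ) (σ : C) : ℕ :=
  ((T.cells n).filter (σ ≤ ·)).card

open Classical in
theorem IsClosedFourManifold.sum_cofaceCount [Fintype C] (hT : T.IsClosedFourManifold) (σ : C) :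
    ∑ n ∈ range 6, (-1 : ℤ) ^ n * T.cofaceCount n σ = -1 := by
  refine Eq.trans ?_ (hT.sum_neg_one_pow σ)
  rw [← sum_fiberwise_of_maps_to (g := fun τ => (T.vert τ).card)
    (t := range 6) (fun τ _ => mem_range.2 (Nat.lt_succ_of_le (hT.card_vert_le τ)))]
  refine sum_congr rfl fun n _ => ?_
  have h1 : (univ.filter (fun τ => σ ≤ τ)).filter (fun τ => (T.vert τ).card = n) =
      (T.cells n).filter (σ ≤ ·) := by
    ext τ; simp [cells, and_comm]
  have h2 : ∀ τ ∈ (T.cells n).filter (σ ≤ ·), (-1 : ℤ) ^ (T.vert τ).card = (-1) ^ n :=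
    fun τ hτ => by rw [(mem_filter.1 (mem_filter.1 hτ).1).2]
  rw [h1, cofaceCount, sum_congr rfl h2, sum_const, nsmul_eq_mul, mul_comm]

open Classical in
theorem cofaceCount_self [Fintype C] (σ : C) : T.cofaceCount (T.vert σ).card σ = 1 := by
  rw [cofaceCount, card_eq_one]
  refine ⟨σ, ?_⟩
  ext τ
  simp only [cells, mem_filter, mem_univ, true_and, mem_singleton]
  constructor
  · rintro ⟨h1, h2⟩
    exact (eq_of_vert_eq le_rfl h2 (eq_of_subset_of_card_le (T.vert_mono _ _ h2) h1.le)).symm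
  · rintro rfl
    exact ⟨rfl, le_rfl⟩

open Classical in
theorem cofaceCount_of_lt [Fintype C] {σ : C} {n : ℕ} (h : n < (T.vert σ).card) :
    T.cofaceCount n σ = 0 := by
  rw [cofaceCount, card_eq_zero, filter_eq_empty_iff]
  intro τ hτ hle
  have h1 := card_le_card (T.vert_mono _ _ hle)
  have h2 := (mem_filter.1 hτ).2
  omega

/-- The link is a 0-sphere: the alternating count of cofaces reads $1-n_5=-1$. -/
theorem IsClosedFourManifold.cofaceCount_tetrahedron [Fintype C] (hT : T.IsClosedFourManifold)
    {t : C} (ht : t ∈ T.cells 4) : T.cofaceCount 5 t = 2 := by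
  have h4 := (mem_filter.1 ht).2
  have h1 := hT.sum_cofaceCount t
  have h2 := cofaceCount_self (T := T) t
  rw [h4] at h2
  simp only [sum_range_succ, sum_range_zero, h2, cofaceCount_of_lt (T := T) (σ := t) (n := 0) (by omega),
    cofaceCount_of_lt (T := T) (σ := t) (n := 1) (by omega),
    cofaceCount_of_lt (T := T) (σ := t) (n := 2) (by omega),
    cofaceCount_of_lt (T := T) (σ := t) (n := 3) (by omega)] at h1
  push_cast at h1
  omega

/-- The link is a circle, with as many vertices as edges. -/
theorem IsClosedFourManifold.cofaceCount_triangle [Fintype C] (hT : T.IsClosedFourManifold)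
    {s : C} (hs : s ∈ T.cells 3) : T.cofaceCount 5 s = T.cofaceCount 4 s := by
  have h4 := (mem_filter.1 hs).2
  have h1 := hT.sum_cofaceCount s
  have h2 := cofaceCount_self (T := T) s
  rw [h4] at h2
  simp only [sum_range_succ, sum_range_zero, h2, cofaceCount_of_lt (T := T) (σ := s) (n := 0) (by omega),
    cofaceCount_of_lt (T := T) (σ := s) (n := 1) (by omega),
    cofaceCount_of_lt (T := T) (σ := s) (n := 2) (by omega)] at h1
  push_cast at h1
  omega

open Classical in
/-- The number of simplices of a given dimension between two simplices. -/
theorem card_between [Fintype C] {σ τ : C} (h : σ ≤ τ) {n m k : ℕ} (hn : (T.vert σ).card = n)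
    (hm : (T.vert τ).card = n + m) :
    ((T.cells (n + k)).filter (fun ρ => σ ≤ ρ ∧ ρ ≤ τ)).card = m.choose k := by
  have h0 := T.vert_mono _ _ h
  have h1 : (T.cells (n + k)).filter (fun ρ => σ ≤ ρ ∧ ρ ≤ τ) =
      univ.filter (fun ρ => ρ ≤ τ ∧ (T.vert σ ⊆ T.vert ρ ∧ (T.vert ρ).card = n + k)) := by
    ext ρ
    simp only [cells, mem_filter, mem_univ, true_and]
    exact ⟨fun ⟨h1, h2, h3⟩ => ⟨h3, T.vert_mono _ _ h2, h1⟩,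
      fun ⟨h1, h2, h3⟩ => ⟨h3, le_of_vert_subset (T := T) h1 h h2, h1⟩⟩
  have h2 : (T.vert τ \ T.vert σ).card = m := by
    rw [card_sdiff_of_subset h0]; omega
  rw [h1, card_eq_sum_ones, sum_faces (T := T) τ (fun A => T.vert σ ⊆ A ∧ A.card = n + k),
    ← card_eq_sum_ones, ← h2, ← card_powersetCard]
  refine card_bij' (fun D _ => D \ T.vert σ) (fun D _ => T.vert σ ∪ D) ?_ ?_ ?_ ?_
  · intro D hD
    obtain ⟨h3, -, h4, h5⟩ := mem_filter.1 hD
    refine mem_powersetCard.2 ⟨sdiff_subset_sdiff (mem_powerset.1 h3) le_rfl, ?_⟩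
    rw [card_sdiff_of_subset h4]; omega
  · intro D hD
    obtain ⟨h3, h4⟩ := mem_powersetCard.1 hD
    have h5 : Disjoint (T.vert σ) D := disjoint_of_subset_right h3 disjoint_sdiff
    refine mem_filter.2 ⟨mem_powerset.2 (union_subset h0 (h3.trans sdiff_subset)),
      (T.vert_nonempty σ).mono subset_union_left, subset_union_left, ?_⟩
    rw [card_union_of_disjoint h5]; omega
  · intro D hD
    exact union_sdiff_of_subset (mem_filter.1 hD).2.2.1
  · intro D hD
    refine union_sdiff_cancel_left (disjoint_of_subset_right (mem_powersetCard.1 hD).1 ?_)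
    exact disjoint_sdiff

open Classical in
/-- The relation between the numbers of triangles and 4-simplices around an edge. -/
theorem IsClosedFourManifold.cofaceCount_edge [Fintype C] (hT : T.IsClosedFourManifold)
    {e : C} (he : e ∈ T.cells 2) : T.cofaceCount 5 e + 4 = 2 * T.cofaceCount 3 e := by
  have h2 := (mem_filter.1 he).2
  have h1 := hT.sum_cofaceCount e
  have h3 := cofaceCount_self (T := T) e
  rw [h2] at h3
  simp only [sum_range_succ, sum_range_zero, h3,
    cofaceCount_of_lt (T := T) (σ := e) (n := 0) (by omega),
    cofaceCount_of_lt (T := T) (σ := e) (n := 1) (by omega)] at h1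
  -- Double counting of the pairs $t\subset u$ around $e$: each tetrahedron lies in two 4-simplices,
  -- and three tetrahedra of a 4-simplex contain a given edge of it. With Euler's formula for the
  -- 2-sphere this gives the claim.
  have h4 : 2 * T.cofaceCount 4 e = 3 * T.cofaceCount 5 e := by
    have h5 := sum_card_bipartiteAbove_eq_sum_card_bipartiteBelow (s := (T.cells 4).filter (e ≤ ·))
      (t := (T.cells 5).filter (e ≤ ·)) (fun t u : C => t ≤ u)
    rw [sum_congr rfl (g := fun _ => 2), sum_const,
      sum_congr (s₁ := (T.cells 5).filter (e ≤ ·)) rfl (g := fun _ => 3), sum_const] at h5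
    · simp only [smul_eq_mul] at h5
      rw [cofaceCount, cofaceCount, mul_comm, h5, mul_comm]
    · intro u hu
      obtain ⟨h6, h7⟩ := mem_filter.1 hu
      have h8 := card_between (T := T) (k := 2) (m := 3) h7 h2 (mem_filter.1 h6).2
      rw [bipartiteBelow, filter_filter]
      exact h8
    · intro t ht
      obtain ⟨h6, h7⟩ := mem_filter.1 ht
      rw [← hT.cofaceCount_tetrahedron h6, cofaceCount, bipartiteAbove, filter_filter]
      congr 1
      ext u
      simp only [mem_filter, and_congr_right_iff, and_iff_right_iff_imp]
      exact fun _ h => h7.trans h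
  push_cast at h1
  omega

end Triangulation

/-! ### Pfaffians under congruence. -/

section Pfaffian

variable {m : ℕ}

/-- Skew symmetry of $A$ plays no role, since the defining sum antisymmetrizes. Expanding every
entry of $BAB^{\mathrm T}$ gives a sum over all maps $g$ of the index set to itself, in which the
sum over permutations produces the determinant of $B$ with its columns rearranged by $g$. -/
theorem pfaffian_congruence (A B : Matrix (Fin m × Fin 2) (Fin m × Fin 2) ℂ) :
    pfaffian (B * A * B.transpose) = B.det * pfaffian A := by
  let e : (Fin m × Fin 2 → Fin m × Fin 2) ≃ (Fin m → (Fin m × Fin 2) × (Fin m × Fin 2)) :=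
    { toFun := fun g a => (g (a, 0), g (a, 1))
      invFun := fun f x => if x.2 = 0 then (f x.1).1 else (f x.1).2
      left_inv := by
        intro g
        funext ⟨a, b⟩
        fin_cases b <;> simp
      right_inv := by
        intro f
        funext a
        simp }
  have h1 : ∀ x y, (B * A * B.transpose) x y =
      ∑ z : (Fin m × Fin 2) × (Fin m × Fin 2), A z.1 z.2 * (B x z.1 * B y z.2) := by
    intro x y
    rw [Fintype.sum_prod_type, Matrix.mul_apply]
    simp only [Matrix.mul_apply, Matrix.transpose_apply, sum_mul]
    rw [sum_comm]
    exact sum_congr rfl fun _ _ => sum_congr rfl fun _ _ => by ring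
  have h2 : ∀ π : Equiv.Perm (Fin m × Fin 2),
      ∏ a : Fin m, (B * A * B.transpose) (π (a, 0)) (π (a, 1)) =
        ∑ g : Fin m × Fin 2 → Fin m × Fin 2,
          (∏ a, A (g (a, 0)) (g (a, 1))) * ∏ x, B (π x) (g x) := by
    intro π
    simp only [h1]
    rw [prod_univ_sum, Fintype.piFinset_univ, ← e.sum_comp]
    refine sum_congr rfl fun g _ => ?_
    rw [prod_mul_distrib]
    congr 1
    rw [Fintype.prod_prod_type]
    exact prod_congr rfl fun a _ => by rw [Fin.prod_univ_two]; rfl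
  have h3 : ∀ g : Fin m × Fin 2 → Fin m × Fin 2,
      ∑ π : Equiv.Perm (Fin m × Fin 2), ((Equiv.Perm.sign π : ℤ) : ℂ) * ∏ x, B (π x) (g x) =
        (B.submatrix id g).det := by
    intro g
    rw [Matrix.det_apply']
    rfl
  have h4 : ∑ π : Equiv.Perm (Fin m × Fin 2), ((Equiv.Perm.sign π : ℤ) : ℂ) *
      ∏ a : Fin m, (B * A * B.transpose) (π (a, 0)) (π (a, 1)) =
      B.det * ∑ σ : Equiv.Perm (Fin m × Fin 2), ((Equiv.Perm.sign σ : ℤ) : ℂ) *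
        ∏ a : Fin m, A (σ (a, 0)) (σ (a, 1)) := by
    simp only [h2, mul_sum]
    rw [sum_comm]
    have h5 : ∀ g : Fin m × Fin 2 → Fin m × Fin 2,
        ∑ π : Equiv.Perm (Fin m × Fin 2), ((Equiv.Perm.sign π : ℤ) : ℂ) *
          ((∏ a, A (g (a, 0)) (g (a, 1))) * ∏ x, B (π x) (g x)) =
        (∏ a, A (g (a, 0)) (g (a, 1))) * (B.submatrix id g).det := by
      intro g
      rw [← h3, mul_sum]
      exact sum_congr rfl fun _ _ => by ring
    simp only [h5]
    -- Maps $g$ that are not injective repeat a column of $B$ and contribute zero, so only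
    -- permutations remain.
    symm
    refine Fintype.sum_of_injective (fun σ : Equiv.Perm (Fin m × Fin 2) => (σ : _ → _))
      DFunLike.coe_injective _ _ ?_ ?_
    · intro g hg
      have hinj : ¬ Function.Injective g := fun h =>
        hg ⟨Equiv.ofBijective g (Finite.injective_iff_bijective.1 h), rfl⟩
      simp only [Function.Injective, not_forall] at hinj
      obtain ⟨x, y, hxy, hne⟩ := hinj
      rw [Matrix.det_zero_of_column_eq hne, mul_zero]
      intro z
      simp [hxy]
    · intro σ
      rw [Matrix.det_permute']
      ring
  rw [pfaffian, h4, pfaffian]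
  ring

end Pfaffian

/-! ### Independence of the square root of the torsion from the minors, and its behaviour under
scaling. -/

section Torsion

variable {ι τ : Type*} [Fintype ι] [Fintype τ]

theorem det_submatrix_equiv_eq_or {α β : Type*} [Fintype α] [DecidableEq α] (M : Matrix β α ℂ)
    (e e' : α ≃ β) :
    (M.submatrix e id).det = (M.submatrix e' id).det ∨
      (M.submatrix e id).det = -(M.submatrix e' id).det := by
  have h : M.submatrix e id = (M.submatrix e' id).submatrix (e.trans e'.symm) id := by
    ext x y
    simp
  rw [h, Matrix.det_permute]
  rcases Int.units_eq_one_or (Equiv.Perm.sign (e.trans e'.symm)) with h | h <;> simp [h]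

/-- If the columns of `M` are the columns of `G` and the unit vectors with the numbers
`e (Sum.inr x)`, then its determinant is a minor of `G`. -/
theorem det_fromCols_single {α κ β : Type*} [Fintype α] [Fintype κ] [DecidableEq α] [DecidableEq κ]
    [DecidableEq β] (G : Matrix β α ℂ) (e : α ⊕ κ ≃ β) :
    ((Matrix.fromCols G (Matrix.of fun t x => if t = e (Sum.inr x) then (1 : ℂ) else 0)).submatrix
      e id).det = (G.submatrix (e ∘ Sum.inl) id).det := by
  have h : (Matrix.fromCols G
      (Matrix.of fun t x => if t = e (Sum.inr x) then (1 : ℂ) else 0)).submatrix e id =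
      Matrix.fromBlocks (G.submatrix (e ∘ Sum.inl) id) 0 (G.submatrix (e ∘ Sum.inr) id) 1 := by
    ext (x | x) (y | y) <;> simp [Matrix.one_apply]
  rw [h, Matrix.det_fromBlocks_zero₁₂, Matrix.det_one, mul_one]

/-- The change of basis between two bases, consisting of the columns of `G` or `G * P` and some unit
vectors. -/
theorem exists_change_of_basis {α κ β : Type*} [Fintype α] [Fintype κ] [DecidableEq α]
    [DecidableEq κ] [DecidableEq β] (G : Matrix β α ℂ) (P : Matrix α α ℂ) (e e' : α ⊕ κ ≃ β)
    (h : (G.submatrix (e ∘ Sum.inl) id).det ≠ 0) :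
    ∃ (Q : Matrix α κ ℂ) (B : Matrix κ κ ℂ),
      (Matrix.of fun t x => if t = e' (Sum.inr x) then (1 : ℂ) else 0) =
        G * Q + (Matrix.of fun t x => if t = e (Sum.inr x) then (1 : ℂ) else 0) * B ∧
      (((G * P).submatrix (e' ∘ Sum.inl) id).det =
          (G.submatrix (e ∘ Sum.inl) id).det * P.det * B.det ∨
        ((G * P).submatrix (e' ∘ Sum.inl) id).det =
          -((G.submatrix (e ∘ Sum.inl) id).det * P.det * B.det)) := by
  set D : Matrix β κ ℂ := Matrix.of fun t x => if t = e (Sum.inr x) then (1 : ℂ) else 0 with hD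
  set D' : Matrix β κ ℂ := Matrix.of fun t x => if t = e' (Sum.inr x) then (1 : ℂ) else 0 with hD'
  set A := (Matrix.fromCols G D).submatrix e id with hA
  set A' := (Matrix.fromCols (G * P) D').submatrix e id with hA'
  have hdet : A.det = (G.submatrix (e ∘ Sum.inl) id).det := det_fromCols_single G e
  have hunit : IsUnit A.det := by rw [hdet]; exact isUnit_iff_ne_zero.2 h
  -- The coordinates of the new unit vectors in the old basis: the upper rows of `Z` belong to the
  -- columns of `G` and become `Q`, the lower ones belong to the old unit vectors and become `B`.
  set Z := A⁻¹ * D'.submatrix e id with hZ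
  have hAZ : A * Z = D'.submatrix e id := by
    rw [hZ, ← Matrix.mul_assoc, Matrix.mul_nonsing_inv _ hunit, Matrix.one_mul]
  refine ⟨Z.toRows₁, Z.toRows₂, ?_, ?_⟩
  · ext t x
    have h1 := congrFun (congrFun hAZ (e.symm t)) x
    rw [Matrix.mul_apply, Fintype.sum_sum_type] at h1
    simpa [hA, Matrix.mul_apply] using h1.symm
  · have h1 : A' = A * Matrix.fromBlocks P Z.toRows₁ 0 Z.toRows₂ := by
      ext x (y | y)
      · rw [Matrix.mul_apply, Fintype.sum_sum_type]
        simp [hA, hA', Matrix.mul_apply]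
      · have h2 := congrFun (congrFun hAZ x) y
        rw [Matrix.mul_apply, Fintype.sum_sum_type] at h2 ⊢
        simpa [hA'] using h2.symm
    have h2 := det_fromCols_single (G * P) e'
    rw [← hdet, ← h2, mul_assoc, ← Matrix.det_fromBlocks_zero₂₁ P Z.toRows₁ Z.toRows₂,
      ← Matrix.det_mul, ← h1]
    exact det_submatrix_equiv_eq_or _ _ _

/-- A choice of minors is a choice of unit vectors completing the image of the preceding map to a
basis. Passing to another choice multiplies the minor of $f_1$ by $\det P$, that of $f_2$ by $\det
P\det B$ and the Pfaffian by $\det B$, up to signs, so the quotient keeps its value up to a sign.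
Only the vanishing of the products of consecutive maps enters. -/
theorem IsSqrtTorsion.eq_or_eq_neg {f₁ : Matrix ι Unit ℂ}
    {f₂ : Matrix τ ι ℂ} {f₃ : Matrix τ τ ℂ}
    (h₁₂ : f₂ * f₁ = 0) (h₂₃ : f₃ * f₂ = 0) (h₃₄ : f₂.transpose * f₃ = 0) {r r' : ℂ}
    (h : IsSqrtTorsion f₁ f₂ f₃ r) (h' : IsSqrtTorsion f₁ f₂ f₃ r') : r' = r ∨ r' = -r := by
  classical
  obtain ⟨n, m, e, g, h1, h2, -, rfl⟩ := h
  obtain ⟨n', m', e', g', h1', h2', -, rfl⟩ := h'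
  obtain rfl : n' = n := by
    have h3 := Fintype.card_congr (e.trans e'.symm)
    simp only [Fintype.card_sum, Fintype.card_fin] at h3
    omega
  obtain rfl : m' = m := by
    have h3 := Fintype.card_congr (g.trans g'.symm)
    simp only [Fintype.card_sum, Fintype.card_prod, Fintype.card_fin] at h3
    omega
  have hdet1 : ∀ e : Unit ⊕ Fin n' ≃ ι,
      (f₁.submatrix (e ∘ Sum.inl) id).det = f₁ (e (Sum.inl ())) () := fun e => by
    rw [Matrix.det_unique]; rfl
  obtain ⟨Q, P, hP, hPdet⟩ := exists_change_of_basis f₁ 1 e e' (by rwa [hdet1])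
  rw [Matrix.mul_one, Matrix.det_one, mul_one, hdet1, hdet1] at hPdet
  have hcols : ∀ e : Unit ⊕ Fin n' ≃ ι, f₂ *
      (Matrix.of fun t x => if t = e (Sum.inr x) then (1 : ℂ) else 0) =
      f₂.submatrix id (e ∘ Sum.inr) := by
    intro e
    ext t x
    simp [Matrix.mul_apply]
  -- The new unit vectors are the old ones times `P` plus multiples of the image of `f₁`, which `f₂`
  -- kills.
  have hG : f₂.submatrix id (e' ∘ Sum.inr) = f₂.submatrix id (e ∘ Sum.inr) * P := by
    rw [← hcols, ← hcols, hP, Matrix.mul_add, ← Matrix.mul_assoc, h₁₂, Matrix.zero_mul, zero_add,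
      Matrix.mul_assoc]
  obtain ⟨R, B, hB, hBdet⟩ := exists_change_of_basis (f₂.submatrix id (e ∘ Sum.inr)) P g g' h2
  rw [← hG] at hBdet
  simp only [Matrix.submatrix_submatrix, Function.id_comp, Function.comp_id] at hBdet
  have hG3 : f₃ * f₂.submatrix id (e ∘ Sum.inr) = 0 := by
    rw [← hcols, ← Matrix.mul_assoc, h₂₃, Matrix.zero_mul]
  have h3G : (f₂.submatrix id (e ∘ Sum.inr)).transpose * f₃ = 0 := by
    rw [← hcols, Matrix.transpose_mul, Matrix.mul_assoc, h₃₄, Matrix.mul_zero]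
  have hsub : ∀ g : Fin n' ⊕ (Fin m' × Fin 2) ≃ τ,
      (Matrix.of fun t x => if t = g (Sum.inr x) then (1 : ℂ) else 0).transpose * f₃ *
        (Matrix.of fun t x => if t = g (Sum.inr x) then (1 : ℂ) else 0) =
      f₃.submatrix (g ∘ Sum.inr) (g ∘ Sum.inr) := by
    intro g
    ext x y
    simp [Matrix.mul_apply]
  -- The part of the new unit vectors in the image of `f₂` is annihilated by `f₃` from both sides,
  -- so the two submatrices are congruent through `B`.
  have hpf : pfaffian (f₃.submatrix (g' ∘ Sum.inr) (g' ∘ Sum.inr)) =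
      B.det * pfaffian (f₃.submatrix (g ∘ Sum.inr) (g ∘ Sum.inr)) := by
    rw [← hsub, ← hsub, hB, Matrix.mul_assoc, Matrix.mul_add, ← Matrix.mul_assoc f₃, hG3,
      Matrix.zero_mul, zero_add, Matrix.transpose_add, Matrix.add_mul, Matrix.transpose_mul,
      Matrix.transpose_mul, Matrix.mul_assoc _ _ (f₃ * _), ← Matrix.mul_assoc _ f₃, h3G,
      Matrix.zero_mul, Matrix.mul_zero, zero_add, ← Matrix.det_transpose B,
      ← pfaffian_congruence, Matrix.transpose_transpose]
    simp only [Matrix.mul_assoc]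
  have hPB : P.det ≠ 0 ∧ B.det ≠ 0 := by
    constructor
    · intro h0
      rw [h0, mul_zero, zero_mul, neg_zero, or_self] at hBdet
      exact h2' hBdet
    · intro h0
      rw [h0, mul_zero, neg_zero, or_self] at hBdet
      exact h2' hBdet
  obtain ⟨hP0, hB0⟩ := hPB
  rw [hpf]
  rcases hPdet with h3 | h3 <;> rcases hBdet with h4 | h4 <;> rw [h3, h4]
  · left; field_simp
  · right; field_simp
  · right; field_simp
  · left; field_simp

/-- The rows in the minor of $f_2$ put their $c_t$ into the denominator, and the remaining rows and
columns give their $c_t^{-1}$ through the Pfaffian. Together every tetrahedron contributes exactly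
once. -/
theorem IsSqrtTorsion.scale {f₁ : Matrix ι Unit ℂ}
    {f₂ f₂' : Matrix τ ι ℂ} {f₃ f₃' : Matrix τ τ ℂ} {c : τ → ℂ} (hc : ∀ t, c t ≠ 0)
    (h₂ : ∀ t a, f₂' t a = c t * f₂ t a)
    (h₃ : ∀ t t', f₃' t t' = (c t)⁻¹ * (c t')⁻¹ * f₃ t t') {r : ℂ}
    (h : IsSqrtTorsion f₁ f₂ f₃ r) : IsSqrtTorsion f₁ f₂' f₃' ((∏ t, c t)⁻¹ * r) := by
  obtain ⟨n, m, e, g, h1, h2, h3, rfl⟩ := h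
  have h4 : f₂'.submatrix (g ∘ Sum.inl) (e ∘ Sum.inr) =
      Matrix.diagonal (fun x => c (g (Sum.inl x))) *
        f₂.submatrix (g ∘ Sum.inl) (e ∘ Sum.inr) := by
    ext x y
    simp [h₂]
  have h5 : f₃'.submatrix (g ∘ Sum.inr) (g ∘ Sum.inr) =
      Matrix.diagonal (fun x => (c (g (Sum.inr x)))⁻¹) *
        f₃.submatrix (g ∘ Sum.inr) (g ∘ Sum.inr) *
        (Matrix.diagonal (fun x => (c (g (Sum.inr x)))⁻¹)).transpose := by
    ext x y
    simp [h₃]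
    ring
  have h6 : ∏ x, c (g (Sum.inl x)) ≠ 0 := prod_ne_zero_iff.2 fun _ _ => hc _
  have h7 : ∏ x, c (g (Sum.inr x)) ≠ 0 := prod_ne_zero_iff.2 fun _ _ => hc _
  refine ⟨n, m, e, g, h1, ?_, ?_, ?_⟩
  · rw [h4, Matrix.det_mul, Matrix.det_diagonal]
    exact mul_ne_zero h6 h2
  · rw [h5, Matrix.det_mul, Matrix.det_mul, Matrix.det_transpose, Matrix.det_diagonal,
      prod_inv_distrib]
    exact mul_ne_zero (mul_ne_zero (inv_ne_zero h7) h3) (inv_ne_zero h7)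
  · rw [h4, h5, pfaffian_congruence, Matrix.det_mul, Matrix.det_diagonal, Matrix.det_diagonal,
      prod_inv_distrib, ← g.prod_comp, Fintype.prod_sum_type]
    field_simp

end Torsion

/-! ### Edge operators in one 4-simplex -/

/-- The coefficients at one kind of Grassmann generators of edge operators in a 4-simplex with the
vertices `0, …, 4`; the tetrahedra are numbered by their missing vertices. -/
structure IsEdgeFamily (w : Fin 5 → Fin 5 → Fin 5 → ℂ) (b : Fin 5 → Fin 5 → Fin 5 → ℂ) : Prop where
  support : ∀ a i, b a a i = 0
  antisymm : ∀ a i j, b a j i = -b a i j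
  cycle : ∀ a i, ∑ j, b a i j = 0
  relation : ∀ a m, ∑ i, ∑ j, w m i j * b a i j = 0

/-- The values of a cocycle on the triangles of a 4-simplex. -/
structure IsLocalCocycle (w : Fin 5 → Fin 5 → Fin 5 → ℂ) : Prop where
  swap₁₂ : ∀ i j k, w j i k = -w i j k
  swap₂₃ : ∀ i j k, w i k j = -w i j k
  closed : ∀ i j k l, w j k l - w i k l + w i j l - w i j k = 0
  ne_zero : ∀ i j k, i ≠ j → i ≠ k → j ≠ k → w i j k ≠ 0

/-- The rows of `b` for the edges `30`, `31`, `20`, `21`, `23`. -/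
def edgeMatrix (b : Fin 5 → Fin 5 → Fin 5 → ℂ) : Matrix (Fin 5) (Fin 5) ℂ :=
  Matrix.of fun x a => ![b a 3 0, b a 3 1, b a 2 0, b a 2 1, b a 2 3] x

/-- The minor of the matrix of an edge family, normalized so that it does not depend on the order of
the vertices. -/
noncomputable def edgeMinor (w b : Fin 5 → Fin 5 → Fin 5 → ℂ) : ℂ :=
  (edgeMatrix b).det / w 0 1 4

/-- Renumbering the vertices. -/
def relabel (π : Equiv.Perm (Fin 5)) (b : Fin 5 → Fin 5 → Fin 5 → ℂ) : Fin 5 → Fin 5 → Fin 5 → ℂ :=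
  fun i j k => b (π i) (π j) (π k)

theorem IsLocalCocycle.cyclic {w : Fin 5 → Fin 5 → Fin 5 → ℂ} (hw : IsLocalCocycle w)
    (i j k : Fin 5) : w k i j = w i j k := by
  rw [hw.swap₁₂, hw.swap₂₃, neg_neg]

theorem IsLocalCocycle.relabel {w : Fin 5 → Fin 5 → Fin 5 → ℂ} (hw : IsLocalCocycle w)
    (π : Equiv.Perm (Fin 5)) : IsLocalCocycle (relabel π w) where
  swap₁₂ _ _ _ := hw.swap₁₂ _ _ _
  swap₂₃ _ _ _ := hw.swap₂₃ _ _ _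
  closed _ _ _ _ := hw.closed _ _ _ _
  ne_zero _ _ _ h h' h'' := hw.ne_zero _ _ _ (π.injective.ne h) (π.injective.ne h')
    (π.injective.ne h'')

theorem IsEdgeFamily.relabel {w b : Fin 5 → Fin 5 → Fin 5 → ℂ} (hb : IsEdgeFamily w b)
    (π : Equiv.Perm (Fin 5)) : IsEdgeFamily (relabel π w) (relabel π b) where
  support _ _ := hb.support _ _
  antisymm _ _ _ := hb.antisymm _ _ _
  cycle a i := (Equiv.sum_comp π fun j => b (π a) (π i) j).trans (hb.cycle _ _)
  relation a m := by
    refine Eq.trans ?_ (hb.relation (π a) (π m))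
    rw [← Equiv.sum_comp π fun i => ∑ j, w (π m) i j * b (π a) i j]
    exact sum_congr rfl fun i _ =>
      Equiv.sum_comp π fun j => w (π m) (π i) j * b (π a) (π i) j

/-- A change of rows and a transposition of columns. -/
theorem det_edgeMatrix_swap {b : Fin 5 → Fin 5 → Fin 5 → ℂ} {i j : Fin 5} (hij : i ≠ j)
    (S : Matrix (Fin 5) (Fin 5) ℂ) (c : ℂ)
    (h : ∀ a x, c * ![b a (Equiv.swap i j 3) (Equiv.swap i j 0),
        b a (Equiv.swap i j 3) (Equiv.swap i j 1), b a (Equiv.swap i j 2) (Equiv.swap i j 0),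
        b a (Equiv.swap i j 2) (Equiv.swap i j 1), b a (Equiv.swap i j 2) (Equiv.swap i j 3)] x =
      S x 0 * b a 3 0 + S x 1 * b a 3 1 + S x 2 * b a 2 0 + S x 3 * b a 2 1 + S x 4 * b a 2 3) :
    c ^ 5 * (edgeMatrix (relabel (Equiv.swap i j) b)).det = -(S.det * (edgeMatrix b).det) := by
  have h1 : c • (edgeMatrix (relabel (Equiv.swap i j) b)).submatrix id (Equiv.swap i j) =
      S * edgeMatrix b := by
    ext x a
    rw [Matrix.mul_apply, Fin.sum_univ_five]
    refine Eq.trans ?_ (h a x)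
    simp [edgeMatrix, relabel]
  -- The power of `c` counts the rows, and the minus sign comes from the transposed columns.
  rw [← Matrix.det_mul, ← h1, Matrix.det_smul, Matrix.det_permute', Equiv.Perm.sign_swap hij]
  simp

variable {w b g : Fin 5 → Fin 5 → Fin 5 → ℂ}

/-- With the cochain $\nu_{ij}=\omega_{4ij}$ the relation involves only the edges of the tetrahedron
$0123$. The cycle conditions eliminate the edges at $4$, and this relation eliminates the edge $01$
at the cost of dividing by $\omega_{401}=\omega_{014}$. That explains both the five rows of
`edgeMatrix` and the denominator of `edgeMinor`. -/
theorem IsEdgeFamily.relation_four (hw : IsLocalCocycle w) (hb : IsEdgeFamily w b) (a : Fin 5) :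
    w 4 0 1 * b a 0 1 + w 4 0 2 * b a 0 2 + w 4 0 3 * b a 0 3 + w 4 1 2 * b a 1 2 +
      w 4 1 3 * b a 1 3 + w 4 2 3 * b a 2 3 = 0 := by
  have h := hb.relation a 4
  have h0 : ∀ i, b a i i = 0 := fun i => by
    have := hb.antisymm a i i
    linear_combination (1 / 2 : ℂ) * this
  have h4 : ∀ i, w 4 4 i = 0 := fun i => by
    have := hw.swap₁₂ 4 4 i
    linear_combination (1 / 2 : ℂ) * this
  have h4' : ∀ i, w 4 i 4 = 0 := fun i => by
    rw [hw.swap₂₃, h4, neg_zero]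
  simp only [Fin.sum_univ_five, h0, h4, h4', mul_zero, zero_mul, zero_add, add_zero] at h
  rw [hb.antisymm a 0 1, hb.antisymm a 0 2, hb.antisymm a 0 3, hb.antisymm a 1 2,
    hb.antisymm a 1 3, hb.antisymm a 2 3, hw.swap₂₃ 4 0 1, hw.swap₂₃ 4 0 2, hw.swap₂₃ 4 0 3,
    hw.swap₂₃ 4 1 2, hw.swap₂₃ 4 1 3, hw.swap₂₃ 4 2 3] at h
  linear_combination (1 / 2 : ℂ) * h

theorem edgeMinor_swap_zero_one (hw : IsLocalCocycle w) :
    edgeMinor (relabel (Equiv.swap 0 1) w) (relabel (Equiv.swap 0 1) b) = edgeMinor w b := by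
  have h := det_edgeMatrix_swap (b := b) (i := 0) (j := 1) (by decide)
    !![0, 1, 0, 0, 0; 1, 0, 0, 0, 0; 0, 0, 0, 1, 0; 0, 0, 1, 0, 0; 0, 0, 0, 0, 1] 1 (by
      intro a x
      fin_cases x <;> simp [Equiv.swap_apply_def])
  have hS : (!![0, 1, 0, 0, 0; 1, 0, 0, 0, 0; 0, 0, 0, 1, 0; 0, 0, 1, 0, 0; 0, 0, 0, 0, 1] :
      Matrix (Fin 5) (Fin 5) ℂ).det = 1 := by
    simp [Matrix.det_succ_row_zero, Fin.sum_univ_succ, Fin.succAbove]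
  rw [hS] at h
  have h1 : relabel (Equiv.swap 0 1) w 0 1 4 = -w 0 1 4 := by
    rw [← hw.swap₁₂]; rfl
  rw [edgeMinor, edgeMinor, h1, div_neg, ← neg_div]
  congr 1
  linear_combination -h

/-- The new rows contain the eliminated edge $01$. The third row of the matrix expresses it by
`relation_four`; the factor $\omega_{014}$ in front keeps everything polynomial. -/
theorem edgeMinor_swap_one_two (hw : IsLocalCocycle w) (hb : IsEdgeFamily w b) :
    edgeMinor (relabel (Equiv.swap 1 2) w) (relabel (Equiv.swap 1 2) b) = edgeMinor w b := by
  have h0 : w 0 1 4 ≠ 0 := hw.ne_zero _ _ _ (by decide) (by decide) (by decide)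
  have h0' : w 0 2 4 ≠ 0 := hw.ne_zero _ _ _ (by decide) (by decide) (by decide)
  have h := det_edgeMatrix_swap (b := b) (i := 1) (j := 2) (by decide)
    !![w 0 1 4, 0, 0, 0, 0; 0, 0, 0, 0, -w 0 1 4;
      -w 4 0 3, -w 4 1 3, -w 4 0 2, -w 4 1 2, w 4 2 3;
      0, 0, 0, -w 0 1 4, 0; 0, -w 0 1 4, 0, 0, 0] (w 0 1 4) (by
      intro a x
      have h1 := hb.relation_four hw a
      have h2 : w 0 1 4 = w 4 0 1 := (hw.cyclic 0 1 4).symm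
      have h3 := hb.antisymm a 0 1
      have h4 := hb.antisymm a 0 2
      have h5 := hb.antisymm a 0 3
      have h6 := hb.antisymm a 1 2
      have h7 := hb.antisymm a 1 3
      have h8 := hb.antisymm a 2 3
      fin_cases x <;> simp [Equiv.swap_apply_def]
      · linear_combination w 0 1 4 * h8
      · rw [h3, h4, h5, h6, h7]
        linear_combination -h1 - b a 0 1 * h2
      · linear_combination w 0 1 4 * h6
      · linear_combination w 0 1 4 * h7)
  have hS : (!![w 0 1 4, 0, 0, 0, 0; 0, 0, 0, 0, -w 0 1 4;
      -w 4 0 3, -w 4 1 3, -w 4 0 2, -w 4 1 2, w 4 2 3;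
      0, 0, 0, -w 0 1 4, 0; 0, -w 0 1 4, 0, 0, 0] :
      Matrix (Fin 5) (Fin 5) ℂ).det = w 0 1 4 ^ 4 * -w 4 0 2 := by
    simp [Matrix.det_succ_row_zero, Fin.sum_univ_succ, Fin.succAbove]
    ring
  have h2 : w 4 0 2 = w 0 2 4 := hw.cyclic 0 2 4
  have h1 : relabel (Equiv.swap 1 2) w 0 1 4 = w 0 2 4 := rfl
  rw [hS, h2] at h
  rw [edgeMinor, edgeMinor, h1, div_eq_div_iff h0' h0]
  refine mul_left_cancel₀ (pow_ne_zero 4 h0) ?_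
  linear_combination h

theorem edgeMinor_swap_two_three (hb : IsEdgeFamily w b) :
    edgeMinor (relabel (Equiv.swap 2 3) w) (relabel (Equiv.swap 2 3) b) = edgeMinor w b := by
  have h := det_edgeMatrix_swap (b := b) (i := 2) (j := 3) (by decide)
    !![0, 0, 1, 0, 0; 0, 0, 0, 1, 0; 1, 0, 0, 0, 0; 0, 1, 0, 0, 0; 0, 0, 0, 0, -1] 1 (by
      intro a x
      have h8 := hb.antisymm a 2 3
      fin_cases x <;> simp [Equiv.swap_apply_def, h8])
  have hS : (!![0, 0, 1, 0, 0; 0, 0, 0, 1, 0; 1, 0, 0, 0, 0; 0, 1, 0, 0, 0; 0, 0, 0, 0, -1] :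
      Matrix (Fin 5) (Fin 5) ℂ).det = -1 := by
    simp [Matrix.det_succ_row_zero, Fin.sum_univ_succ, Fin.succAbove]
  rw [hS] at h
  have h1 : relabel (Equiv.swap 2 3) w 0 1 4 = w 0 1 4 := rfl
  rw [edgeMinor, edgeMinor, h1]
  congr 1
  linear_combination h

/-- The new rows contain $40$, $41$ and $24$, which the cycle conditions at $0$, $1$, $2$ reduce to
edges of $0123$; in the first two of them the edge $01$ appears and is removed by `relation_four`.
-/
theorem edgeMinor_swap_three_four (hw : IsLocalCocycle w) (hb : IsEdgeFamily w b) :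
    edgeMinor (relabel (Equiv.swap 3 4) w) (relabel (Equiv.swap 3 4) b) = edgeMinor w b := by
  have h0 : w 0 1 4 ≠ 0 := hw.ne_zero _ _ _ (by decide) (by decide) (by decide)
  have h0' : w 0 1 3 ≠ 0 := hw.ne_zero _ _ _ (by decide) (by decide) (by decide)
  have h2 : w 0 1 4 = w 4 0 1 := (hw.cyclic 0 1 4).symm
  have h := det_edgeMatrix_swap (b := b) (i := 3) (j := 4) (by decide)
    !![w 4 0 3 - w 0 1 4, w 4 1 3, w 4 0 2 - w 0 1 4, w 4 1 2, -w 4 2 3;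
      -w 4 0 3, -w 4 1 3 - w 0 1 4, -w 4 0 2, -w 4 1 2 - w 0 1 4, w 4 2 3;
      0, 0, w 0 1 4, 0, 0; 0, 0, 0, w 0 1 4, 0;
      0, 0, -w 0 1 4, -w 0 1 4, -w 0 1 4] (w 0 1 4) (by
      intro a x
      have h1 := hb.relation_four hw a
      have h3 := hb.antisymm a 0 1
      have h4 := hb.antisymm a 0 2
      have h5 := hb.antisymm a 0 3
      have h6 := hb.antisymm a 1 2
      have h7 := hb.antisymm a 1 3
      have h8 := hb.antisymm a 0 4
      have h9 := hb.antisymm a 1 4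
      have hc0 := hb.cycle a 0
      have hc1 := hb.cycle a 1
      have hc2 := hb.cycle a 2
      have h10 : ∀ i, b a i i = 0 := fun i => by
        have := hb.antisymm a i i
        linear_combination (1 / 2 : ℂ) * this
      simp only [Fin.sum_univ_five, h10] at hc0 hc1 hc2
      fin_cases x <;> simp [Equiv.swap_apply_def]
      · rw [h8, h5, h4, h7, h6]
        linear_combination -w 0 1 4 * hc0 + h1 + b a 0 1 * h2
      · rw [h9, h5, h4, h7, h6]
        linear_combination -w 0 1 4 * hc1 - h1 - b a 0 1 * h2 + w 0 1 4 * h3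
      · linear_combination w 0 1 4 * hc2)
  have hS : (!![w 4 0 3 - w 0 1 4, w 4 1 3, w 4 0 2 - w 0 1 4, w 4 1 2, -w 4 2 3;
      -w 4 0 3, -w 4 1 3 - w 0 1 4, -w 4 0 2, -w 4 1 2 - w 0 1 4, w 4 2 3;
      0, 0, w 0 1 4, 0, 0; 0, 0, 0, w 0 1 4, 0;
      0, 0, -w 0 1 4, -w 0 1 4, -w 0 1 4] : Matrix (Fin 5) (Fin 5) ℂ).det =
      w 0 1 4 ^ 4 * -w 0 1 3 := by
    -- The determinant contains $\omega_{413}-\omega_{403}+\omega_{014}$, which the cocycle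
    -- condition on $4013$ identifies with $\omega_{013}$.
    have h3 := hw.closed 4 0 1 3
    simp [Matrix.det_succ_row_zero, Fin.sum_univ_succ, Fin.succAbove]
    linear_combination w 0 1 4 ^ 4 * h3 - w 0 1 4 ^ 4 * h2
  have h1 : relabel (Equiv.swap 3 4) w 0 1 4 = w 0 1 3 := rfl
  rw [hS] at h
  rw [edgeMinor, edgeMinor, h1, div_eq_div_iff h0' h0]
  refine mul_left_cancel₀ (pow_ne_zero 4 h0) ?_
  linear_combination h

/-- The normalized minor does not depend on the order of the vertices. -/
theorem edgeMinor_relabel (hw : IsLocalCocycle w) (hb : IsEdgeFamily w b)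
    (π : Equiv.Perm (Fin 5)) : edgeMinor (relabel π w) (relabel π b) = edgeMinor w b := by
  -- Adjacent transpositions generate the symmetric group; each of the four was treated above.
  have h1 : π ∈ Submonoid.closure (Set.range fun i : Fin 4 => Equiv.swap i.castSucc i.succ) := by
    rw [Equiv.Perm.mclosure_swap_castSucc_succ]
    trivial
  induction h1 using Submonoid.closure_induction generalizing w b with
  | mem x hx =>
    obtain ⟨i, rfl⟩ := hx
    fin_cases i
    · exact edgeMinor_swap_zero_one hw
    · exact edgeMinor_swap_one_two hw hb
    · exact edgeMinor_swap_two_three hb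
    · exact edgeMinor_swap_three_four hw hb
  | one => rfl
  | mul x y _ _ hx hy =>
    exact (hy (hw.relabel x) (hb.relabel x)).trans (hx hw hb)

/-- The product of `edgeMatrix b` with a matrix such that the columns of the product are the columns
of `b` and `g` for the tetrahedra `2` and `3`, and one more column. -/
theorem det_edgeMatrix_mul (hb : IsEdgeFamily w b) (hg : IsEdgeFamily w g)
    {F : Fin 5 → Fin 5 → ℂ} (hF : ∀ a' i j, g a' i j = ∑ a, b a i j * F a a')
    (x : Fin 5 → ℂ) :
    (edgeMatrix b).det * (F 0 2 * (F 1 3 * x 4 - x 1 * F 4 3) - F 0 3 * (F 1 2 * x 4 - x 1 * F 4 2)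
        + x 0 * (F 1 2 * F 4 3 - F 1 3 * F 4 2)) =
      -((b 2 3 0 * g 2 3 1 - b 2 3 1 * g 2 3 0) * (b 3 2 0 * g 3 2 1 - b 3 2 1 * g 3 2 0) *
        ∑ a, b a 2 3 * x a) := by
  have hb' : ∀ a i, b a i a = 0 := fun a i => by rw [hb.antisymm, hb.support, neg_zero]
  have hg' : ∀ a i, g a i a = 0 := fun a i => by rw [hg.antisymm, hg.support, neg_zero]
  -- The columns are the unit vector and the column of `F` for the tetrahedron $2$, the same for the
  -- tetrahedron $3$, and `x`.
  set S : Matrix (Fin 5) (Fin 5) ℂ := !![0, F 0 2, 0, F 0 3, x 0; 0, F 1 2, 0, F 1 3, x 1;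
    1, F 2 2, 0, F 2 3, x 2; 0, F 3 2, 1, F 3 3, x 3; 0, F 4 2, 0, F 4 3, x 4] with hS
  -- The tetrahedron $2$ has no edges at the vertex $2$ and the tetrahedron $3$ none at the vertex
  -- $3$. So two $2\times2$ blocks and one last entry, for the edge $23$, remain.
  have h1 : edgeMatrix b * S =
      !![b 2 3 0, g 2 3 0, 0, 0, ∑ a, b a 3 0 * x a; b 2 3 1, g 2 3 1, 0, 0, ∑ a, b a 3 1 * x a;
        0, 0, b 3 2 0, g 3 2 0, ∑ a, b a 2 0 * x a; 0, 0, b 3 2 1, g 3 2 1, ∑ a, b a 2 1 * x a;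
        0, 0, 0, 0, ∑ a, b a 2 3 * x a] := by
    have h2 : ∀ y, (edgeMatrix b * S) y = ![edgeMatrix b y 2, ∑ a, edgeMatrix b y a * F a 2,
        edgeMatrix b y 3, ∑ a, edgeMatrix b y a * F a 3, ∑ a, edgeMatrix b y a * x a] := by
      intro y
      ext z
      rw [Matrix.mul_apply]
      fin_cases z <;> simp [hS, Fin.sum_univ_five]
    ext y z
    rw [h2]
    fin_cases y <;>
      simp only [edgeMatrix, Matrix.of_apply, Fin.zero_eta, Fin.mk_one, Fin.reduceFinMk,
        Matrix.cons_val, ← hF] <;>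
      fin_cases z <;> simp [hb.support, hg.support, hb', hg']
  have h3 := congrArg Matrix.det h1
  rw [Matrix.det_mul] at h3
  have h4 : S.det = -(F 0 2 * (F 1 3 * x 4 - x 1 * F 4 3) - F 0 3 * (F 1 2 * x 4 - x 1 * F 4 2)
      + x 0 * (F 1 2 * F 4 3 - F 1 3 * F 4 2)) := by
    simp [hS, Matrix.det_succ_row_zero, Fin.sum_univ_succ, Fin.succAbove]
    ring
  rw [h4, mul_neg, neg_eq_iff_eq_neg] at h3
  rw [h3]
  congr 1
  simp [Matrix.det_succ_row_zero, Fin.sum_univ_succ, Fin.succAbove]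
  ring

/-- The coefficients `b` and `g` of edge operators in a 4-simplex with the vertices `0, …, 4` and the
orientation `ε`; `k a` is the square root for the tetrahedron without the vertex `a`, with the
orientation of the order `0, …, 4` of the vertices. -/
structure IsEdgePair (w : Fin 5 → Fin 5 → Fin 5 → ℂ) (k : Fin 5 → ℂ) (ε : ℂ)
    (b g : Fin 5 → Fin 5 → Fin 5 → ℂ) : Prop where
  left : IsEdgeFamily w b
  right : IsEdgeFamily w g
  cocycle : IsLocalCocycle w
  sign : ε ^ 2 = 1
  sq : ∀ π : Equiv.Perm (Fin 5), k (π 4) ^ 2 =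
    w (π 0) (π 1) (π 2) * w (π 0) (π 1) (π 3) * w (π 0) (π 2) (π 3) * w (π 1) (π 2) (π 3)
  normalization : ∀ π : Equiv.Perm (Fin 5),
    b (π 4) (π 0) (π 1) * g (π 4) (π 0) (π 2) + b (π 4) (π 0) (π 2) * g (π 4) (π 0) (π 1) =
      (Equiv.Perm.sign π : ℤ) * ε / w (π 0) (π 1) (π 2)
  branch : ∀ π : Equiv.Perm (Fin 5),
    b (π 4) (π 0) (π 1) * g (π 4) (π 0) (π 2) - b (π 4) (π 0) (π 2) * g (π 4) (π 0) (π 1) =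
      -ε * k (π 4) / (w (π 0) (π 1) (π 2) * w (π 0) (π 1) (π 3) * w (π 0) (π 2) (π 3))

variable {w b g b' g' : Fin 5 → Fin 5 → Fin 5 → ℂ} {k : Fin 5 → ℂ} {ε : ℂ}

/-- An odd renumbering changes the sign of the orientation and of all $K_t$ at once. The product
$\varepsilon k$ in the branch condition is therefore unchanged, while the normalization sees
$\varepsilon$ alone. -/
theorem IsEdgePair.relabel (h : IsEdgePair w k ε b g) (π : Equiv.Perm (Fin 5)) :
    IsEdgePair (relabel π w) (fun a => (Equiv.Perm.sign π : ℤ) * k (π a))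
      ((Equiv.Perm.sign π : ℤ) * ε) (relabel π b) (relabel π g) := by
  have hs : (((Equiv.Perm.sign π : ℤ) : ℂ)) ^ 2 = 1 := by
    rcases Int.units_eq_one_or (Equiv.Perm.sign π) with h | h <;> simp [h]
  refine ⟨h.left.relabel π, h.right.relabel π, h.cocycle.relabel π, ?_, ?_, ?_, ?_⟩
  · rw [mul_pow, hs, h.sign, one_mul]
  · intro σ
    rw [mul_pow, hs, one_mul]
    exact h.sq (π * σ)
  · intro σ
    refine (h.normalization (π * σ)).trans ?_
    rw [Equiv.Perm.sign_mul]
    push_cast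
    rw [mul_left_comm, mul_assoc]
    rfl
  · intro σ
    refine (h.branch (π * σ)).trans ?_
    have h1 : ((Equiv.Perm.sign π : ℤ) : ℂ) * ε * ((Equiv.Perm.sign π : ℤ) * k (π (σ 4))) =
        ε * k (π (σ 4)) := by
      linear_combination ε * k (π (σ 4)) * hs
    rw [neg_mul, neg_mul, h1]
    rfl

theorem IsEdgePair.k_ne_zero (h : IsEdgePair w k ε b g) (π : Equiv.Perm (Fin 5)) : k (π 4) ≠ 0 := by
  have h1 : ∀ i j l : Fin 5, i ≠ j → i ≠ l → j ≠ l → w (π i) (π j) (π l) ≠ 0 :=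
    fun i j l h1 h2 h3 => h.cocycle.ne_zero _ _ _ (π.injective.ne h1) (π.injective.ne h2)
      (π.injective.ne h3)
  refine fun h0 => ?_
  have h2 := h.sq π
  rw [h0, zero_pow two_ne_zero] at h2
  exact mul_ne_zero (mul_ne_zero (mul_ne_zero (h1 0 1 2 (by decide) (by decide) (by decide))
    (h1 0 1 3 (by decide) (by decide) (by decide))) (h1 0 2 3 (by decide) (by decide) (by decide)))
    (h1 1 2 3 (by decide) (by decide) (by decide)) h2.symm

/-- This $2\times2$ determinant is what makes the differential and the multiplicative coefficients
at one tetrahedron linearly independent; all nondegeneracy below comes from it. -/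
theorem IsEdgePair.branch_ne_zero (h : IsEdgePair w k ε b g) (π : Equiv.Perm (Fin 5)) :
    b (π 4) (π 0) (π 1) * g (π 4) (π 0) (π 2) - b (π 4) (π 0) (π 2) * g (π 4) (π 0) (π 1) ≠ 0 := by
  have h1 : ∀ i j l : Fin 5, i ≠ j → i ≠ l → j ≠ l → w (π i) (π j) (π l) ≠ 0 :=
    fun i j l h1 h2 h3 => h.cocycle.ne_zero _ _ _ (π.injective.ne h1) (π.injective.ne h2)
      (π.injective.ne h3)
  have hε : ε ≠ 0 := fun h0 => by
    have := h.sign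
    rw [h0] at this
    norm_num at this
  rw [h.branch]
  exact div_ne_zero (mul_ne_zero (neg_ne_zero.2 hε) (h.k_ne_zero π))
    (mul_ne_zero (mul_ne_zero (h1 0 1 2 (by decide) (by decide) (by decide))
    (h1 0 1 3 (by decide) (by decide) (by decide))) (h1 0 2 3 (by decide) (by decide) (by decide)))

/-- The coefficients for opposite edges of a tetrahedron. -/
theorem IsEdgePair.opposite (h : IsEdgePair w k ε b g) :
    b 4 0 1 * (w 0 1 2 * w 0 1 3) = b 4 2 3 * k 4 := by
  have hw := h.cocycle
  have h012 : w 0 1 2 ≠ 0 := hw.ne_zero _ _ _ (by decide) (by decide) (by decide)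
  have h013 : w 0 1 3 ≠ 0 := hw.ne_zero _ _ _ (by decide) (by decide) (by decide)
  have h023 : w 0 2 3 ≠ 0 := hw.ne_zero _ _ _ (by decide) (by decide) (by decide)
  have h123 : w 1 2 3 ≠ 0 := hw.ne_zero _ _ _ (by decide) (by decide) (by decide)
  have hsq : k 4 ^ 2 = w 0 1 2 * w 0 1 3 * w 0 2 3 * w 1 2 3 := h.sq 1
  have n1 : b 4 0 1 * g 4 0 2 + b 4 0 2 * g 4 0 1 = ε / w 0 1 2 := by
    have := h.normalization 1
    simpa using this
  have b1 : b 4 0 1 * g 4 0 2 - b 4 0 2 * g 4 0 1 =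
      -ε * k 4 / (w 0 1 2 * w 0 1 3 * w 0 2 3) := h.branch 1
  have n2 : b 4 0 1 * g 4 0 3 + b 4 0 3 * g 4 0 1 = -ε / w 0 1 3 := by
    have := h.normalization (Equiv.swap 2 3)
    rw [Equiv.Perm.sign_swap (by decide)] at this
    refine Eq.trans this ?_
    norm_num
    rfl
  have b2 : b 4 0 1 * g 4 0 3 - b 4 0 3 * g 4 0 1 =
      -ε * k 4 / (w 0 1 3 * w 0 1 2 * w 0 3 2) := h.branch (Equiv.swap 2 3)
  have n3 : b 4 2 3 * g 4 2 0 + b 4 2 0 * g 4 2 3 = ε / w 2 3 0 := by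
    have := h.normalization (Equiv.swap 0 2 * Equiv.swap 1 3)
    rw [Equiv.Perm.sign_mul, Equiv.Perm.sign_swap (by decide),
      Equiv.Perm.sign_swap (by decide)] at this
    refine Eq.trans this ?_
    norm_num
    rfl
  have b3 : b 4 2 3 * g 4 2 0 - b 4 2 0 * g 4 2 3 =
      -ε * k 4 / (w 2 3 0 * w 2 3 1 * w 2 0 1) := h.branch (Equiv.swap 0 2 * Equiv.swap 1 3)
  have n4 : b 4 3 2 * g 4 3 0 + b 4 3 0 * g 4 3 2 = -ε / w 3 2 0 := by
    have := h.normalization (Equiv.swap 2 3 * Equiv.swap 0 2 * Equiv.swap 1 3)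
    rw [Equiv.Perm.sign_mul, Equiv.Perm.sign_mul, Equiv.Perm.sign_swap (by decide),
      Equiv.Perm.sign_swap (by decide), Equiv.Perm.sign_swap (by decide)] at this
    refine Eq.trans this ?_
    norm_num
    rfl
  have b4 : b 4 3 2 * g 4 3 0 - b 4 3 0 * g 4 3 2 =
      -ε * k 4 / (w 3 2 0 * w 3 2 1 * w 3 0 1) :=
    h.branch (Equiv.swap 2 3 * Equiv.swap 0 2 * Equiv.swap 1 3)
  have a1 := h.right.antisymm 4 0 2
  have a2 := h.right.antisymm 4 0 3
  have a3 := h.left.antisymm 4 2 3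
  rw [hw.swap₂₃ 0 2 3] at b2
  rw [← hw.cyclic 2 3 0] at n3 b3
  rw [← hw.cyclic 2 3 1, hw.cyclic 0 1 2] at b3
  rw [hw.swap₁₂ 2 3 0, ← hw.cyclic 2 3 0] at n4 b4
  rw [hw.swap₁₂ 2 3 1, ← hw.cyclic 2 3 1, hw.cyclic 0 1 3] at b4
  rw [a1] at n3 b3
  rw [a2, a3] at n4 b4
  -- Half the sum of the normalization and branch conditions is a single product of coefficients.
  -- Computing the products of $g_{02}$ with both opposite edges gives equal results, by the formula
  -- for $k_4^2$; below the same is done with $g_{03}$.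
  have e1 : (b 4 0 1 * (w 0 1 2 * w 0 1 3) - b 4 2 3 * k 4) * g 4 0 2 = 0 := by
    have p1 : 2 * (b 4 0 1 * g 4 0 2) * (w 0 1 2 * w 0 1 3) = ε * (w 0 1 3 - k 4 / w 0 2 3) := by
      have : 2 * (b 4 0 1 * g 4 0 2) = ε / w 0 1 2 + -ε * k 4 / (w 0 1 2 * w 0 1 3 * w 0 2 3) := by
        linear_combination n1 + b1
      rw [this]
      field_simp
      ring
    have p2 : 2 * (b 4 2 3 * g 4 0 2) * k 4 = ε * (w 0 1 3 - k 4 / w 0 2 3) := by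
      have : 2 * (b 4 2 3 * g 4 0 2) =
          -(ε / w 0 2 3 + -ε * k 4 / (w 0 2 3 * w 1 2 3 * w 0 1 2)) := by
        linear_combination -n3 - b3
      rw [this]
      field_simp
      linear_combination ε * hsq
    linear_combination (p1 - p2) / 2
  have e2 : (b 4 0 1 * (w 0 1 2 * w 0 1 3) - b 4 2 3 * k 4) * g 4 0 3 = 0 := by
    have p1 : 2 * (b 4 0 1 * g 4 0 3) * (w 0 1 2 * w 0 1 3) = ε * (k 4 / w 0 2 3 - w 0 1 2) := by
      have : 2 * (b 4 0 1 * g 4 0 3) =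
          -ε / w 0 1 3 + -ε * k 4 / (w 0 1 3 * w 0 1 2 * -w 0 2 3) := by
        linear_combination n2 + b2
      rw [this]
      field_simp
      ring
    have p2 : 2 * (b 4 2 3 * g 4 0 3) * k 4 = ε * (k 4 / w 0 2 3 - w 0 1 2) := by
      have : 2 * (b 4 2 3 * g 4 0 3) =
          -ε / -w 0 2 3 + -ε * k 4 / (-w 0 2 3 * -w 1 2 3 * w 0 1 3) := by
        linear_combination n4 + b4
      rw [this]
      field_simp
      linear_combination -ε * hsq
    linear_combination (p1 - p2) / 2
  -- The coefficients $g_{02}$ and $g_{03}$ cannot both vanish, so one of the two identities can be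
  -- cancelled.
  have hne := h.branch_ne_zero (Equiv.swap 1 3)
  have hne' : b 4 0 3 * g 4 0 2 - b 4 0 2 * g 4 0 3 ≠ 0 := hne
  by_contra hcon
  have hcon' := sub_ne_zero.2 hcon
  rw [(mul_eq_zero.1 e1).resolve_left hcon', (mul_eq_zero.1 e2).resolve_left hcon'] at hne'
  simp at hne'

theorem IsEdgePair.exists_ne_zero (h : IsEdgePair w k ε b g) :
    (∃ i j, b 4 i j ≠ 0) ∧ ∃ i j, g 4 i j ≠ 0 := by
  have hne := h.branch_ne_zero 1
  constructor
  · by_contra! h0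
    simp [h0] at hne
  · by_contra! h0
    simp [h0] at hne

/-- Of the vectors `x` in `det_edgeMatrix_mul`, the unit vector of the tetrahedron $4$ and the
fourth column of $F$ put $b_{4,23}$ and $g_{4,23}$ on the right-hand side. If the determinant
vanished, both would be zero, against `branch_ne_zero`. -/
theorem IsEdgePair.det_ne_zero (h : IsEdgePair w k ε b g) {F : Fin 5 → Fin 5 → ℂ}
    (hF : ∀ a' i j, g a' i j = ∑ a, b a i j * F a a') : (edgeMatrix b).det ≠ 0 := by
  intro h0
  have h1 := det_edgeMatrix_mul h.left h.right hF (fun a => if a = 4 then 1 else 0)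
  have h2 := det_edgeMatrix_mul h.left h.right hF (fun a => F a 4)
  rw [h0, zero_mul, zero_eq_neg] at h1 h2
  have c1 : b 2 3 0 * g 2 3 1 - b 2 3 1 * g 2 3 0 ≠ 0 :=
    h.branch_ne_zero (Equiv.swap 0 1 * Equiv.swap 0 2 * Equiv.swap 0 3 * Equiv.swap 3 4)
  have c2 : b 3 2 0 * g 3 2 1 - b 3 2 1 * g 3 2 0 ≠ 0 :=
    h.branch_ne_zero (Equiv.swap 0 2 * Equiv.swap 1 2 * Equiv.swap 3 4)
  have h3 := (mul_eq_zero.1 h1).resolve_left (mul_ne_zero c1 c2)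
  have h4 := (mul_eq_zero.1 h2).resolve_left (mul_ne_zero c1 c2)
  rw [← hF] at h4
  simp only [mul_ite, mul_one, mul_zero, sum_ite_eq', mem_univ, if_true] at h3
  have h5 : b 4 2 3 * g 4 2 0 - b 4 2 0 * g 4 2 3 ≠ 0 :=
    h.branch_ne_zero (Equiv.swap 0 2 * Equiv.swap 1 3)
  rw [h3, h4] at h5
  simp at h5

/-- The matrix `F` is determined by the edge operators. -/
theorem IsEdgePair.eq_zero_of_sum_eq_zero (h : IsEdgePair w k ε b g) {F : Fin 5 → Fin 5 → ℂ}
    (hF : ∀ a' i j, g a' i j = ∑ a, b a i j * F a a') {x : Fin 5 → ℂ}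
    (hx : ∀ i j, ∑ a, b a i j * x a = 0) : x = 0 := by
  refine Matrix.eq_zero_of_mulVec_eq_zero (h.det_ne_zero hF) ?_
  ext y
  fin_cases y <;> exact hx _ _

/-- The expression of the 2×2 minors of `F`. -/
theorem IsEdgePair.mul_minor (h : IsEdgePair w k ε b g) {F : Fin 5 → Fin 5 → ℂ}
    (hF : ∀ a' i j, g a' i j = ∑ a, b a i j * F a a') :
    b 4 0 1 * (k 2 * k 3) = -(edgeMinor w b * (F 1 3 * F 0 2 - F 1 2 * F 0 3) * k 4 *
      (w 0 1 4 * w 0 3 4 * w 1 3 4 * w 0 2 4 * w 1 2 4)) := by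
  have hw := h.cocycle
  have h012 : w 0 1 2 ≠ 0 := hw.ne_zero _ _ _ (by decide) (by decide) (by decide)
  have h013 : w 0 1 3 ≠ 0 := hw.ne_zero _ _ _ (by decide) (by decide) (by decide)
  have h014 : w 0 1 4 ≠ 0 := hw.ne_zero _ _ _ (by decide) (by decide) (by decide)
  have h034 : w 0 3 4 ≠ 0 := hw.ne_zero _ _ _ (by decide) (by decide) (by decide)
  have h134 : w 1 3 4 ≠ 0 := hw.ne_zero _ _ _ (by decide) (by decide) (by decide)
  have h024 : w 0 2 4 ≠ 0 := hw.ne_zero _ _ _ (by decide) (by decide) (by decide)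
  have h124 : w 1 2 4 ≠ 0 := hw.ne_zero _ _ _ (by decide) (by decide) (by decide)
  -- For this `x` the left-hand side reduces to the determinant of the edge matrix times the
  -- $2\times2$ minor of `F`, and the last sum to $b_{4,23}$.
  have h1 := det_edgeMatrix_mul h.left h.right hF (fun a => if a = 4 then 1 else 0)
  have c1 : b 2 3 0 * g 2 3 1 - b 2 3 1 * g 2 3 0 =
      -ε * k 2 / (w 3 0 1 * w 3 0 4 * w 3 1 4) :=
    h.branch (Equiv.swap 0 1 * Equiv.swap 0 2 * Equiv.swap 0 3 * Equiv.swap 3 4)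
  have c2 : b 3 2 0 * g 3 2 1 - b 3 2 1 * g 3 2 0 =
      -ε * k 3 / (w 2 0 1 * w 2 0 4 * w 2 1 4) :=
    h.branch (Equiv.swap 0 2 * Equiv.swap 1 2 * Equiv.swap 3 4)
  rw [hw.cyclic 0 1 3, hw.swap₁₂ 0 3 4, hw.swap₁₂ 1 3 4] at c1
  rw [hw.cyclic 0 1 2, hw.swap₁₂ 0 2 4, hw.swap₁₂ 1 2 4] at c2
  simp only [mul_ite, mul_one, mul_zero, sum_ite_eq', mem_univ, if_true] at h1
  rw [if_neg (by decide : (1 : Fin 5) ≠ 4), if_neg (by decide : (0 : Fin 5) ≠ 4), c1, c2] at h1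
  have h2 : (edgeMatrix b).det = edgeMinor w b * w 0 1 4 := by
    rw [edgeMinor, div_mul_cancel₀ _ h014]
  rw [h2] at h1
  have hs := h.sign
  have h3 : edgeMinor w b * w 0 1 4 * (F 0 2 * F 1 3 - F 0 3 * F 1 2) *
      (w 0 1 3 * w 0 3 4 * w 1 3 4 * w 0 1 2 * w 0 2 4 * w 1 2 4) = -(k 2 * k 3 * b 4 2 3) := by
    have h5 : -ε * k 2 / (w 0 1 3 * -w 0 3 4 * -w 1 3 4) *
        (-ε * k 3 / (w 0 1 2 * -w 0 2 4 * -w 1 2 4)) *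
        (w 0 1 3 * w 0 3 4 * w 1 3 4 * w 0 1 2 * w 0 2 4 * w 1 2 4) = k 2 * k 3 := by
      field_simp
      linear_combination k 2 * k 3 * hs
    linear_combination (w 0 1 3 * w 0 3 4 * w 1 3 4 * w 0 1 2 * w 0 2 4 * w 1 2 4) * h1 -
      b 4 2 3 * h5
  -- This trades the edge $23$ for the edge $01$, which occurs in $H_u$.
  have h4 := h.opposite
  refine mul_right_cancel₀ (mul_ne_zero h012 h013) ?_
  linear_combination k 2 * k 3 * h4 + k 4 * h3

/-- The conditions fix the products for two different edges with a common vertex. The products of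
the edge $01$ with itself and with the opposite edge then follow from the cycle condition: the
differences form a skew matrix with zero row sums whose other entries vanish. -/
theorem IsEdgePair.product_eq_of_first (h : IsEdgePair w k ε b g) (h' : IsEdgePair w k ε b' g')
    (x y : Fin 5) : b 4 0 1 * g 4 x y = b' 4 0 1 * g' 4 x y := by
  have key : ∀ π : Equiv.Perm (Fin 5), b (π 4) (π 0) (π 1) * g (π 4) (π 0) (π 2) =
      b' (π 4) (π 0) (π 1) * g' (π 4) (π 0) (π 2) := by
    intro π
    linear_combination (h.normalization π + h.branch π - h'.normalization π - h'.branch π) / 2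
  set P : Fin 5 → Fin 5 → ℂ := fun x y => b 4 0 1 * g 4 x y - b' 4 0 1 * g' 4 x y with hP
  have hanti : ∀ x y, P y x = -P x y := fun x y => by
    simp only [hP]
    rw [h.right.antisymm 4 x y, h'.right.antisymm 4 x y]
    ring
  have hcyc : ∀ x, P x 0 + P x 1 + P x 2 + P x 3 + P x 4 = 0 := fun x => by
    have h1 := h.right.cycle 4 x
    have h2 := h'.right.cycle 4 x
    rw [Fin.sum_univ_five] at h1 h2
    simp only [hP]
    linear_combination b 4 0 1 * h1 - b' 4 0 1 * h2
  have hdiag : ∀ x, P x x = 0 := fun x => by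
    have := hanti x x
    linear_combination (1 / 2 : ℂ) * this
  have h4 : ∀ x, P 4 x = 0 := fun x => by
    simp only [hP]
    rw [h.right.support, h'.right.support, mul_zero, mul_zero, sub_zero]
  have h4' : ∀ x, P x 4 = 0 := fun x => by rw [hanti, h4, neg_zero]
  have h02 : P 0 2 = 0 := sub_eq_zero.2 (key 1)
  have h03 : P 0 3 = 0 := sub_eq_zero.2 (key (Equiv.swap 2 3))
  have h12 : P 1 2 = 0 := by
    have : b 4 1 0 * g 4 1 2 = b' 4 1 0 * g' 4 1 2 := key (Equiv.swap 0 1)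
    rw [h.left.antisymm, h'.left.antisymm] at this
    simp only [hP]
    linear_combination -this
  have h13 : P 1 3 = 0 := by
    have : b 4 1 0 * g 4 1 3 = b' 4 1 0 * g' 4 1 3 := key (Equiv.swap 2 3 * Equiv.swap 0 1)
    rw [h.left.antisymm, h'.left.antisymm] at this
    simp only [hP]
    linear_combination -this
  have h01 : P 0 1 = 0 := by
    have := hcyc 0
    rw [hdiag, h02, h03, h4'] at this
    linear_combination this
  have h23 : P 2 3 = 0 := by
    have := hcyc 2
    rw [hdiag, hanti 0 2, hanti 1 2, h02, h12, h4'] at this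
    linear_combination this
  have : P x y = 0 := by
    fin_cases x <;> fin_cases y <;>
      simp [h4, h4', hdiag, h01, h02, h03, h12, h13, h23, hanti 0 1, hanti 0 2, hanti 0 3,
        hanti 1 2, hanti 1 3, hanti 2 3]
  exact sub_eq_zero.1 this

/-- The products of the coefficients for one tetrahedron are determined by the conditions. -/
theorem IsEdgePair.product_eq (h : IsEdgePair w k ε b g) (h' : IsEdgePair w k ε b' g')
    (i j x y : Fin 5) : b 4 i j * g 4 x y = b' 4 i j * g' 4 x y := by
  by_cases hi : i = 4
  · rw [hi, h.left.support, h'.left.support, zero_mul, zero_mul]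
  by_cases hj : j = 4
  · rw [hj, h.left.antisymm, h'.left.antisymm, h.left.support, h'.left.support]
    simp
  by_cases hij : i = j
  · have h0 : ∀ {b : Fin 5 → Fin 5 → Fin 5 → ℂ}, IsEdgeFamily w b → b 4 j j = 0 := fun hb => by
      have := hb.antisymm 4 j j
      linear_combination (1 / 2 : ℂ) * this
    rw [hij, h0 h.left, h0 h'.left, zero_mul, zero_mul]
  -- An explicit permutation that takes $0,1$ to $i,j$ and fixes the tetrahedron $4$, so that the
  -- case of the edge $01$ suffices.
  have hex : ∀ i j : Fin 5, i ≠ 4 → j ≠ 4 → i ≠ j →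
      (Equiv.swap (Equiv.swap 0 i 1) j * Equiv.swap 0 i) 0 = i ∧
      (Equiv.swap (Equiv.swap 0 i 1) j * Equiv.swap 0 i) 1 = j ∧
      (Equiv.swap (Equiv.swap 0 i 1) j * Equiv.swap 0 i) 4 = 4 := by decide
  obtain ⟨h0, h1, h4⟩ := hex i j hi hj hij
  set π := Equiv.swap (Equiv.swap 0 i 1) j * Equiv.swap 0 i
  have h5 := (h.relabel π).product_eq_of_first (h'.relabel π) (π.symm x) (π.symm y)
  simpa [ExoticTorsion.relabel, h0, h1, h4] using h5

/-- Edge operators are unique up to a scaling of the Grassmann variables. -/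
theorem IsEdgePair.exists_scale (h : IsEdgePair w k ε b g) (h' : IsEdgePair w k ε b' g') :
    ∃ c : ℂ, c ≠ 0 ∧ ∀ i j, b' 4 i j = c * b 4 i j := by
  obtain ⟨⟨i₀, j₀, hb⟩, ⟨x, y, hg⟩⟩ := h.exists_ne_zero
  have h1 := fun i j => h.product_eq h' i j x y
  have hg' : g' 4 x y ≠ 0 := by
    intro h0
    have h2 := h1 i₀ j₀
    rw [h0, mul_zero] at h2
    exact mul_ne_zero hb hg h2
  refine ⟨g 4 x y / g' 4 x y, div_ne_zero hg hg', fun i j => ?_⟩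
  field_simp
  linear_combination -h1 i j

/-- The factor `c` is given in advance here because $\beta_t$ is common to both 4-simplices at a
tetrahedron: the factor found in one of them is used in the other. -/
theorem IsEdgePair.scale_right (h : IsEdgePair w k ε b g) (h' : IsEdgePair w k ε b' g') {c : ℂ}
    (hc : c ≠ 0) (hb : ∀ i j, b' 4 i j = c * b 4 i j) (x y : Fin 5) :
    g' 4 x y = c⁻¹ * g 4 x y := by
  obtain ⟨⟨i₀, j₀, hb₀⟩, -⟩ := h.exists_ne_zero
  have h1 := h.product_eq h' i₀ j₀ x y
  rw [hb] at h1
  refine mul_left_cancel₀ (mul_ne_zero hc hb₀) ?_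
  rw [← h1]
  field_simp

/-! ### Signs of orders of the vertices. -/

theorem exists_perm_castSucc {n : ℕ} (σ : Equiv.Perm (Fin (n + 1))) (h : σ (Fin.last n) = Fin.last n) :
    ∃ ρ : Equiv.Perm (Fin n), Equiv.Perm.sign ρ = Equiv.Perm.sign σ ∧
      ∀ i : Fin n, σ i.castSucc = (ρ i).castSucc := by
  have h1 : ∀ x, σ x ≠ Fin.last n ↔ x ≠ Fin.last n := fun x => by
    rw [not_iff_not]
    exact ⟨fun h2 => σ.injective (h2.trans h.symm), fun h2 => h2 ▸ h⟩
  let e : Fin n ≃ {x : Fin (n + 1) // x ≠ Fin.last n} := finSuccAboveEquiv (Fin.last n)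
  refine ⟨e.symm.permCongr (σ.subtypePerm h1), ?_, fun i => ?_⟩
  · rw [Equiv.Perm.sign_permCongr, Equiv.Perm.sign_subtypePerm]
    exact fun x hx h2 => hx (by rw [h2, h])
  · have h2 : ∀ y, ((e y : {x : Fin (n + 1) // x ≠ Fin.last n}) : Fin (n + 1)) = y.castSucc :=
      fun y => by simp [e, finSuccAboveEquiv]
    rw [← h2 (e.symm.permCongr (σ.subtypePerm h1) i)]
    simp [Equiv.permCongr_apply, h2]

/-- The sign of the order of two elements with the numbers `num`. -/
noncomputable def pairSign {V : Type*} (num : V → ℕ) (x y : V) : ℂ :=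
  if num x < num y then 1 else if num y < num x then -1 else 0

theorem pairSign_of_lt {V : Type*} {num : V → ℕ} {x y : V} (h : num x < num y) :
    pairSign num x y = 1 := if_pos h

theorem pairSign_of_gt {V : Type*} {num : V → ℕ} {x y : V} (h : num y < num x) :
    pairSign num x y = -1 := by
  rw [pairSign, if_neg h.not_gt, if_pos h]

theorem pairSign_sq {V : Type*} {num : V → ℕ} (hnum : Function.Injective num) {x y : V}
    (h : x ≠ y) : pairSign num x y ^ 2 = 1 := by
  rcases lt_or_gt_of_ne (hnum.ne h) with h | h
  · rw [pairSign_of_lt h, one_pow]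
  · rw [pairSign_of_gt h, neg_one_sq]

theorem pairSign_swap {V : Type*} (num : V → ℕ) (x y : V) :
    pairSign num x y = -pairSign num y x := by
  rcases lt_trichotomy (num x) (num y) with h | h | h
  · rw [pairSign_of_lt h, pairSign_of_gt h, neg_neg]
  · simp [pairSign, h]
  · rw [pairSign_of_lt h, pairSign_of_gt h]

/-- The sign of the permutation that sorts a list according to the numbers `num`. -/
noncomputable def orderSign {V : Type*} (num : V → ℕ) {n : ℕ} (p : Fin n → V) : ℂ :=
  ∏ j, ∏ i ∈ Iio j, pairSign num (p i) (p j)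

theorem orderSign_comp {V : Type*} (num : V → ℕ) {n : ℕ} (p : Fin n → V) (π : Equiv.Perm (Fin n)) :
    orderSign num (p ∘ π) = (Equiv.Perm.sign π : ℤ) * orderSign num p :=
  π.prod_Iio_comp_eq_sign_mul_prod (f := fun i j => pairSign num (p i) (p j))
    fun _ _ => pairSign_swap _ _ _

theorem orderSign_of_strictMono {V : Type*} {num : V → ℕ} {n : ℕ} {p : Fin n → V}
    (h : StrictMono (num ∘ p)) : orderSign num p = 1 :=
  prod_eq_one fun _ _ => prod_eq_one fun _ hi => pairSign_of_lt (h (mem_Iio.1 hi))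

theorem exists_sort {V : Type*} {num : V → ℕ} (hnum : Function.Injective num) {n : ℕ} {p : Fin n → V}
    (hp : Function.Injective p) : ∃ π : Equiv.Perm (Fin n), StrictMono (num ∘ p ∘ π) ∧
      orderSign num p = (Equiv.Perm.sign π : ℤ) := by
  have h1 : StrictMono (num ∘ p ∘ Tuple.sort (num ∘ p)) :=
    (Tuple.monotone_sort (num ∘ p)).strictMono_of_injective
      ((hnum.comp hp).comp (Equiv.injective _))
  refine ⟨_, h1, ?_⟩
  have h2 := orderSign_comp num p (Tuple.sort (num ∘ p))
  rw [orderSign_of_strictMono h1] at h2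
  rcases Int.units_eq_one_or (Equiv.Perm.sign (Tuple.sort (num ∘ p))) with h | h <;>
    rw [h] at h2 ⊢ <;> push_cast at h2 ⊢
  · linear_combination -h2
  · linear_combination h2

/-! ### From a 4-simplex of the triangulation to the model with the vertices $0,\dots,4$. -/

namespace Triangulation

variable {V C : Type*} [DecidableEq V] [PartialOrder C] {T : Triangulation V C}

theorem Spells.comp_perm {n : ℕ} {σ : C} {p : Fin n → V} (h : T.Spells σ p)
    (π : Equiv.Perm (Fin n)) : T.Spells σ (p ∘ π) := by
  refine ⟨h.1.comp π.injective, ?_⟩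
  rw [← h.2, ← image_image, image_univ_of_surjective π.surjective]

theorem Spells.exists_perm {n : ℕ} {σ : C} {p p' : Fin n → V} (h : T.Spells σ p)
    (h' : T.Spells σ p') : ∃ π : Equiv.Perm (Fin n), p' = p ∘ π := by
  have h1 : ∀ i, ∃ j, p j = p' i := fun i => by
    have : p' i ∈ univ.image p := by rw [h.2, ← h'.2]; exact mem_image_of_mem _ (mem_univ i)
    simpa using this
  choose f hf using h1
  have hinj : Function.Injective f := fun i j hij => h'.1 (by rw [← hf, ← hf, hij])
  exact ⟨Equiv.ofBijective f (Finite.injective_iff_bijective.1 hinj), funext fun i => (hf i).symm⟩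

theorem face_comp_perm (τ : C) {n : ℕ} (p : Fin n → V) (π : Equiv.Perm (Fin n)) :
    T.face τ (p ∘ π) = T.face τ p := by
  rw [face_eq_faceOn, face_eq_faceOn, ← image_image, image_univ_of_surjective π.surjective]

theorem spells_face {τ : C} {n : ℕ} [NeZero n] {p : Fin n → V} (hp : Function.Injective p)
    (h : ∀ i, p i ∈ T.vert τ) : T.face τ p ≤ τ ∧ T.Spells (T.face τ p) p := by
  obtain ⟨h1, h2⟩ := faceOn_spec (T := T) (τ := τ) (A := univ.image p)
    (image_subset_iff.2 fun i _ => h i) ⟨p 0, mem_image_of_mem _ (mem_univ _)⟩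
  exact ⟨h1, hp, h2.symm⟩

theorem face_face {τ : C} {n m : ℕ} [NeZero n] {p : Fin m → V} (h : ∀ i, p i ∈ T.vert τ)
    (f : Fin n → Fin m) : T.face (T.face τ p) (p ∘ f) = T.face τ (p ∘ f) := by
  refine faceOn_faceOn (image_subset_iff.2 fun i _ => h i) ?_ ⟨p (f 0), ?_⟩
  · rw [← image_image]
    exact image_subset_image (subset_univ _)
  · exact mem_image_of_mem _ (mem_univ _)

theorem Spells.mem {n : ℕ} {σ : C} {p : Fin n → V} (h : T.Spells σ p) (i : Fin n) :
    p i ∈ T.vert σ := by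
  rw [← h.2]
  exact mem_image_of_mem _ (mem_univ i)

theorem Spells.sum_vert {n : ℕ} {σ : C} {p : Fin n → V} (h : T.Spells σ p) (f : V → ℂ) :
    ∑ v ∈ T.vert σ, f v = ∑ i, f (p i) := by
  rw [← h.2, sum_image fun i _ j _ hij => h.1 hij]

variable (T) in
/-- The tetrahedron of a 4-simplex with the vertices `p 0, …, p 4` that does not contain `p a`. -/
noncomputable def oppositeTet (u : C) (p : Fin 5 → V) (a : Fin 5) : C :=
  T.faceOn u ((univ.erase a).image p)

theorem face_eq_oppositeTet (u : C) (p : Fin 5 → V) {a : Fin 5} {f : Fin 4 → Fin 5}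
    (hf : univ.image f = univ.erase a) : T.face u (p ∘ f) = T.oppositeTet u p a := by
  rw [oppositeTet, ← hf, image_image]
  rfl

theorem oppositeTet_comp (u : C) (p : Fin 5 → V) (π : Equiv.Perm (Fin 5)) (a : Fin 5) :
    T.oppositeTet u (p ∘ π) a = T.oppositeTet u p (π a) := by
  rw [oppositeTet, oppositeTet, ← image_image]
  congr 2
  ext x
  simp only [mem_image, mem_erase, mem_univ, and_true]
  constructor
  · rintro ⟨y, hy, rfl⟩
    exact π.injective.ne hy
  · intro hx
    exact ⟨π.symm x, fun h => hx (by rw [← h, π.apply_symm_apply]), π.apply_symm_apply x⟩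

theorem Spells.oppositeTet_spec {u : C} {p : Fin 5 → V} (h : T.Spells u p) (a : Fin 5) :
    T.oppositeTet u p a ≤ u ∧ T.vert (T.oppositeTet u p a) = (univ.erase a).image p := by
  refine faceOn_spec ?_ (image_nonempty.2 ⟨a + 1, ?_⟩)
  · rw [← h.2]
    exact image_subset_image (subset_univ _)
  · revert a; decide

theorem Spells.mem_oppositeTet {u : C} {p : Fin 5 → V} (h : T.Spells u p) (a i : Fin 5) :
    p i ∈ T.vert (T.oppositeTet u p a) ↔ i ≠ a := by
  rw [(h.oppositeTet_spec a).2, mem_image]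
  constructor
  · rintro ⟨j, hj, hij⟩
    rw [← h.1 hij]
    exact (mem_erase.1 hj).1
  · intro hi
    exact ⟨i, mem_erase.2 ⟨hi, mem_univ _⟩, rfl⟩

theorem Spells.card_oppositeTet {u : C} {p : Fin 5 → V} (h : T.Spells u p) (a : Fin 5) :
    (T.vert (T.oppositeTet u p a)).card = 4 := by
  rw [(h.oppositeTet_spec a).2, card_image_of_injective _ h.1, card_erase_of_mem (mem_univ _)]
  rfl

variable (T) in
/-- The values of a cochain on the triangles of a 4-simplex. -/
noncomputable def localCocycle (ω : C → (Fin 3 → V) → ℂ) (u : C) (p : Fin 5 → V) :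
    Fin 5 → Fin 5 → Fin 5 → ℂ :=
  fun i j k => ω (T.face u ![p i, p j, p k]) ![p i, p j, p k]

variable (T) in
/-- The coefficients of edge operators in a 4-simplex. -/
noncomputable def localFamily (β : C → V → V → ℂ) (u : C) (p : Fin 5 → V) :
    Fin 5 → Fin 5 → Fin 5 → ℂ :=
  fun a i j => β (T.oppositeTet u p a) (p i) (p j)

theorem localCocycle_comp (ω : C → (Fin 3 → V) → ℂ) (u : C) (p : Fin 5 → V)
    (π : Equiv.Perm (Fin 5)) :
    T.localCocycle ω u (p ∘ π) = relabel π (T.localCocycle ω u p) := rfl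

theorem localFamily_comp (β : C → V → V → ℂ) (u : C) (p : Fin 5 → V) (π : Equiv.Perm (Fin 5)) :
    T.localFamily β u (p ∘ π) = relabel π (T.localFamily β u p) := by
  funext a i j
  simp [localFamily, relabel, oppositeTet_comp]

theorem vec3_comp_swap₁₂ (x y z : V) : ![y, x, z] = ![x, y, z] ∘ Equiv.swap (0 : Fin 3) 1 := by
  funext i
  fin_cases i <;> rfl

theorem vec3_comp_swap₂₃ (x y z : V) : ![x, z, y] = ![x, y, z] ∘ Equiv.swap (1 : Fin 3) 2 := by
  funext i
  fin_cases i <;> rfl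

theorem comp_vec3 {α β : Type*} (f : α → β) (x y z : α) : ![f x, f y, f z] = f ∘ ![x, y, z] := by
  funext i
  fin_cases i <;> rfl

theorem isLocalCocycle_localCocycle (ω : T.cocycles)
    (hω : ∀ s (p : Fin 3 → V), T.Spells s p → (ω : C → (Fin 3 → V) → ℂ) s p ≠ 0)
    {u : C} {p : Fin 5 → V} (hp : T.Spells u p) : IsLocalCocycle (T.localCocycle ω u p) := by
  obtain ⟨h1, h2, h3⟩ := ω.2
  have hsp : ∀ i j k : Fin 5, Function.Injective ![p i, p j, p k] →
      T.Spells (T.face u ![p i, p j, p k]) ![p i, p j, p k] := fun i j k h =>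
    (spells_face h fun x => by fin_cases x <;> exact hp.mem _).2
  have hz : ∀ i j k, ¬ Function.Injective ![p i, p j, p k] → T.localCocycle ω u p i j k = 0 :=
    fun i j k h => h1 _ _ fun h' => h h'.1
  have hperm : ∀ i j k i' j' k', ∀ π : Equiv.Perm (Fin 3), Equiv.Perm.sign π = -1 →
      ![p i', p j', p k'] = ![p i, p j, p k] ∘ π →
      T.localCocycle ω u p i' j' k' = -T.localCocycle ω u p i j k := by
    intro i j k i' j' k' π hπ he
    by_cases hinj : Function.Injective ![p i, p j, p k]
    · simp only [localCocycle]
      rw [he, face_comp_perm, h2 _ _ (hsp i j k hinj), hπ]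
      simp
    · rw [hz i j k hinj, hz i' j' k', neg_zero]
      rw [he]
      exact fun h => hinj ((Function.Injective.of_comp_iff' _ π.bijective).1 h)
  have hs12 : ∀ i j k, T.localCocycle ω u p j i k = -T.localCocycle ω u p i j k := fun i j k =>
    hperm _ _ _ _ _ _ _ (Equiv.Perm.sign_swap (by decide)) (vec3_comp_swap₁₂ _ _ _)
  have hs23 : ∀ i j k, T.localCocycle ω u p i k j = -T.localCocycle ω u p i j k := fun i j k =>
    hperm _ _ _ _ _ _ _ (Equiv.Perm.sign_swap (by decide)) (vec3_comp_swap₂₃ _ _ _)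
  have hz12 : ∀ i k, T.localCocycle ω u p i i k = 0 := fun i k => by
    have := hs12 i i k
    linear_combination (1 / 2 : ℂ) * this
  have hz23 : ∀ i k, T.localCocycle ω u p i k k = 0 := fun i k => by
    have := hs23 i k k
    linear_combination (1 / 2 : ℂ) * this
  have hz13 : ∀ i k, T.localCocycle ω u p i k i = 0 := fun i k => by
    rw [hs23, hz12, neg_zero]
  refine ⟨hs12, hs23, fun i j k l => ?_, fun i j k h h' h'' => ?_⟩
  -- If two vertices coincide, the equation follows from skew symmetry alone; otherwise it is the
  -- cocycle condition on a tetrahedron.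
  · by_cases hij : i = j
    · subst hij; rw [hz12, hz12]; ring
    by_cases hik : i = k
    · subst hik; rw [hz12, hz13, hs12]; ring
    by_cases hil : i = l
    · subst hil; rw [hz13, hz13, hs23, hs12]; ring
    by_cases hjk : j = k
    · subst hjk; rw [hz12, hz23]; ring
    by_cases hjl : j = l
    · subst hjl; rw [hz13, hz23, hs23]; ring
    by_cases hkl : k = l
    · subst hkl; rw [hz23, hz23]; ring
    have hinj : Function.Injective ![i, j, k, l] := by
      intro x y hxy
      fin_cases x <;> fin_cases y <;>
        first
        | rfl
        | exact absurd hxy hij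
        | exact absurd hxy.symm hij
        | exact absurd hxy hik
        | exact absurd hxy.symm hik
        | exact absurd hxy hil
        | exact absurd hxy.symm hil
        | exact absurd hxy hjk
        | exact absurd hxy.symm hjk
        | exact absurd hxy hjl
        | exact absurd hxy.symm hjl
        | exact absurd hxy hkl
        | exact absurd hxy.symm hkl
    have hmem : ∀ x, (p ∘ ![i, j, k, l]) x ∈ T.vert u := fun x => hp.mem _
    have h4 := h3 _ _ (spells_face (hp.1.comp hinj) hmem).2
    rw [Fin.sum_univ_four] at h4
    simp only [face_face hmem] at h4
    have e0 : (p ∘ ![i, j, k, l]) ∘ Fin.succAbove 0 = ![p j, p k, p l] := by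
      funext x; fin_cases x <;> rfl
    have e1 : (p ∘ ![i, j, k, l]) ∘ Fin.succAbove 1 = ![p i, p k, p l] := by
      funext x; fin_cases x <;> rfl
    have e2 : (p ∘ ![i, j, k, l]) ∘ Fin.succAbove 2 = ![p i, p j, p l] := by
      funext x; fin_cases x <;> rfl
    have e3 : (p ∘ ![i, j, k, l]) ∘ Fin.succAbove 3 = ![p i, p j, p k] := by
      funext x; fin_cases x <;> rfl
    rw [e0, e1, e2, e3] at h4
    simp only [Fin.val_zero, Fin.val_one, Fin.val_two, pow_zero, pow_one, one_mul, neg_mul] at h4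
    norm_num at h4
    simp only [localCocycle]
    linear_combination h4
  · refine hω _ _ (hsp i j k ?_)
    rw [comp_vec3]
    refine hp.1.comp ?_
    intro x y hxy
    fin_cases x <;> fin_cases y <;>
      first
      | rfl
      | exact absurd hxy h
      | exact absurd hxy.symm h
      | exact absurd hxy h'
      | exact absurd hxy.symm h'
      | exact absurd hxy h''
      | exact absurd hxy.symm h''

theorem isEdgeFamily_localFamily [Fintype C] (ω : T.cocycles)
    (hω : ∀ s (p : Fin 3 → V), T.Spells s p → (ω : C → (Fin 3 → V) → ℂ) s p ≠ 0)
    {u : C} {p : Fin 5 → V} (hp : T.Spells u p) (B : C → V → V → ℂ)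
    (hsupp : ∀ t ∈ T.cells 4, t ≤ u → ∀ i j, ¬ (i ∈ T.vert t ∧ j ∈ T.vert t) → B t i j = 0)
    (hanti : ∀ t ∈ T.cells 4, t ≤ u → ∀ i j, B t j i = -B t i j)
    (hcyc : ∀ t ∈ T.cells 4, t ≤ u → ∀ i ∈ T.vert u, ∑ j ∈ T.vert u, B t i j = 0)
    (hrel : ∀ t ∈ T.cells 4, t ≤ u → T.cochainPairing (B t) ω t = 0) :
    IsEdgeFamily (T.localCocycle ω u p) (T.localFamily B u p) := by
  have hw := isLocalCocycle_localCocycle ω hω hp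
  have ht : ∀ a, T.oppositeTet u p a ∈ T.cells 4 := fun a =>
    mem_filter.2 ⟨mem_univ _, hp.card_oppositeTet a⟩
  have hle : ∀ a, T.oppositeTet u p a ≤ u := fun a => (hp.oppositeTet_spec a).1
  refine ⟨fun a i => ?_, fun a i j => hanti _ (ht a) (hle a) _ _, fun a i => ?_, fun a m => ?_⟩
  · exact hsupp _ (ht a) (hle a) _ _ fun h => (hp.mem_oppositeTet a a).1 h.1 rfl
  · rw [← hcyc _ (ht a) (hle a) (p i) (hp.mem i), hp.sum_vert]
    rfl
  · set t := T.oppositeTet u p a with htdef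
    have hsub : T.vert t ⊆ T.vert u := T.vert_mono _ _ (hle a)
    -- The pairing is evaluated with the cone cochain $\nu_{xy}=\omega_{p_m xy}$, which has the
    -- coboundary $\omega$ in all of $u$, whether or not $p_m$ belongs to $t$.
    have h1 := T.cochainPairing_eq (B t) ω t
      (fun x y => (ω : C → (Fin 3 → V) → ℂ) (T.face u ![p m, x, y]) ![p m, x, y])
      (hp.card_oppositeTet a) (hanti t (ht a) (hle a)) ?_ ?_
    · rw [hrel t (ht a) (hle a)] at h1
      have h2 : ∑ i ∈ T.vert t, ∑ j ∈ T.vert t,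
          (ω : C → (Fin 3 → V) → ℂ) (T.face u ![p m, i, j]) ![p m, i, j] * B t i j =
          ∑ i ∈ T.vert u, ∑ j ∈ T.vert u,
          (ω : C → (Fin 3 → V) → ℂ) (T.face u ![p m, i, j]) ![p m, i, j] * B t i j := by
        have h3 : ∀ i, ∑ j ∈ T.vert t,
            (ω : C → (Fin 3 → V) → ℂ) (T.face u ![p m, i, j]) ![p m, i, j] * B t i j =
            ∑ j ∈ T.vert u,
            (ω : C → (Fin 3 → V) → ℂ) (T.face u ![p m, i, j]) ![p m, i, j] * B t i j := fun i =>
          sum_subset hsub fun j _ hj => by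
            rw [hsupp t (ht a) (hle a) i j fun h => hj h.2, mul_zero]
        simp only [h3]
        refine sum_subset hsub fun i _ hi => sum_eq_zero fun j _ => ?_
        rw [hsupp t (ht a) (hle a) i j fun h => hi h.1, mul_zero]
      rw [h2, hp.sum_vert] at h1
      simp only [hp.sum_vert] at h1
      have h4 : (2 : ℂ) * 0 = _ := congrArg (2 * ·) h1
      rw [mul_zero, ← mul_assoc, mul_one_div_cancel two_ne_zero, one_mul] at h4
      exact h4.symm
    · intro i hi
      rw [← hcyc t (ht a) (hle a) i (hsub hi)]
      exact sum_subset hsub fun j _ hj => hsupp t (ht a) (hle a) i j fun h => hj h.2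
    · intro x hx y hy z hz
      have hex : ∀ v ∈ T.vert t, ∃ i, i ≠ a ∧ p i = v := by
        intro v hv
        rw [(hp.oppositeTet_spec a).2] at hv
        obtain ⟨i, hi, rfl⟩ := mem_image.1 hv
        exact ⟨i, (mem_erase.1 hi).1, rfl⟩
      have hfc : T.face t ![x, y, z] = T.face u ![x, y, z] := by
        refine faceOn_faceOn ?_ ?_ ?_
        · rw [← hp.2]
          exact image_subset_image (subset_univ _)
        · rw [← (hp.oppositeTet_spec a).2]
          refine image_subset_iff.2 fun i _ => ?_
          fin_cases i
          · exact hx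
          · exact hy
          · exact hz
        · exact ⟨x, mem_image.2 ⟨0, mem_univ _, rfl⟩⟩
      rw [hfc]
      obtain ⟨i, -, rfl⟩ := hex x hx
      obtain ⟨j, -, rfl⟩ := hex y hy
      obtain ⟨k, -, rfl⟩ := hex z hz
      have h5 := hw.closed m i j k
      have h6 := hw.swap₂₃ m i k
      simp only [localCocycle] at h5 h6
      linear_combination h5 - h6

end Triangulation

theorem orderSign_three {V : Type*} (num : V → ℕ) (p : Fin 3 → V) :
    orderSign num p =
      pairSign num (p 0) (p 1) * pairSign num (p 0) (p 2) *
      pairSign num (p 1) (p 2) := by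
  simp only [orderSign, Fin.prod_univ_three,
    show Iio (0 : Fin 3) = ∅ by decide,
    show Iio (1 : Fin 3) = {0} by decide,
    show Iio (2 : Fin 3) = {0, 1} by decide,
    prod_insert (show (0 : Fin 3) ∉ ({1} : Finset (Fin 3)) by decide),
    prod_empty, prod_singleton, one_mul, mul_assoc]

theorem orderSign_four {V : Type*} (num : V → ℕ) (p : Fin 4 → V) :
    orderSign num p =
      pairSign num (p 0) (p 1) * pairSign num (p 0) (p 2) *
      pairSign num (p 1) (p 2) * pairSign num (p 0) (p 3) *
      pairSign num (p 1) (p 3) * pairSign num (p 2) (p 3) := by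
  simp only [orderSign, Fin.prod_univ_four,
    show Iio (0 : Fin 4) = ∅ by decide,
    show Iio (1 : Fin 4) = {0} by decide,
    show Iio (2 : Fin 4) = {0, 1} by decide,
    show Iio (3 : Fin 4) = {0, 1, 2} by decide,
    prod_insert (show (0 : Fin 4) ∉ ({1} : Finset (Fin 4)) by decide),
    prod_insert (show (0 : Fin 4) ∉ ({1, 2} : Finset (Fin 4)) by decide),
    prod_insert (show (1 : Fin 4) ∉ ({2} : Finset (Fin 4)) by decide),
    prod_empty, prod_singleton, one_mul, mul_assoc]

theorem orderSign_five {V : Type*} (num : V → ℕ) (p : Fin 5 → V) :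
    orderSign num p =
      pairSign num (p 0) (p 1) * pairSign num (p 0) (p 2) *
      pairSign num (p 1) (p 2) * pairSign num (p 0) (p 3) *
      pairSign num (p 1) (p 3) * pairSign num (p 2) (p 3) *
      pairSign num (p 0) (p 4) * pairSign num (p 1) (p 4) *
      pairSign num (p 2) (p 4) * pairSign num (p 3) (p 4) := by
  simp only [orderSign, Fin.prod_univ_five,
    show Iio (0 : Fin 5) = ∅ by decide,
    show Iio (1 : Fin 5) = {0} by decide,
    show Iio (2 : Fin 5) = {0, 1} by decide,
    show Iio (3 : Fin 5) = {0, 1, 2} by decide,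
    show Iio (4 : Fin 5) = {0, 1, 2, 3} by decide,
    prod_insert (show (0 : Fin 5) ∉ ({1} : Finset (Fin 5)) by decide),
    prod_insert (show (0 : Fin 5) ∉ ({1, 2} : Finset (Fin 5)) by decide),
    prod_insert (show (1 : Fin 5) ∉ ({2} : Finset (Fin 5)) by decide),
    prod_insert (show (0 : Fin 5) ∉ ({1, 2, 3} : Finset (Fin 5)) by decide),
    prod_insert (show (1 : Fin 5) ∉ ({2, 3} : Finset (Fin 5)) by decide),
    prod_insert (show (2 : Fin 5) ∉ ({3} : Finset (Fin 5)) by decide),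
    prod_empty, prod_singleton, one_mul, mul_assoc]

namespace Triangulation

variable {V C : Type*} [DecidableEq V] [PartialOrder C] {T : Triangulation V C}

theorem Spells.spells_oppositeTet {u : C} {p : Fin 5 → V} (h : T.Spells u p) {a : Fin 5}
    {f : Fin 4 → Fin 5} (hinj : Function.Injective f) (hf : univ.image f = univ.erase a) :
    T.Spells (T.oppositeTet u p a) (p ∘ f) := by
  rw [← face_eq_oppositeTet u p hf]
  exact (spells_face (h.1.comp hinj) fun i => h.mem _).2

theorem image_comp_castSucc (π : Equiv.Perm (Fin 5)) :
    univ.image (π ∘ Fin.castSucc) = univ.erase (π 4) := by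
  ext x
  obtain ⟨y, rfl⟩ := π.surjective x
  simp only [mem_image, mem_univ, true_and, Function.comp_apply, EmbeddingLike.apply_eq_iff_eq,
    mem_erase, ne_eq, and_true]
  exact Fin.exists_castSucc_eq (i := y)

variable (T) in
/-- The square root `K` for the tetrahedron without the vertex `a`, with the orientation of the
order `p` of the vertices of a 4-simplex. -/
noncomputable def localRoot (K : C → (Fin 4 → V) → ℂ) (u : C) (p : Fin 5 → V) (a : Fin 5) : ℂ :=
  (Equiv.Perm.sign (Equiv.swap a 4) : ℤ) *
    K (T.oppositeTet u p a) (p ∘ (Equiv.swap a 4 ∘ Fin.castSucc))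

/-- Two permutations that put the same missing vertex last differ by a permutation of the other
four, of the same sign. So `localRoot`, defined by one transposition, serves for all of them. -/
theorem IsSquareRoots.eq_localRoot {ω : C → (Fin 3 → V) → ℂ} {K : C → (Fin 4 → V) → ℂ}
    (hK : T.IsSquareRoots ω K) {u : C} {p : Fin 5 → V} (hp : T.Spells u p)
    (π : Equiv.Perm (Fin 5)) : K (T.oppositeTet u p (π 4)) (p ∘ (π ∘ Fin.castSucc)) =
      (Equiv.Perm.sign π : ℤ) * T.localRoot K u p (π 4) := by
  set τ : Equiv.Perm (Fin 5) := Equiv.swap (π 4) 4 with hτ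
  have h4 : τ 4 = π 4 := Equiv.swap_apply_right _ _
  have h4' : (τ⁻¹ * π) (Fin.last 4) = Fin.last 4 := by
    change τ⁻¹ (π 4) = 4
    rw [← h4, Equiv.Perm.coe_inv, Equiv.symm_apply_apply]
  obtain ⟨ρ, hρ, hρ'⟩ := exists_perm_castSucc (τ⁻¹ * π) h4'
  have h1 : π ∘ Fin.castSucc = (τ ∘ Fin.castSucc) ∘ ρ := by
    funext i
    have := hρ' i
    simp only [Function.comp_apply]
    rw [← this, Equiv.Perm.mul_apply, Equiv.Perm.coe_inv, Equiv.apply_symm_apply]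
  have h2 : T.Spells (T.oppositeTet u p (π 4)) (p ∘ (τ ∘ Fin.castSucc)) :=
    hp.spells_oppositeTet (τ.injective.comp (Fin.castSucc_injective 4)) (by
      rw [image_comp_castSucc]; exact congrArg _ h4)
  rw [h1, ← Function.comp_assoc, hK.perm _ _ h2, hρ, localRoot, ← hτ, Equiv.Perm.sign_mul,
    Equiv.Perm.sign_inv]
  push_cast
  ring

theorem vec4_eq (p : Fin 5 → V) (f : Fin 4 → Fin 5) : ![p (f 0), p (f 1), p (f 2), p (f 3)] = p ∘ f := by
  funext i
  fin_cases i <;> rfl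

theorem vec5_eq (p : Fin 5 → V) (f : Fin 5 → Fin 5) :
    ![p (f 0), p (f 1), p (f 2), p (f 3), p (f 4)] = p ∘ f := by
  funext i
  fin_cases i <;> rfl

variable [Fintype C]

/-- The tetrahedra are named by their missing vertices. A permutation of the vertices changes the
orientation and $K_t$ by the same sign, and the two signs cancel in the branch condition. -/
theorem isEdgePair {o : C → (Fin 5 → V) → ℤ} (ho : T.IsOrientation o) {ω : T.cocycles}
    (hω : ∀ s (p : Fin 3 → V), T.Spells s p → (ω : C → (Fin 3 → V) → ℂ) s p ≠ 0)
    {K : C → (Fin 4 → V) → ℂ} (hK : T.IsSquareRoots ω K) {β : C → V → V → ℂ}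
    {γ : C → C → V → V → ℂ} (hE : T.IsEdgeOperators o ω K β γ) {u : C} {p : Fin 5 → V}
    (hp : T.Spells u p) :
    IsEdgePair (T.localCocycle ω u p) (T.localRoot K u p) (o u p) (T.localFamily β u p)
      (T.localFamily (γ u) u p) := by
  have hu : u ∈ T.cells 5 := mem_filter.2 ⟨mem_univ _, hp.card_vert⟩
  have hs : ∀ π : Equiv.Perm (Fin 5), (((Equiv.Perm.sign π : ℤ) : ℂ)) ^ 2 = 1 := fun π => by
    rcases Int.units_eq_one_or (Equiv.Perm.sign π) with h | h <;> simp [h]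
  have hface : ∀ π : Equiv.Perm (Fin 5), T.face u ![p (π 0), p (π 1), p (π 2), p (π 3)] =
      T.oppositeTet u p (π 4) := fun π => by
    rw [← face_eq_oppositeTet u p (image_comp_castSucc π)]
    congr 1
    exact vec4_eq p (π ∘ Fin.castSucc)
  have hspell : ∀ π : Equiv.Perm (Fin 5),
      T.Spells u ![p (π 0), p (π 1), p (π 2), p (π 3), p (π 4)] := fun π => by
    rw [vec5_eq]; exact hp.comp_perm π
  have ho' : ∀ π : Equiv.Perm (Fin 5), (o u ![p (π 0), p (π 1), p (π 2), p (π 3), p (π 4)] : ℂ) =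
      (Equiv.Perm.sign π : ℤ) * o u p := fun π => by
    rw [vec5_eq, ho.perm u p hp]
    push_cast
    rfl
  have hKp : ∀ π : Equiv.Perm (Fin 5),
      K (T.oppositeTet u p (π 4)) ![p (π 0), p (π 1), p (π 2), p (π 3)] =
        (Equiv.Perm.sign π : ℤ) * T.localRoot K u p (π 4) := fun π => by
    rw [← hK.eq_localRoot hp π]
    congr 1
    exact vec4_eq p (π ∘ Fin.castSucc)
  refine ⟨isEdgeFamily_localFamily ω hω hp β (fun t ht h i j hij => (hE.support u hu t ht h i j hij).1)
      (fun t ht h i j => (hE.antisymm u hu t ht h i j).1)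
      (fun t ht h i hi => (hE.cycle u hu t ht h i hi).1)
      (fun t ht h => (hE.relation u hu t ht h).1),
    isEdgeFamily_localFamily ω hω hp (γ u) (fun t ht h i j hij => (hE.support u hu t ht h i j hij).2)
      (fun t ht h i j => (hE.antisymm u hu t ht h i j).2)
      (fun t ht h i hi => (hE.cycle u hu t ht h i hi).2)
      (fun t ht h => (hE.relation u hu t ht h).2),
    isLocalCocycle_localCocycle ω hω hp, ?_, fun π => ?_, fun π => ?_, fun π => ?_⟩
  · rcases ho.value u p hp with h | h <;> simp [h]
  · have h1 : T.Spells (T.oppositeTet u p (π 4)) (p ∘ (π ∘ Fin.castSucc)) :=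
      hp.spells_oppositeTet (π.injective.comp (Fin.castSucc_injective 4)) (image_comp_castSucc π)
    have h2 := hK.sq _ _ h1
    rw [hK.eq_localRoot hp, mul_pow, hs, one_mul] at h2
    rw [h2, ← face_eq_oppositeTet u p (image_comp_castSucc π), Fin.prod_univ_four]
    have hm : ∀ i, (p ∘ (π ∘ Fin.castSucc)) i ∈ T.vert u := fun i => hp.mem _
    rw [face_face hm, face_face hm, face_face hm, face_face hm]
    have e0 : (p ∘ (π ∘ Fin.castSucc)) ∘ Fin.succAbove 0 = ![p (π 1), p (π 2), p (π 3)] := by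
      funext x; fin_cases x <;> rfl
    have e1 : (p ∘ (π ∘ Fin.castSucc)) ∘ Fin.succAbove 1 = ![p (π 0), p (π 2), p (π 3)] := by
      funext x; fin_cases x <;> rfl
    have e2 : (p ∘ (π ∘ Fin.castSucc)) ∘ Fin.succAbove 2 = ![p (π 0), p (π 1), p (π 3)] := by
      funext x; fin_cases x <;> rfl
    have e3 : (p ∘ (π ∘ Fin.castSucc)) ∘ Fin.succAbove 3 = ![p (π 0), p (π 1), p (π 2)] := by
      funext x; fin_cases x <;> rfl
    rw [e0, e1, e2, e3]
    simp only [localCocycle]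
    ring
  · have h1 := hE.normalization u _ _ _ _ _ (hspell π)
    rw [hface, ho'] at h1
    exact h1
  · have h1 := hE.branch u _ _ _ _ _ (hspell π)
    rw [hface, ho', hKp] at h1
    refine h1.trans ?_
    have h2 : -((Equiv.Perm.sign π : ℤ) * (o u p : ℂ)) *
        ((Equiv.Perm.sign π : ℤ) * T.localRoot K u p (π 4)) =
        -(o u p : ℂ) * T.localRoot K u p (π 4) := by
      linear_combination -(o u p : ℂ) * T.localRoot K u p (π 4) * hs π
    rw [h2]
    rfl

open Classical in
theorem Spells.prod_tetrahedra {R : Type*} [CommMonoid R] {u : C} {p : Fin 5 → V}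
    (hp : T.Spells u p) (f : C → R) :
    ∏ t ∈ (T.cells 4).filter (· ≤ u), f t = ∏ a, f (T.oppositeTet u p a) := by
  rw [prod_cells_le (by norm_num) hp, show powersetCard 4 (univ : Finset (Fin 5)) =
    univ.image (fun a => univ.erase a) by decide, prod_image fun a _ b _ hab => ?_]
  · rfl
  · revert a b; decide

open Classical in
theorem Spells.sum_tetrahedra {R : Type*} [AddCommMonoid R] {u : C} {p : Fin 5 → V}
    (hp : T.Spells u p) (f : C → R) :
    ∑ t ∈ (T.cells 4).filter (· ≤ u), f t = ∑ a, f (T.oppositeTet u p a) :=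
  hp.prod_tetrahedra (R := Multiplicative R) f

theorem IsWeightMatrix.localFamily_eq {β : C → V → V → ℂ} {γ : C → C → V → V → ℂ}
    {F : C → C → C → ℂ} (hF : T.IsWeightMatrix β γ F) {u : C} {p : Fin 5 → V} (hp : T.Spells u p)
    (a' i j : Fin 5) : T.localFamily (γ u) u p a' i j = ∑ a, T.localFamily β u p a i j *
      F u (T.oppositeTet u p a) (T.oppositeTet u p a') := by
  have h1 := hF.annihilate u (mem_filter.2 ⟨mem_univ _, hp.card_vert⟩) (T.oppositeTet u p a')
    (mem_filter.2 ⟨mem_univ _, hp.card_oppositeTet a'⟩) (hp.oppositeTet_spec a').1 _ (hp.mem i) _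
    (hp.mem j)
  rw [hp.sum_tetrahedra] at h1
  exact h1

/-! ### Triangle roots and the local formula for $H_u$. -/

open Classical in
theorem Spells.prod_triangles {u : C} {p : Fin 5 → V} (hp : T.Spells u p) (q : C → ℂ) :
    ∏ s ∈ (T.cells 3).filter (· ≤ u), q s =
      q (T.face u ![p 0, p 1, p 2]) * (q (T.face u ![p 0, p 1, p 3]) *
      (q (T.face u ![p 0, p 1, p 4]) * (q (T.face u ![p 0, p 2, p 3]) *
      (q (T.face u ![p 0, p 2, p 4]) * (q (T.face u ![p 0, p 3, p 4]) *
      (q (T.face u ![p 1, p 2, p 3]) * (q (T.face u ![p 1, p 2, p 4]) *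
      (q (T.face u ![p 1, p 3, p 4]) * q (T.face u ![p 2, p 3, p 4]))))))))) := by
  have h1 : ∀ a b c : Fin 5, T.faceOn u (({a, b, c} : Finset (Fin 5)).image p) =
      T.face u ![p a, p b, p c] := by
    intro a b c
    rw [comp_vec3, face_eq_faceOn, ← image_image]
    congr 2
    revert a b c
    decide
  rw [prod_cells_le (by norm_num) hp, show powersetCard 3 (univ : Finset (Fin 5)) =
    {{0, 1, 2}, {0, 1, 3}, {0, 1, 4}, {0, 2, 3}, {0, 2, 4}, {0, 3, 4}, {1, 2, 3}, {1, 2, 4},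
      {1, 3, 4}, {2, 3, 4}} by decide, prod_insert (by decide), prod_insert (by decide),
    prod_insert (by decide), prod_insert (by decide), prod_insert (by decide),
    prod_insert (by decide), prod_insert (by decide), prod_insert (by decide),
    prod_insert (by decide), prod_singleton]
  simp only [h1]

theorem IsTriangleRoots.cocycle_eq {ω : T.cocycles} {K : C → (Fin 4 → V) → ℂ} {num : V → ℕ}
    {q : C → ℂ} (hq : T.IsTriangleRoots ω K num q) (hnum : Function.Injective num) {s : C}
    {p : Fin 3 → V} (hp : T.Spells s p) :
    (ω : C → (Fin 3 → V) → ℂ) s p = orderSign num p * q s ^ 2 := by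
  obtain ⟨π, h1, h2⟩ := exists_sort hnum hp.1
  rw [hq.sq s _ (hp.comp_perm π) h1, ω.2.2.1 s p hp π, h2, ← mul_assoc, ← Int.cast_mul,
    ← Units.val_mul, Int.units_mul_self]
  simp

open Classical in
theorem Spells.prod_triangles_tetrahedron {t : C} {p : Fin 4 → V} (hp : T.Spells t p) (q : C → ℂ) :
    ∏ s ∈ (T.cells 3).filter (· ≤ t), q s = ∏ a : Fin 4, q (T.face t (p ∘ a.succAbove)) := by
  rw [prod_cells_le (by norm_num) hp, show powersetCard 3 (univ : Finset (Fin 4)) =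
    univ.image (fun a : Fin 4 => univ.image a.succAbove) by decide, prod_image fun a _ b _ hab => ?_]
  · exact prod_congr rfl fun a _ => by rw [face_eq_faceOn, ← image_image]
  · revert a b; decide

theorem IsTriangleRoots.root_eq {ω : C → (Fin 3 → V) → ℂ} {K : C → (Fin 4 → V) → ℂ} {num : V → ℕ}
    {q : C → ℂ} (hq : T.IsTriangleRoots ω K num q) (hK : T.IsSquareRoots ω K)
    (hnum : Function.Injective num) {t : C} {p : Fin 4 → V} (hp : T.Spells t p) :
    K t p = orderSign num p * ∏ a : Fin 4, q (T.face t (p ∘ a.succAbove)) := by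
  classical
  obtain ⟨π, h1, h2⟩ := exists_sort hnum hp.1
  have h3 := hq.agree t _ (hp.comp_perm π) h1
  rw [hK.perm t p hp π, ← (hp.comp_perm π).prod_triangles_tetrahedron,
    hp.prod_triangles_tetrahedron] at h3
  rw [← h3, h2, ← mul_assoc, ← Int.cast_mul, ← Units.val_mul, Int.units_mul_self]
  simp

open Classical in
/-- The quantity `H` does not depend on the way in which it is calculated. -/
theorem valueH_eq {o : C → (Fin 5 → V) → ℤ} (ho : T.IsOrientation o) {ω : T.cocycles}
    (hω : ∀ s (p : Fin 3 → V), T.Spells s p → (ω : C → (Fin 3 → V) → ℂ) s p ≠ 0)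
    {K : C → (Fin 4 → V) → ℂ} (hK : T.IsSquareRoots ω K) {β : C → V → V → ℂ}
    {γ : C → C → V → V → ℂ} (hE : T.IsEdgeOperators o ω K β γ) {F : C → C → C → ℂ}
    (hF : T.IsWeightMatrix β γ F) {num : V → ℕ} (hnum : Function.Injective num) {q : C → ℂ}
    (hq : T.IsTriangleRoots ω K num q) {u : C} {p : Fin 5 → V} (hp : T.Spells u p)
    (h01 : num (p 0) < num (p 1)) (hD : T.denominatorH F u (p 0) (p 1) (p 2) (p 3) (p 4) ≠ 0) :
    T.valueH β F q u (p 0) (p 1) (p 2) (p 3) (p 4) =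
      edgeMinor (T.localCocycle ω u p) (T.localFamily β u p) * orderSign num p *
        ∏ s ∈ (T.cells 3).filter (· ≤ u), q s := by
  have hmem : ∀ i, p i ∈ T.vert u := hp.mem
  -- From `mul_minor` the result follows by writing every $\omega_s$ as a sign times $q_s^2$ and
  -- every $K_t$ as a sign times a product of four $q_s$; the rest is bookkeeping with signs of
  -- pairs of vertices.
  have hpair := isEdgePair ho hω hK hE hp
  have hmin := hpair.mul_minor (hF.localFamily_eq hp)
  have hmono : ∀ a b c : Fin 5, a ≠ b → a ≠ c → b ≠ c →
      T.Spells (T.face u ![p a, p b, p c]) ![p a, p b, p c] := by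
    intro a b c h h' h''
    refine (spells_face ?_ fun x => by fin_cases x <;> exact hp.mem _).2
    rw [comp_vec3]
    refine hp.1.comp ?_
    revert a b c
    decide
  have hw : ∀ a b c : Fin 5, a ≠ b → a ≠ c → b ≠ c → T.localCocycle ω u p a b c =
      pairSign num (p a) (p b) * (pairSign num (p a) (p c) * pairSign num (p b) (p c)) *
        q (T.face u ![p a, p b, p c]) ^ 2 := by
    intro a b c h h' h''
    rw [localCocycle, hq.cocycle_eq hnum (hmono a b c h h' h''), orderSign_three, mul_assoc (pairSign _ _ _)]
    rfl
  have hQ : ∀ a b c : Fin 5, a ≠ b → a ≠ c → b ≠ c → q (T.face u ![p a, p b, p c]) ≠ 0 := by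
    intro a b c h h' h'' h0
    refine hω _ _ (hmono a b c h h' h'') ?_
    rw [hq.cocycle_eq hnum (hmono a b c h h' h''), h0]
    ring
  have hv : ∀ a b : Fin 5, a ≠ b → pairSign num (p a) (p b) ^ 2 = 1 := fun a b h =>
    pairSign_sq hnum (hp.1.ne h)
  have hroot : ∀ f : Fin 4 → Fin 5, Function.Injective f → ∀ a, univ.image f = univ.erase a →
      K (T.oppositeTet u p a) (p ∘ f) = orderSign num (p ∘ f) *
        (q (T.face u ![p (f 1), p (f 2), p (f 3)]) * q (T.face u ![p (f 0), p (f 2), p (f 3)]) *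
          q (T.face u ![p (f 0), p (f 1), p (f 3)]) *
          q (T.face u ![p (f 0), p (f 1), p (f 2)])) := by
    intro f hf a hfa
    rw [hq.root_eq hK hnum (hp.spells_oppositeTet hf hfa), Fin.prod_univ_four,
      ← face_eq_oppositeTet u p hfa]
    have hm : ∀ i, (p ∘ f) i ∈ T.vert u := fun i => hp.mem _
    rw [face_face hm, face_face hm, face_face hm, face_face hm]
    have e0 : (p ∘ f) ∘ Fin.succAbove 0 = ![p (f 1), p (f 2), p (f 3)] := by
      funext x; fin_cases x <;> rfl
    have e1 : (p ∘ f) ∘ Fin.succAbove 1 = ![p (f 0), p (f 2), p (f 3)] := by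
      funext x; fin_cases x <;> rfl
    have e2 : (p ∘ f) ∘ Fin.succAbove 2 = ![p (f 0), p (f 1), p (f 3)] := by
      funext x; fin_cases x <;> rfl
    have e3 : (p ∘ f) ∘ Fin.succAbove 3 = ![p (f 0), p (f 1), p (f 2)] := by
      funext x; fin_cases x <;> rfl
    rw [e0, e1, e2, e3]
  have k4 : T.localRoot K u p 4 = orderSign num (p ∘ ![0, 1, 2, 3]) *
      (q (T.face u ![p 1, p 2, p 3]) * q (T.face u ![p 0, p 2, p 3]) *
        q (T.face u ![p 0, p 1, p 3]) * q (T.face u ![p 0, p 1, p 2])) := by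
    have h1 := hK.eq_localRoot hp 1
    rw [Equiv.Perm.sign_one] at h1
    simp only [Equiv.Perm.one_apply, Units.val_one, Int.cast_one, one_mul] at h1
    rw [← h1]
    refine Eq.trans (congrArg _ (congrArg _ ?_)) (hroot ![0, 1, 2, 3] (by decide) 4 (by decide))
    decide
  have k2 : T.localRoot K u p 2 = orderSign num (p ∘ ![0, 1, 3, 4]) *
      (q (T.face u ![p 1, p 3, p 4]) * q (T.face u ![p 0, p 3, p 4]) *
        q (T.face u ![p 0, p 1, p 4]) * q (T.face u ![p 0, p 1, p 3])) := by
    have h1 := hK.eq_localRoot hp (Equiv.swap 2 4 * Equiv.swap 2 3)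
    rw [show (Equiv.swap 2 4 * Equiv.swap 2 3 : Equiv.Perm (Fin 5)) 4 = 2 by decide,
      show Equiv.Perm.sign (Equiv.swap 2 4 * Equiv.swap 2 3 : Equiv.Perm (Fin 5)) = 1 by decide] at h1
    simp only [Units.val_one, Int.cast_one, one_mul] at h1
    rw [← h1]
    refine Eq.trans (congrArg _ (congrArg _ ?_)) (hroot ![0, 1, 3, 4] (by decide) 2 (by decide))
    decide
  -- Moving the vertex $3$ to the last place is an odd permutation, whereas the vertex $2$ is moved
  -- there by an even one. This sign cancels the minus sign in `mul_minor`.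
  have k3 : T.localRoot K u p 3 = -(orderSign num (p ∘ ![0, 1, 2, 4]) *
      (q (T.face u ![p 1, p 2, p 4]) * q (T.face u ![p 0, p 2, p 4]) *
        q (T.face u ![p 0, p 1, p 4]) * q (T.face u ![p 0, p 1, p 2]))) := by
    have h1 := hK.eq_localRoot hp (Equiv.swap 3 4)
    rw [show (Equiv.swap 3 4 : Equiv.Perm (Fin 5)) 4 = 3 by decide,
      show Equiv.Perm.sign (Equiv.swap 3 4 : Equiv.Perm (Fin 5)) = -1 by decide] at h1
    simp only [Units.val_neg, Units.val_one, Int.cast_neg, Int.cast_one, neg_mul, one_mul] at h1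
    rw [← neg_eq_iff_eq_neg, ← h1]
    refine Eq.trans (congrArg _ (congrArg _ ?_)) (hroot ![0, 1, 2, 4] (by decide) 3 (by decide))
    decide
  have hface : ∀ f : Fin 4 → Fin 5, ∀ a, univ.image f = univ.erase a →
      T.face u ![p (f 0), p (f 1), p (f 2), p (f 3)] = T.oppositeTet u p a := by
    intro f a hfa
    rw [vec4_eq, face_eq_oppositeTet u p hfa]
  have f0 := hface ![1, 2, 3, 4] 0 (by decide)
  have f1 := hface ![0, 2, 3, 4] 1 (by decide)
  have f2 := hface ![0, 1, 3, 4] 2 (by decide)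
  have f3 := hface ![0, 1, 2, 4] 3 (by decide)
  have f4 := hface ![0, 1, 2, 3] 4 (by decide)
  simp only [Matrix.cons_val] at f0 f1 f2 f3 f4
  have hD' : T.denominatorH F u (p 0) (p 1) (p 2) (p 3) (p 4) =
      F u (T.oppositeTet u p 1) (T.oppositeTet u p 3) *
        F u (T.oppositeTet u p 0) (T.oppositeTet u p 2) -
      F u (T.oppositeTet u p 1) (T.oppositeTet u p 2) *
        F u (T.oppositeTet u p 0) (T.oppositeTet u p 3) := by
    rw [denominatorH, f0, f1, f2, f3]
  have hb : T.localFamily β u p 4 0 1 = β (T.face u ![p 0, p 1, p 2, p 3]) (p 0) (p 1) := by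
    rw [f4]; rfl
  rw [← hD', hb, k2, k3, k4, hw 0 1 4 (by decide) (by decide) (by decide),
    hw 0 3 4 (by decide) (by decide) (by decide), hw 1 3 4 (by decide) (by decide) (by decide),
    hw 0 2 4 (by decide) (by decide) (by decide), hw 1 2 4 (by decide) (by decide) (by decide),
    orderSign_four, orderSign_four, orderSign_four] at hmin
  simp only [Function.comp_apply, Matrix.cons_val] at hmin
  rw [valueH, div_eq_iff hD, hp.prod_triangles, orderSign_five]
  have v01 : pairSign num (p 0) (p 1) = 1 := pairSign_of_lt h01
  rw [v01] at hmin ⊢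
  have v02 := hv 0 2 (by decide)
  have v03 := hv 0 3 (by decide)
  have v04 := hv 0 4 (by decide)
  have v12 := hv 1 2 (by decide)
  have v13 := hv 1 3 (by decide)
  have v14 := hv 1 4 (by decide)
  have v24 := hv 2 4 (by decide)
  have v34 := hv 3 4 (by decide)
  have q012 := hQ 0 1 2 (by decide) (by decide) (by decide)
  have q013 := hQ 0 1 3 (by decide) (by decide) (by decide)
  have q014 := hQ 0 1 4 (by decide) (by decide) (by decide)
  have q034 := hQ 0 3 4 (by decide) (by decide) (by decide)
  have q134 := hQ 1 3 4 (by decide) (by decide) (by decide)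
  have q024 := hQ 0 2 4 (by decide) (by decide) (by decide)
  have q124 := hQ 1 2 4 (by decide) (by decide) (by decide)
  clear hw hQ hv hroot hface hD' hb k2 k3 k4 hpair hmono f0 f1 f2 f3 f4 hD v01 h01
  generalize T.denominatorH F u (p 0) (p 1) (p 2) (p 3) (p 4) = D at *
  generalize edgeMinor (T.localCocycle ω u p) (T.localFamily β u p) = θ at *
  generalize β (T.face u ![p 0, p 1, p 2, p 3]) (p 0) (p 1) = b at *
  generalize q (T.face u ![p 0, p 1, p 2]) = Q012 at *
  generalize q (T.face u ![p 0, p 1, p 3]) = Q013 at *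
  generalize q (T.face u ![p 0, p 1, p 4]) = Q014 at *
  generalize q (T.face u ![p 0, p 2, p 3]) = Q023 at *
  generalize q (T.face u ![p 0, p 2, p 4]) = Q024 at *
  generalize q (T.face u ![p 0, p 3, p 4]) = Q034 at *
  generalize q (T.face u ![p 1, p 2, p 3]) = Q123 at *
  generalize q (T.face u ![p 1, p 2, p 4]) = Q124 at *
  generalize q (T.face u ![p 1, p 3, p 4]) = Q134 at *
  generalize q (T.face u ![p 2, p 3, p 4]) = Q234 at *
  generalize pairSign num (p 0) (p 2) = V02 at *
  generalize pairSign num (p 0) (p 3) = V03 at *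
  generalize pairSign num (p 0) (p 4) = V04 at *
  generalize pairSign num (p 1) (p 2) = V12 at *
  generalize pairSign num (p 1) (p 3) = V13 at *
  generalize pairSign num (p 1) (p 4) = V14 at *
  generalize pairSign num (p 2) (p 3) = V23 at *
  generalize pairSign num (p 2) (p 4) = V24 at *
  generalize pairSign num (p 3) (p 4) = V34 at *
  -- Each sign squares to one, so the products of signs on both sides reduce to their factors of odd
  -- multiplicity.
  have hL : (V03 * V04 * V13 * V14 * V34) * (V02 * V04 * V12 * V14 * V24) =
      V02 * V03 * V12 * V13 * V24 * V34 := by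
    calc _ = V04 ^ 2 * V14 ^ 2 * (V02 * V03 * V12 * V13 * V24 * V34) := by ring
      _ = _ := by rw [v04, v14]; ring
  have hR : (V02 * V03 * V12 * V13 * V23) * ((V04 * V14) * (V03 * V04 * V34) * (V13 * V14 * V34) *
      (V02 * V04 * V24) * (V12 * V14 * V24)) = V23 * V04 * V14 := by
    calc _ = V02 ^ 2 * V03 ^ 2 * V12 ^ 2 * V13 ^ 2 * V34 ^ 2 * V24 ^ 2 * V04 ^ 2 * V14 ^ 2 *
          (V23 * V04 * V14) := by ring
      _ = _ := by rw [v02, v03, v12, v13, v34, v24, v04, v14]; ring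
  have hL2 : (V02 * V03 * V12 * V13 * V24 * V34) ^ 2 = 1 := by
    calc _ = V02 ^ 2 * V03 ^ 2 * V12 ^ 2 * V13 ^ 2 * V24 ^ 2 * V34 ^ 2 := by ring
      _ = _ := by rw [v02, v03, v12, v13, v24, v34]; ring
  set A := b * (Q134 * Q034 * Q014 * Q013 * (Q124 * Q024 * Q014 * Q012)) with hA
  set B := θ * D * (Q123 * Q023 * Q013 * Q012) *
    (Q014 ^ 2 * Q034 ^ 2 * Q134 ^ 2 * Q024 ^ 2 * Q124 ^ 2) with hB
  have h1 : A * (V02 * V03 * V12 * V13 * V24 * V34) = B * (V23 * V04 * V14) := by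
    rw [← hL, ← hR, hA, hB]
    linear_combination -hmin
  have h2 : A = B * (V23 * V04 * V14 * (V02 * V03 * V12 * V13 * V24 * V34)) := by
    linear_combination (V02 * V03 * V12 * V13 * V24 * V34) * h1 - A * hL2
  have h3 : b = θ * D * (Q123 * Q023 * Q034 * Q134 * Q024 * Q124) *
      (V23 * V04 * V14 * (V02 * V03 * V12 * V13 * V24 * V34)) := by
    have hne : Q134 * Q034 * Q014 * Q013 * (Q124 * Q024 * Q014 * Q012) ≠ 0 := by positivity
    refine mul_right_cancel₀ hne ?_
    rw [← hA, h2, hB]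
    ring
  rw [h3]
  ring

end Triangulation

/-- The product over edges takes the shape of `orderSign`, with which it is compared. -/
theorem prod_powersetCard_two {n : ℕ} {R : Type*} [CommMonoid R] (f : Finset (Fin n) → R) :
    ∏ B ∈ powersetCard 2 (univ : Finset (Fin n)), f B = ∏ j, ∏ i ∈ Iio j, f {i, j} := by
  rw [prod_sigma']
  symm
  refine prod_bij (fun z _ => {z.2, z.1}) ?_ ?_ ?_ ?_
  · rintro ⟨j, i⟩ h
    have h1 : i < j := by simpa using h
    exact mem_powersetCard.2 ⟨subset_univ _, card_pair h1.ne⟩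
  · rintro ⟨j, i⟩ h ⟨j', i'⟩ h' heq
    have h1 : i < j := by simpa using h
    have h1' : i' < j' := by simpa using h'
    simp only at heq
    have h2 : i = i' ∨ i = j' := by
      have : i ∈ ({i', j'} : Finset (Fin n)) := heq ▸ mem_insert_self _ _
      simpa using this
    have h3 : j = i' ∨ j = j' := by
      have : j ∈ ({i', j'} : Finset (Fin n)) := heq ▸ mem_insert_of_mem (mem_singleton_self _)
      simpa using this
    rcases h2 with rfl | rfl <;> rcases h3 with rfl | rfl
    · exact absurd h1 (lt_irrefl _)
    · rfl
    · exact absurd h1 h1'.not_gt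
    · exact absurd h1 (lt_irrefl _)
  · intro B hB
    obtain ⟨x, y, hxy, rfl⟩ := card_eq_two.1 (mem_powersetCard.1 hB).2
    rcases lt_or_gt_of_ne hxy with h | h
    · exact ⟨⟨y, x⟩, by simpa using h, rfl⟩
    · exact ⟨⟨x, y⟩, by simpa using h, pair_comm _ _⟩
  · intro _ _
    rfl

namespace Triangulation

variable {V C : Type*} [DecidableEq V] [PartialOrder C] {T : Triangulation V C}

/-! ### Change of the numbering -/

variable (T) in
open Classical in
/-- The factor of an edge on whose order two numberings of the vertices disagree or agree. -/
noncomputable def edgeFlip (num num' : V → ℕ) (e : C) : ℂ :=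
  if ∃ x ∈ T.vert e, ∃ y ∈ T.vert e, num x < num y ∧ num' y < num' x then Complex.I else 1

theorem edgeFlip_pow_four (num num' : V → ℕ) (e : C) : T.edgeFlip num num' e ^ 4 = 1 := by
  unfold edgeFlip
  split_ifs
  · exact Complex.I_pow_four
  · exact one_pow 4

theorem edgeFlip_sq {num num' : V → ℕ} (hnum : Function.Injective num)
    (hnum' : Function.Injective num') {e : C} {x y : V} (hxy : x ≠ y) (he : T.vert e = {x, y}) :
    T.edgeFlip num num' e ^ 2 = pairSign num x y * pairSign num' x y := by
  have h : (∃ a ∈ T.vert e, ∃ b ∈ T.vert e, num a < num b ∧ num' b < num' a) ↔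
      (num x < num y ∧ num' y < num' x) ∨ (num y < num x ∧ num' x < num' y) := by
    rw [he]
    simp
  unfold edgeFlip
  rw [if_congr h rfl rfl]
  rcases lt_or_gt_of_ne (hnum.ne hxy) with h1 | h1 <;>
    rcases lt_or_gt_of_ne (hnum'.ne hxy) with h2 | h2
  · simp [h1, h2, h1.not_gt, h2.not_gt, pairSign_of_lt]
  · simp [h1, h2, pairSign_of_lt, pairSign_of_gt]
  · simp [h1, h2, pairSign_of_lt, pairSign_of_gt]
  · simp [h1, h2, h1.not_gt, h2.not_gt, pairSign_of_gt]

variable [Fintype C]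

variable (T) in
open Classical in
/-- The product of `edgeFlip` over the edges of a simplex. -/
noncomputable def flip (num num' : V → ℕ) (τ : C) : ℂ :=
  ∏ e ∈ (T.cells 2).filter (· ≤ τ), T.edgeFlip num num' e

/-- The square of an edge factor is $-1$ exactly when the two numberings disagree on the edge, and
orders of vertices are compared by the product of these signs over all pairs. -/
theorem Spells.flip_sq {num num' : V → ℕ} (hnum : Function.Injective num)
    (hnum' : Function.Injective num') {n : ℕ} {τ : C} {p : Fin n → V} (hp : T.Spells τ p) :
    T.flip num num' τ ^ 2 = orderSign num p * orderSign num' p := by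
  classical
  rw [flip, ← prod_pow, prod_cells_le two_ne_zero hp, prod_powersetCard_two, orderSign, orderSign,
    ← prod_mul_distrib]
  refine prod_congr rfl fun j _ => ?_
  rw [← prod_mul_distrib]
  refine prod_congr rfl fun i hi => ?_
  refine edgeFlip_sq hnum hnum' (hp.1.ne (mem_Iio.1 hi).ne) ?_
  rw [(faceOn_spec (T := T) _ _).2, image_insert, image_singleton]
  · rw [← hp.2]
    exact image_subset_image (subset_univ _)
  · exact image_nonempty.2 (insert_nonempty _ _)

-- Each face $e$ is counted once for every $N$-vertex simplex between it and $\tau$, and their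
-- number is a binomial coefficient.
open Classical in
theorem prod_prod_cells_le {n m k N : ℕ} {τ : C} (hτ : (T.vert τ).card = n + m) (hk : n + k = N)
    (f : C → ℂ) : ∏ s ∈ (T.cells N).filter (· ≤ τ), ∏ e ∈ (T.cells n).filter (· ≤ s), f e =
      (∏ e ∈ (T.cells n).filter (· ≤ τ), f e) ^ m.choose k := by
  subst hk
  rw [prod_comm' (s' := fun e => (T.cells (n + k)).filter (fun s => e ≤ s ∧ s ≤ τ))
    (t' := (T.cells n).filter (· ≤ τ)), ← prod_pow]
  · refine prod_congr rfl fun e he => ?_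
    obtain ⟨h1, h2⟩ := mem_filter.1 he
    rw [prod_const, card_between h2 (mem_filter.1 h1).2 hτ]
  · intro s e
    simp only [mem_filter]
    constructor
    · rintro ⟨⟨h1, h2⟩, h3, h4⟩
      exact ⟨⟨h1, h4, h2⟩, h3, h4.trans h2⟩
    · rintro ⟨⟨h1, h2, h3⟩, h4, -⟩
      exact ⟨⟨h1, h3⟩, h4, h2⟩

open Classical in
theorem prod_prod_cells (n N : ℕ) (f : C → ℂ) :
    ∏ s ∈ T.cells N, ∏ e ∈ (T.cells n).filter (· ≤ s), f e =
      ∏ e ∈ T.cells n, f e ^ T.cofaceCount N e := by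
  rw [prod_comm' (s' := fun e => (T.cells N).filter (e ≤ ·)) (t' := T.cells n)]
  · exact prod_congr rfl fun e _ => by rw [prod_const, cofaceCount]
  · intro s e
    simp only [mem_filter]
    tauto

/-- On a triangle the square of the new factor is the change of sign of $\omega_s$. On a tetrahedron
every edge lies in two triangles, so the factors multiply to the square of `flip`, which is the
change of sign of $K_t$. -/
theorem IsTriangleRoots.flip {ω : T.cocycles} {K : C → (Fin 4 → V) → ℂ} {num num' : V → ℕ}
    {q : C → ℂ} (hq : T.IsTriangleRoots ω K num q) (hK : T.IsSquareRoots ω K)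
    (hnum : Function.Injective num) (hnum' : Function.Injective num') :
    T.IsTriangleRoots ω K num' (fun s => q s * T.flip num num' s) := by
  classical
  constructor
  · intro s p hp hmono
    rw [hq.cocycle_eq hnum hp, mul_pow, hp.flip_sq hnum hnum', orderSign_of_strictMono hmono]
    ring
  · intro t p hp hmono
    rw [hq.root_eq hK hnum hp, prod_mul_distrib,
      ← hp.prod_triangles_tetrahedron (T.flip num num')]
    have h1 := prod_prod_cells_le (T := T) (n := 2) (m := 2) (k := 1) hp.card_vert rfl
      (T.edgeFlip num num')
    have h2 : ∏ s ∈ (T.cells 3).filter (· ≤ t), T.flip num num' s = orderSign num p := by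
      refine h1.trans ?_
      have h3 := hp.flip_sq hnum hnum'
      rw [orderSign_of_strictMono hmono, mul_one] at h3
      exact h3
    rw [h2, mul_comm]

variable (T) in
open Classical in
/-- The orientation of a 4-simplex compared with the order of its vertices. -/
noncomputable def simplexSign (o : C → (Fin 5 → V) → ℤ) (num : V → ℕ) (u : C) : ℂ :=
  if h : ∃ p, T.Spells u p then o u h.choose * orderSign num h.choose else 0

theorem simplexSign_eq {o : C → (Fin 5 → V) → ℤ} (ho : T.IsOrientation o) (num : V → ℕ) {u : C}
    {p : Fin 5 → V} (hp : T.Spells u p) : T.simplexSign o num u = o u p * orderSign num p := by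
  have h : ∃ p, T.Spells u p := ⟨p, hp⟩
  obtain ⟨π, hπ⟩ := hp.exists_perm h.choose_spec
  rw [simplexSign, dif_pos h, hπ, orderSign_comp, ho.perm u p hp]
  rcases Int.units_eq_one_or (Equiv.Perm.sign π) with h | h <;> simp [h]

theorem simplexSign_flip {o : C → (Fin 5 → V) → ℤ} (ho : T.IsOrientation o) {num num' : V → ℕ}
    (hnum : Function.Injective num) (hnum' : Function.Injective num') {u : C} (hu : u ∈ T.cells 5) :
    T.simplexSign o num' u = T.simplexSign o num u * T.flip num num' u ^ 2 := by
  obtain ⟨p, hp⟩ := exists_spells (mem_filter.1 hu).2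
  rw [simplexSign_eq ho num hp, simplexSign_eq ho num' hp, hp.flip_sq hnum hnum']
  obtain ⟨π, -, h2⟩ := exists_sort hnum hp.1
  have h3 : orderSign num p ^ 2 = 1 := by
    rw [h2]
    rcases Int.units_eq_one_or (Equiv.Perm.sign π) with h | h <;> simp [h]
  linear_combination -(o u p : ℂ) * orderSign num' p * h3

variable (T) in
open Classical in
/-- The part of the square of the quantity `I` that depends on the numbering and the roots `q`. -/
noncomputable def rootFactor (o : C → (Fin 5 → V) → ℤ) (num : V → ℕ) (q : C → ℂ) : ℂ :=
  (∏ s ∈ T.cells 3, (q s)⁻¹) ^ 2 *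
    ∏ u ∈ T.cells 5, (T.simplexSign o num u * ∏ s ∈ (T.cells 3).filter (· ≤ u), q s)

/-- In a 4-simplex every edge lies in three triangles, so the roots contribute the cube of its
factor, and the orientation sign contributes the square. -/
theorem rootFactor_flip (hT : T.IsClosedFourManifold) {o : C → (Fin 5 → V) → ℤ}
    (ho : T.IsOrientation o) {num num' : V → ℕ}
    (hnum : Function.Injective num) (hnum' : Function.Injective num') (q : C → ℂ) :
    T.rootFactor o num' (fun s => q s * T.flip num num' s) = T.rootFactor o num q := by
  classical
  have h1 : ∀ u ∈ T.cells 5, T.simplexSign o num' u *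
      ∏ s ∈ (T.cells 3).filter (· ≤ u), q s * T.flip num num' s =
      (T.simplexSign o num u * ∏ s ∈ (T.cells 3).filter (· ≤ u), q s) * T.flip num num' u ^ 5 := by
    intro u hu
    have h2 : ∏ s ∈ (T.cells 3).filter (· ≤ u), T.flip num num' s = T.flip num num' u ^ 3 :=
      prod_prod_cells_le (n := 2) (m := 3) (k := 1) (mem_filter.1 hu).2 rfl _
    rw [simplexSign_flip ho hnum hnum' hu, prod_mul_distrib, h2]
    ring
  have h3 : ∏ u ∈ T.cells 5, T.flip num num' u ^ 5 = (∏ s ∈ T.cells 3, T.flip num num' s) ^ 2 := by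
    have h4 := prod_prod_cells (T := T) 2 5 (T.edgeFlip num num')
    have h5 := prod_prod_cells (T := T) 2 3 (T.edgeFlip num num')
    rw [prod_pow]
    refine (congrArg (· ^ 5) h4).trans (Eq.trans ?_ (congrArg (· ^ 2) h5).symm)
    rw [← prod_pow, ← prod_pow]
    refine prod_congr rfl fun e he => ?_
    -- The exponents $5n_5$ and $2n_3=n_5+4$ agree modulo four, and the fourth power of an edge
    -- factor is one.
    have h6 := edgeFlip_pow_four (T := T) num num' e
    rw [← pow_mul, ← pow_mul, mul_comm _ 2, ← hT.cofaceCount_edge he, mul_comm, pow_mul, pow_succ,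
      h6, one_mul, pow_add, h6, mul_one]
  have h7 : ∏ s ∈ T.cells 3, T.flip num num' s ≠ 0 := by
    refine prod_ne_zero_iff.2 fun s _ => prod_ne_zero_iff.2 fun e _ h => ?_
    have := edgeFlip_pow_four (T := T) num num' e
    rw [h] at this
    norm_num at this
  rw [rootFactor, rootFactor, prod_congr rfl h1, prod_mul_distrib, h3]
  simp only [mul_inv, prod_mul_distrib, prod_inv_distrib]
  field_simp

/-- Since a triangle lies in equally many tetrahedra and 4-simplices, the product of the $q_s$ over
all 4-simplices equals the one over all tetrahedra, which is the product of the $K_t$ taken in the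
order of the numbers. The other occurrences of $q_s$ are squares. -/
theorem IsTriangleRoots.rootFactor_eq (hT : T.IsClosedFourManifold) {o : C → (Fin 5 → V) → ℤ}
    {ω : T.cocycles} {K : C → (Fin 4 → V) → ℂ} {num : V → ℕ} (hnum : Function.Injective num)
    {q q' : C → ℂ} (hq : T.IsTriangleRoots ω K num q) (hq' : T.IsTriangleRoots ω K num q') :
    T.rootFactor o num q' = T.rootFactor o num q := by
  classical
  have h1 : ∀ s ∈ T.cells 3, q' s ^ 2 = q s ^ 2 := by
    intro s hs
    obtain ⟨p, hp⟩ := exists_spells (mem_filter.1 hs).2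
    obtain ⟨π, hπ, -⟩ := exists_sort hnum hp.1
    rw [hq.sq s _ (hp.comp_perm π) hπ, hq'.sq s _ (hp.comp_perm π) hπ]
  have h2 : ∀ t ∈ T.cells 4, ∏ s ∈ (T.cells 3).filter (· ≤ t), q' s =
      ∏ s ∈ (T.cells 3).filter (· ≤ t), q s := by
    intro t ht
    obtain ⟨p, hp⟩ := exists_spells (mem_filter.1 ht).2
    obtain ⟨π, hπ, -⟩ := exists_sort hnum hp.1
    rw [(hp.comp_perm π).prod_triangles_tetrahedron, (hp.comp_perm π).prod_triangles_tetrahedron,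
      ← hq.agree t _ (hp.comp_perm π) hπ, ← hq'.agree t _ (hp.comp_perm π) hπ]
  have h3 : ∀ q : C → ℂ, ∏ u ∈ T.cells 5, ∏ s ∈ (T.cells 3).filter (· ≤ u), q s =
      ∏ t ∈ T.cells 4, ∏ s ∈ (T.cells 3).filter (· ≤ t), q s := by
    intro q
    rw [prod_prod_cells, prod_prod_cells]
    exact prod_congr rfl fun s hs => by rw [hT.cofaceCount_triangle hs]
  rw [rootFactor, rootFactor, prod_mul_distrib, prod_mul_distrib, h3, h3, prod_congr rfl h2,
    ← prod_pow, ← prod_pow]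
  congr 1
  exact prod_congr rfl fun s hs => by rw [inv_pow, inv_pow, h1 s hs]

/-! ### Change of the edge operators -/

variable (T) in
open Classical in
/-- The normalized minor of the differential parts of the edge operators in a 4-simplex. -/
noncomputable def simplexMinor (ω : C → (Fin 3 → V) → ℂ) (β : C → V → V → ℂ) (u : C) : ℂ :=
  if h : ∃ p, T.Spells u p then
    edgeMinor (T.localCocycle ω u h.choose) (T.localFamily β u h.choose) else 0

section Data

variable {o : C → (Fin 5 → V) → ℤ} {ω : T.cocycles} {K : C → (Fin 4 → V) → ℂ}
  {β β' : C → V → V → ℂ} {γ γ' : C → C → V → V → ℂ} {F F' : C → C → C → ℂ}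

theorem simplexMinor_eq (ho : T.IsOrientation o)
    (hω : ∀ s (p : Fin 3 → V), T.Spells s p → (ω : C → (Fin 3 → V) → ℂ) s p ≠ 0)
    (hK : T.IsSquareRoots ω K) (hE : T.IsEdgeOperators o ω K β γ) {u : C}
    {p : Fin 5 → V} (hp : T.Spells u p) : T.simplexMinor ω β u =
      edgeMinor (T.localCocycle ω u p) (T.localFamily β u p) := by
  have h : ∃ p, T.Spells u p := ⟨p, hp⟩
  obtain ⟨π, hπ⟩ := hp.exists_perm h.choose_spec
  have hpair := isEdgePair ho hω hK hE hp
  rw [simplexMinor, dif_pos h, hπ, localCocycle_comp, localFamily_comp,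
    edgeMinor_relabel hpair.cocycle hpair.left]

open Classical in
theorem IsEta.sq_eq (ho : T.IsOrientation o)
    (hω : ∀ s (p : Fin 3 → V), T.Spells s p → (ω : C → (Fin 3 → V) → ℂ) s p ≠ 0)
    (hK : T.IsSquareRoots ω K) (hE : T.IsEdgeOperators o ω K β γ) (hF : T.IsWeightMatrix β γ F)
    {num : V → ℕ} (hnum : Function.Injective num) {q η : C → ℂ} (hq : T.IsTriangleRoots ω K num q)
    (hη : T.IsEta o num β F q η) {u : C} (hu : u ∈ T.cells 5) :
    η u ^ 2 = T.simplexMinor ω β u *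
      (T.simplexSign o num u * ∏ s ∈ (T.cells 3).filter (· ≤ u), q s) := by
  obtain ⟨i, j, k, l, m, hp, ho1, hij, hD, h⟩ := hη u hu
  rw [h, simplexMinor_eq ho hω hK hE hp, simplexSign_eq ho num hp, ho1]
  refine (valueH_eq ho hω hK hE hF hnum hq hp hij hD).trans ?_
  push_cast
  ring

/-- The square of the quantity `I`. -/
theorem sq_value_eq (ho : T.IsOrientation o)
    (hω : ∀ s (p : Fin 3 → V), T.Spells s p → (ω : C → (Fin 3 → V) → ℂ) s p ≠ 0)
    (hK : T.IsSquareRoots ω K) (hE : T.IsEdgeOperators o ω K β γ) (hF : T.IsWeightMatrix β γ F)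
    {num : V → ℕ} (hnum : Function.Injective num) {q η : C → ℂ} (hq : T.IsTriangleRoots ω K num q)
    (hη : T.IsEta o num β F q η) (r : ℂ) :
    ((∏ s ∈ T.cells 3, (q s)⁻¹) * (∏ u ∈ T.cells 5, η u) * r) ^ 2 =
      T.rootFactor o num q * ((∏ u ∈ T.cells 5, T.simplexMinor ω β u) * r ^ 2) := by
  have h1 : (∏ u ∈ T.cells 5, η u) ^ 2 = _ :=
    (prod_pow (T.cells 5) 2 η).symm.trans
      (prod_congr rfl fun u hu => hη.sq_eq ho hω hK hE hF hnum hq hu)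
  rw [mul_pow, mul_pow, h1, prod_mul_distrib, rootFactor]
  ring

open Classical in
theorem exists_spells_oppositeTet {u t : C} (hu : u ∈ T.cells 5) (ht : t ∈ T.cells 4) (h : t ≤ u) :
    ∃ p, T.Spells u p ∧ T.oppositeTet u p 4 = t := by
  obtain ⟨p, hp⟩ := exists_spells (mem_filter.1 hu).2
  -- The product of a function that vanishes only at `t` is zero, so one of the five listed
  -- tetrahedra must be `t`.
  have h1 := hp.prod_tetrahedra (fun t' => if t' = t then (0 : ℕ) else 1)
  have h2 : ∏ t' ∈ (T.cells 4).filter (· ≤ u), (if t' = t then (0 : ℕ) else 1) = 0 :=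
    prod_eq_zero (i := t) (mem_filter.2 ⟨ht, h⟩) (if_pos rfl)
  rw [h2, eq_comm, prod_eq_zero_iff] at h1
  obtain ⟨a, -, ha⟩ := h1
  refine ⟨p ∘ Equiv.swap a 4, hp.comp_perm _, ?_⟩
  rw [oppositeTet_comp, Equiv.swap_apply_right]
  by_contra hne
  rw [if_neg hne] at ha
  exact one_ne_zero ha

/-- Two systems of edge operators differ by a scaling of the Grassmann variables only. -/
theorem IsEdgeOperators.exists_scale (hT : T.IsClosedFourManifold) (ho : T.IsOrientation o)
    (hω : ∀ s (p : Fin 3 → V), T.Spells s p → (ω : C → (Fin 3 → V) → ℂ) s p ≠ 0)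
    (hK : T.IsSquareRoots ω K) (hE : T.IsEdgeOperators o ω K β γ)
    (hE' : T.IsEdgeOperators o ω K β' γ') {t : C} (ht : t ∈ T.cells 4) :
    ∃ c : ℂ, c ≠ 0 ∧ (∀ i j, β' t i j = c * β t i j) ∧
      ∀ u ∈ T.cells 5, t ≤ u → ∀ i j, γ' u t i j = c⁻¹ * γ u t i j := by
  classical
  have h0 : 0 < T.cofaceCount 5 t := by rw [hT.cofaceCount_tetrahedron ht]; norm_num
  obtain ⟨u, huf⟩ := card_pos.1 h0
  obtain ⟨hu, hle⟩ := mem_filter.1 huf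
  clear huf
  have hex : ∀ {u : C}, u ∈ T.cells 5 → t ≤ u → ∀ {p : Fin 5 → V}, T.Spells u p →
      ∀ v ∈ T.vert t, ∃ i, p i = v := by
    intro u hu hle p hp v hv
    have h1 := T.vert_mono _ _ hle hv
    rw [← hp.2] at h1
    simpa using h1
  obtain ⟨p, hp, rfl⟩ := exists_spells_oppositeTet hu ht hle
  have hP := isEdgePair ho hω hK hE hp
  have hP' := isEdgePair ho hω hK hE' hp
  obtain ⟨c, hc, hcβ⟩ := hP.exists_scale hP'
  have hβ : ∀ i j, β' (T.oppositeTet u p 4) i j = c * β (T.oppositeTet u p 4) i j := by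
    intro x y
    by_cases hxy : x ∈ T.vert (T.oppositeTet u p 4) ∧ y ∈ T.vert (T.oppositeTet u p 4)
    · obtain ⟨i, rfl⟩ := hex hu hle hp x hxy.1
      obtain ⟨j, rfl⟩ := hex hu hle hp y hxy.2
      exact hcβ i j
    · rw [(hE.support u hu _ ht hle x y hxy).1, (hE'.support u hu _ ht hle x y hxy).1, mul_zero]
  refine ⟨c, hc, hβ, ?_⟩
  generalize T.oppositeTet u p 4 = t at *
  -- Since $\beta_t$ and $\beta'_t$ do not depend on the 4-simplex, the factor found in `u` scales
  -- $\gamma$ correctly in every other 4-simplex at `t`.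
  intro u' hu' hle' x y
  by_cases hxy : x ∈ T.vert t ∧ y ∈ T.vert t
  · obtain ⟨p', hp', rfl⟩ := exists_spells_oppositeTet hu' ht hle'
    obtain ⟨i, rfl⟩ := hex hu' hle' hp' x hxy.1
    obtain ⟨j, rfl⟩ := hex hu' hle' hp' y hxy.2
    exact (isEdgePair ho hω hK hE hp').scale_right (isEdgePair ho hω hK hE' hp') hc
      (fun i j => hβ _ _) i j
  · rw [(hE.support u' hu' _ ht hle' x y hxy).2, (hE'.support u' hu' _ ht hle' x y hxy).2, mul_zero]

/-- The scaling of the matrices `F`. -/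
theorem IsWeightMatrix.scale (ho : T.IsOrientation o)
    (hω : ∀ s (p : Fin 3 → V), T.Spells s p → (ω : C → (Fin 3 → V) → ℂ) s p ≠ 0)
    (hK : T.IsSquareRoots ω K) (hE : T.IsEdgeOperators o ω K β γ)
    (hF : T.IsWeightMatrix β γ F) (hF' : T.IsWeightMatrix β' γ' F') {c : C → ℂ}
    (hc : ∀ t ∈ T.cells 4, c t ≠ 0) (hβ : ∀ t ∈ T.cells 4, ∀ i j, β' t i j = c t * β t i j)
    (hγ : ∀ t ∈ T.cells 4, ∀ u ∈ T.cells 5, t ≤ u → ∀ i j, γ' u t i j = (c t)⁻¹ * γ u t i j)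
    {u t t' : C} (hu : u ∈ T.cells 5) (ht : t ∈ T.cells 4) (ht' : t' ∈ T.cells 4) (h : t ≤ u)
    (h' : t' ≤ u) : F' u t t' = (c t)⁻¹ * (c t')⁻¹ * F u t t' := by
  obtain ⟨p, hp, rfl⟩ := exists_spells_oppositeTet hu ht h
  have hcell : ∀ a, T.oppositeTet u p a ∈ T.cells 4 := fun a =>
    mem_filter.2 ⟨mem_univ _, hp.card_oppositeTet a⟩
  have hle : ∀ a, T.oppositeTet u p a ≤ u := fun a => (hp.oppositeTet_spec a).1
  have hP := isEdgePair ho hω hK hE hp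
  -- The rescaled column of `F'` and the column of `F` have the same products with all edge rows of
  -- $\beta$. These rows have full rank, so the columns coincide.
  have h1 := hP.eq_zero_of_sum_eq_zero (hF.localFamily_eq hp)
    (x := fun a => c (T.oppositeTet u p a) * F' u (T.oppositeTet u p a) t' * c t' -
      F u (T.oppositeTet u p a) t') ?_
  · have h2 := congrFun h1 4
    simp only [Pi.zero_apply] at h2
    have h3 := hc _ (hcell 4)
    have h4 := hc _ ht'
    field_simp
    linear_combination h2
  · intro i j
    have e1 := hF.annihilate u hu t' ht' h' _ (hp.mem i) _ (hp.mem j)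
    have e2 := hF'.annihilate u hu t' ht' h' _ (hp.mem i) _ (hp.mem j)
    rw [hp.sum_tetrahedra] at e1 e2
    rw [hγ t' ht' u hu h'] at e2
    have e3 : ∑ a, β' (T.oppositeTet u p a) (p i) (p j) * F' u (T.oppositeTet u p a) t' =
        ∑ a, c (T.oppositeTet u p a) * (β (T.oppositeTet u p a) (p i) (p j) *
          F' u (T.oppositeTet u p a) t') :=
      sum_congr rfl fun a _ => by rw [hβ _ (hcell a)]; ring
    rw [e3] at e2
    have e4 : ∑ a, T.localFamily β u p a i j * (c (T.oppositeTet u p a) *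
        F' u (T.oppositeTet u p a) t' * c t' - F u (T.oppositeTet u p a) t') =
        c t' * ∑ a, c (T.oppositeTet u p a) * (β (T.oppositeTet u p a) (p i) (p j) *
          F' u (T.oppositeTet u p a) t') -
        ∑ a, β (T.oppositeTet u p a) (p i) (p j) * F u (T.oppositeTet u p a) t' := by
      rw [mul_sum, ← sum_sub_distrib]
      exact sum_congr rfl fun a _ => by simp only [localFamily]; ring
    rw [e4, ← e2, ← e1, mul_inv_cancel_left₀ (hc t' ht'), sub_self]

-- Each column of the edge matrix belongs to one tetrahedron and is multiplied by its factor;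
-- $\omega$ and hence the denominator do not change.
open Classical in
theorem simplexMinor_scale (ho : T.IsOrientation o)
    (hω : ∀ s (p : Fin 3 → V), T.Spells s p → (ω : C → (Fin 3 → V) → ℂ) s p ≠ 0)
    (hK : T.IsSquareRoots ω K) (hE : T.IsEdgeOperators o ω K β γ)
    (hE' : T.IsEdgeOperators o ω K β' γ') {c : C → ℂ}
    (hβ : ∀ t ∈ T.cells 4, ∀ i j, β' t i j = c t * β t i j) {u : C} (hu : u ∈ T.cells 5) :
    T.simplexMinor ω β' u =
      (∏ t ∈ (T.cells 4).filter (· ≤ u), c t) * T.simplexMinor ω β u := by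
  obtain ⟨p, hp⟩ := exists_spells (mem_filter.1 hu).2
  rw [simplexMinor_eq ho hω hK hE hp, simplexMinor_eq ho hω hK hE' hp, hp.prod_tetrahedra,
    edgeMinor, edgeMinor, ← mul_div_assoc, ← Matrix.det_mul_row]
  congr 2
  ext x a
  have h1 : ∀ i j, T.localFamily β' u p a i j =
      c (T.oppositeTet u p a) * T.localFamily β u p a i j := fun i j =>
    hβ _ (mem_filter.2 ⟨mem_univ _, hp.card_oppositeTet a⟩) _ _
  fin_cases x <;> exact h1 _ _

theorem f₂_scale {ι : Type*} (bas : Module.Basis ι ℂ T.cocycles) {c : C → ℂ}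
    (hβ : ∀ t ∈ T.cells 4, ∀ i j, β' t i j = c t * β t i j) (t : T.Tet) (a : ι) :
    T.f₂ bas β' t a = c t * T.f₂ bas β t a := by
  simp only [f₂, cochainPairing, Matrix.of_apply, mul_sum, hβ _ t.2]
  exact sum_congr rfl fun _ _ => sum_congr rfl fun _ _ => sum_congr rfl fun _ _ => by ring

end Data

end Triangulation

/-! ### The values of $I$: equality of squares, both signs, and existence for every numbering. -/

theorem IsAcyclic.products_eq_zero {ι τ : Type*} [Fintype ι] [Fintype τ] {f₁ : Matrix ι Unit ℂ}
    {f₂ : Matrix τ ι ℂ} {f₃ : Matrix τ τ ℂ} (h : IsAcyclic f₁ f₂ f₃) :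
    f₂ * f₁ = 0 ∧ f₃ * f₂ = 0 ∧ f₂.transpose * f₃ = 0 := by
  refine ⟨?_, ?_, ?_⟩ <;> refine Matrix.mulVec_injective (funext fun x => ?_) <;>
    rw [← Matrix.mulVec_mulVec, Matrix.zero_mulVec]
  · exact h.exact₁₂.apply_apply_eq_zero x
  · exact h.exact₂₃.apply_apply_eq_zero x
  · exact h.exact₃₄.apply_apply_eq_zero x

namespace Triangulation

variable {V C ι : Type*} [DecidableEq V] [PartialOrder C] [Fintype C] [Fintype ι]
  {T : Triangulation V C} {o : C → (Fin 5 → V) → ℤ} {ω : T.cocycles} {K : C → (Fin 4 → V) → ℂ}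
  {bas : Module.Basis ι ℂ T.cocycles} {num num' : V → ℕ} {x x' : ℂ}

theorem IsValueI.sq_eq_sq (hT : T.IsClosedFourManifold) (ho : T.IsOrientation o)
    (hω : ∀ s (p : Fin 3 → V), T.Spells s p → (ω : C → (Fin 3 → V) → ℂ) s p ≠ 0)
    (hK : T.IsSquareRoots ω K) (hnum : Function.Injective num) (hnum' : Function.Injective num')
    (hx : T.IsValueI o ω K bas num x) (hx' : T.IsValueI o ω K bas num' x') : x' ^ 2 = x ^ 2 := by
  classical
  obtain ⟨β, γ, F, q, η, r, hE, hF, hA, hq, hη, hr, rfl⟩ := hx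
  obtain ⟨β', γ', F', q', η', r', hE', hF', hA', hq', hη', hr', rfl⟩ := hx'
  -- The roots `q'` are first compared with the flipped roots `q`, which belong to the same
  -- numbering, and then the flip itself is undone.
  rw [sq_value_eq ho hω hK hE hF hnum hq hη, sq_value_eq ho hω hK hE' hF' hnum' hq' hη',
    (hq.flip hK hnum hnum').rootFactor_eq hT hnum' hq', rootFactor_flip hT ho hnum hnum']
  congr 1
  have hscale : ∀ t, ∃ c : ℂ, t ∈ T.cells 4 → (c ≠ 0 ∧ (∀ i j, β' t i j = c * β t i j) ∧
      ∀ u ∈ T.cells 5, t ≤ u → ∀ i j, γ' u t i j = c⁻¹ * γ u t i j) := by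
    intro t
    by_cases ht : t ∈ T.cells 4
    · obtain ⟨c, hc⟩ := hE.exists_scale hT ho hω hK hE' ht
      exact ⟨c, fun _ => hc⟩
    · exact ⟨0, fun h => absurd h ht⟩
  choose c hc using hscale
  have hβ : ∀ t ∈ T.cells 4, ∀ i j, β' t i j = c t * β t i j := fun t ht => (hc t ht).2.1
  have h3 : ∀ t t' : T.Tet, T.f₃ F' t t' = (c t)⁻¹ * (c t')⁻¹ * T.f₃ F t t' := by
    intro t t'
    simp only [f₃, Matrix.of_apply]
    rw [sum_congr rfl fun u hu => hF.scale ho hω hK hE hF' (fun t ht => (hc t ht).1) hβ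
      (fun t ht => (hc t ht).2.2) (mem_filter.1 hu).1 t.2 t'.2 (mem_filter.1 hu).2.1
      (mem_filter.1 hu).2.2, ← mul_sum]
    ring
  have h4 := hr.scale (c := fun t : T.Tet => c t) (fun t => (hc t t.2).1)
    (fun t a => f₂_scale bas hβ t a) h3
  obtain ⟨h5, h6, h7⟩ := hA'.products_eq_zero
  have h8 := h4.eq_or_eq_neg h5 h6 h7 hr'
  -- The product of the $c_t$ enters $\tau$ with the exponent $-2$; below it enters the product of
  -- the minors with the exponent $2$, since every tetrahedron lies in two 4-simplices.
  have h9 : r' ^ 2 = ((∏ t ∈ T.cells 4, c t) ^ 2)⁻¹ * r ^ 2 := by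
    rw [← sq_eq_sq_iff_eq_or_eq_neg] at h8
    rw [h8, mul_pow, inv_pow, prod_coe_sort (T.cells 4) c]
  have h10 : ∏ u ∈ T.cells 5, T.simplexMinor ω β' u =
      (∏ t ∈ T.cells 4, c t) ^ 2 * ∏ u ∈ T.cells 5, T.simplexMinor ω β u := by
    rw [prod_congr rfl fun u hu => simplexMinor_scale ho hω hK hE hE' hβ hu, prod_mul_distrib,
      prod_prod_cells, ← prod_pow]
    congr 1
    exact prod_congr rfl fun t ht => by rw [hT.cofaceCount_tetrahedron ht]
  have h11 : ∏ t ∈ T.cells 4, c t ≠ 0 := prod_ne_zero_iff.2 fun t ht => (hc t ht).1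
  rw [h9, h10]
  field_simp

/-- The empty triangulation has to be excluded, since the sign of $I$ is changed through a
4-simplex. Without simplices $\omega=0$ and $f_1$ would not be injective. -/
theorem IsValueI.nonempty (hx : T.IsValueI o ω K bas num x) : Nonempty C := by
  obtain ⟨β, γ, F, q, η, r, hE, hF, hA, -⟩ := hx
  by_contra hC
  rw [not_nonempty_iff] at hC
  have h1 : ω = 0 := Subtype.ext (Subsingleton.elim _ _)
  have h2 : T.f₁ bas ω = 0 := by
    ext a b
    simp [f₁, h1]
  have h3 := hA.injective
  rw [h2] at h3
  have h4 := @h3 0 1 (by simp)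
  simpa using congrFun h4 ()

theorem IsValueI.neg (hT : T.IsClosedFourManifold) (hx : T.IsValueI o ω K bas num x) :
    T.IsValueI o ω K bas num (-x) := by
  classical
  have := hx.nonempty
  obtain ⟨u, hu⟩ := hT.exists_cell_five
  obtain ⟨β, γ, F, q, η, r, hE, hF, hA, hq, hη, hr, rfl⟩ := hx
  -- The sign of a single $\eta_u$ is changed.
  refine ⟨β, γ, F, q, fun v => (if v = u then -1 else 1) * η v, r, hE, hF, hA, hq, ?_, hr, ?_⟩
  · intro v hv
    obtain ⟨i, j, k, l, m, h1, h2, h3, h4, h5⟩ := hη v hv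
    refine ⟨i, j, k, l, m, h1, h2, h3, h4, ?_⟩
    rw [mul_pow, h5]
    split_ifs <;> simp
  · rw [prod_mul_distrib, prod_ite_eq' , if_pos hu]
    ring

/-- The value for another numbering that is calculated with the same edge operators. -/
theorem IsValueI.exists_renumber (ho : T.IsOrientation o) (hK : T.IsSquareRoots ω K)
    (hnum : Function.Injective num) (hnum' : Function.Injective num')
    (hx : T.IsValueI o ω K bas num x) : ∃ y, T.IsValueI o ω K bas num' y := by
  obtain ⟨β, γ, F, q, η, r, hE, hF, hA, hq, hη, hr, rfl⟩ := hx
  set q' : C → ℂ := fun s => q s * T.flip num num' s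
  have h : ∀ u, ∃ z : ℂ, u ∈ T.cells 5 → ∃ i j k l m, T.Spells u ![i, j, k, l, m] ∧
      o u ![i, j, k, l, m] = 1 ∧ num' i < num' j ∧ T.denominatorH F u i j k l m ≠ 0 ∧
      z ^ 2 = T.valueH β F q' u i j k l m := by
    intro u
    by_cases hu : u ∈ T.cells 5
    · obtain ⟨i, j, k, l, m, h1, h2, h3, h4, -⟩ := hη u hu
      have hij : i ≠ j := fun h => by rw [h] at h3; exact lt_irrefl _ h3
      rcases lt_or_gt_of_ne (hnum'.ne hij) with h5 | h5
      · obtain ⟨z, hz⟩ := IsAlgClosed.exists_pow_nat_eq (T.valueH β F q' u i j k l m) two_pos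
        exact ⟨z, fun _ => ⟨i, j, k, l, m, h1, h2, h5, h4, hz⟩⟩
      -- If the new numbering reverses the edge, $i,j$ and also $k,l$ are exchanged. This even
      -- permutation keeps the orientation, and the denominator is the same minor of `F`, hence
      -- still nonzero.
      · obtain ⟨z, hz⟩ := IsAlgClosed.exists_pow_nat_eq (T.valueH β F q' u j i l k m) two_pos
        have h6 : ![j, i, l, k, m] = ![i, j, k, l, m] ∘
            (Equiv.swap 0 1 * Equiv.swap 2 3 : Equiv.Perm (Fin 5)) := by
          funext a
          fin_cases a <;> rfl
        have hface : ∀ a b c d : V, T.face u ![a, b, d, c] = T.face u ![a, b, c, d] := by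
          intro a b c d
          rw [← face_comp_perm u ![a, b, c, d] (Equiv.swap 2 3)]
          congr 1
          funext x
          fin_cases x <;> rfl
        have hface' : ∀ a b c d : V, T.face u ![b, a, c, d] = T.face u ![a, b, c, d] := by
          intro a b c d
          rw [← face_comp_perm u ![a, b, c, d] (Equiv.swap 0 1)]
          congr 1
          funext x
          fin_cases x <;> rfl
        have hface'' : ∀ a b c d : V, T.face u ![a, c, b, d] = T.face u ![a, b, c, d] := by
          intro a b c d
          rw [← face_comp_perm u ![a, b, c, d] (Equiv.swap 1 2)]
          congr 1
          funext x
          fin_cases x <;> rfl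
        refine ⟨z, fun _ => ⟨j, i, l, k, m, ?_, ?_, h5, ?_, hz⟩⟩
        · rw [h6]; exact h1.comp_perm _
        · rw [h6, ho.perm u _ h1, h2, Equiv.Perm.sign_mul, Equiv.Perm.sign_swap (by decide),
            Equiv.Perm.sign_swap (by decide)]
          rfl
        · have h7 : T.denominatorH F u j i l k m = T.denominatorH F u i j k l m := by
            simp only [denominatorH]
            rw [hface'' j k l m, hface'' i k l m, hface' i j l m, hface' i j k m]
            ring
          rw [h7]
          exact h4
    · exact ⟨0, fun h => absurd h hu⟩
  choose η' hη' using h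
  exact ⟨_, β, γ, F, q', η', r, hE, hF, hA, hq.flip hK hnum hnum', hη', hr, rfl⟩

end Triangulation

end ExoticTorsion

theorem theorem6p2 {V C ι : Type*} [DecidableEq V] [PartialOrder C] [Fintype C] [Fintype ι]
    (T : ExoticTorsion.Triangulation V C) (hT : T.IsClosedFourManifold)
    (o : C → (Fin 5 → V) → ℤ) (ho : T.IsOrientation o)
    (ω : T.cocycles)
    (hω : ∀ s (p : Fin 3 → V), T.Spells s p → (ω : C → (Fin 3 → V) → ℂ) s p ≠ 0)
    (K : C → (Fin 4 → V) → ℂ) (hK : T.IsSquareRoots ω K)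
    (bas : Module.Basis ι ℂ T.cocycles)
    (num num' : V → ℕ) (hnum : Function.Injective num) (hnum' : Function.Injective num')
    (x : ℂ) (hx : T.IsValueI o ω K bas num x) (x' : ℂ) :
    T.IsValueI o ω K bas num' x' ↔ x' = x ∨ x' = -x := by
  constructor
  · intro hx'
    exact sq_eq_sq_iff_eq_or_eq_neg.1 (hx.sq_eq_sq hT ho hω hK hnum hnum' hx')
  · intro h
    obtain ⟨y, hy⟩ := hx.exists_renumber ho hK hnum hnum'
    have h1 := hx.sq_eq_sq hT ho hω hK hnum hnum' hy
    have h2 : x' ^ 2 = y ^ 2 := by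
      rw [h1]
      exact sq_eq_sq_iff_eq_or_eq_neg.2 h
    rcases sq_eq_sq_iff_eq_or_eq_neg.1 h2 with rfl | rfl
    · exact hy
    · exact hy.neg hT
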